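/- Notation. Let $[n]=\{1,\dots,n\}$ (and read $[m]\cap[n]$ for $[m]$ if $m>n$). For $0<p<1$ and $\mathcal F\subset\mathcal P([n])$ let $\mu_p(\mathcal F)=\sum_{A\in\mathcal F}p^{|A|}(1-p)^{n-|A|}$. The family $\mathcal F$ is $t$-intersecting if $|A\cap B|\ge t$ for all $A,B\in\mathcal F$. Families $\mathcal F,\mathcal G\subset\mathcal P([n])$ are isomorphic, $\mathcal F\cong\mathcal G$, if $\mathcal G=\{\sigma(S):S\in\mathcal F\}$ for some permutation $\sigma$ of $[n]$. For $r\in\mathbb N\cup\{0\}$ let $\mathcal F_{n,t,r}=\{S\subset[n]:|S\cap[t+2r]|\ge t+r\}$, and let $f(n,p,t)=\max_{r\ge 0}\mu_p(\mathcal F_{n,t,r})$. For $n\ge t+2r+s$ let $\mathcal H_{n,t,r,s}$ be the family of all $A\subset[n]$ such that either $|A\cap[t+2r]|\ge t+r$ and $A\cap\{t+2r+1,\dots,t+2r+s\}\ne\emptyset$, or $|A\cap[t+2r]|=t+r-1$ and $\{t+2r+1,\dots,t+2r+s\}\subset A$. For $t=1$, $r=0$ the fraction $\frac{r}{t+2r-1}$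 is read as $0$. Theorem. Let $t\ge1$ be an integer and let $\zeta>0$. (Stability) There exists $C=C(t,\zeta)>0$ such that the following holds. Let $n\ge 0$, let $p\in[\zeta,\frac12-\zeta]$, let $\epsilon>0$, and let $\mathcal F\subset\mathcal P([n])$ be a $t$-intersecting family with $\mu_p(\mathcal F)\ge f(n,p,t)(1-\epsilon)$. Then there exist $r\ge 0$ and $\mathcal G\cong\mathcal F_{n,t,r}$ such that $$\mu_p(\mathcal F\setminus\mathcal G)\le C\epsilon^{\log_{1-p}p}.$$ Moreover, if $\frac{r^*}{t+2r^*-1}+\zeta<p<\frac{r^*+1}{t+2r^*+1}-\zeta$ for some integer $r^*\ge0$ with $t+2r^*\le n$, then this holds with some $\mathcal G\cong\mathcal F_{n,t,r^*}$. (Tightness) There exist $c=c(t,\zeta)>0$ and $s_0=s_0(t,\zeta)$ such that for all $p\in[\zeta,\frac12-\zeta]$, all integers $r\ge0$ with $\frac{r}{t+2r-1}\le p\le\frac{r+1}{t+2r+1}$, all $s\ge s_0$ and all $n\ge t+2r+s$, the following holds with $\epsilon=(1-p)^s$: the family $\mathcal H_{n,t,r,s}$ is $t$-intersecting, $\mu_p(\mathcal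 H_{n,t,r,s})\ge f(n,p,t)(1-\epsilon)$, and $$\mu_p(\mathcal H_{n,t,r,s}\setminus\mathcal G)\ge c\,\epsilon^{\log_{1-p}p}$$ for every $r'\ge0$ and every $\mathcal G\cong\mathcal F_{n,t,r'}$. -/

import Mathlib

/-- The ground set `[n] = {1, …, n}` is `Fin n` (the element `i : Fin n` stands for `i + 1`), and a
family of subsets of `[n]` is a `Finset (Finset (Fin n))`. This is the initial segment
`[m] ∩ [n]` of the ground set. -/
def initSeg (n m : ℕ) : Finset (Fin n) :=
  Finset.univ.filter fun i => i.val < m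

/-- A family is `t`-intersecting if `|A ∩ B| ≥ t` for all members `A`, `B` (equal or not). -/
def TIntersecting {n : ℕ} (t : ℕ) (F : Finset (Finset (Fin n))) : Prop :=
  ∀ A ∈ F, ∀ B ∈ F, t ≤ (A ∩ B).card

/-- The `p`-biased measure of a family of subsets of `[n]`. -/
noncomputable def biasedMeasure {n : ℕ} (p : ℝ) (F : Finset (Finset (Fin n))) : ℝ :=
  ∑ A ∈ F, p ^ A.card * (1 - p) ^ (n - A.card)

/-- Two families are isomorphic if some permutation of the ground set carries one to the other. -/
def FamilyIso {n : ℕ} (F G : Finset (Finset (Fin n))) : Prop :=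
  ∃ σ : Equiv.Perm (Fin n), G = F.image fun S => S.image σ

/-- The family `{S ⊆ [n] : |S ∩ [t + 2r]| ≥ t + r}`. -/
def akFamily (n t r : ℕ) : Finset (Finset (Fin n)) :=
  Finset.univ.filter fun S => t + r ≤ (S ∩ initSeg n (t + 2 * r)).card

/-- The maximum over `r ≥ 0` of the `p`-biased measures of the families `akFamily n t r`. -/
noncomputable def akMax (n : ℕ) (p : ℝ) (t : ℕ) : ℝ :=
  ⨆ r : ℕ, biasedMeasure p (akFamily n t r)

/-- The supremum in `akMax` is an attained maximum. -/
theorem akMax_isGreatest (n : ℕ) (p : ℝ) (t : ℕ) :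
    IsGreatest (Set.range fun r : ℕ => biasedMeasure p (akFamily n t r)) (akMax n p t) := by
  have hfin : (Set.range fun r : ℕ => biasedMeasure p (akFamily n t r)).Finite :=
    (Set.finite_range fun F : Finset (Finset (Fin n)) => biasedMeasure p F).subset (by
      rintro _ ⟨r, rfl⟩
      exact ⟨akFamily n t r, rfl⟩)
  refine ⟨(Set.range_nonempty _).csSup_mem hfin, ?_⟩
  rintro _ ⟨r, rfl⟩
  exact le_ciSup hfin.bddAbove r

/-- The family of all `A ⊆ [n]` such that either `|A ∩ [t + 2r]| ≥ t + r` and `A` meets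
`{t + 2r + 1, …, t + 2r + s}`, or `|A ∩ [t + 2r]| = t + r - 1` and `A` contains
`{t + 2r + 1, …, t + 2r + s}`. -/
def noisyFamily (n t r s : ℕ) : Finset (Finset (Fin n)) :=
  Finset.univ.filter fun A =>
    (t + r ≤ (A ∩ initSeg n (t + 2 * r)).card ∧
      (A ∩ (initSeg n (t + 2 * r + s) \ initSeg n (t + 2 * r))).Nonempty) ∨
    ((A ∩ initSeg n (t + 2 * r)).card + 1 = t + r ∧
      initSeg n (t + 2 * r + s) \ initSeg n (t + 2 * r) ⊆ A)

/-! Write `q = 1 - p` and `a = log_q p`, so that `a > 1` because `p < 1/2`. The exponent comes from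
one inequality: if `F` and an up-closed `G` are cross-intersecting, then `μ(G) ≤ (1 - μ(F)) ^ a`
(`cross_intersecting_ineq`, applied to slices in `IsExponent.slice_le`).

Bootstrapping. Let `G` be a core family with core `M`, and let `x = μ(F \ G)`. Every trace on `M`
too small to lie in `G` has a partner trace inside `G` meeting it in fewer than `t` points, so the
two slices of `F` are cross-intersecting and `x ≤ (μ(G \ F) / κ) ^ a ≤ ((ε + x) / κ) ^ a`. Since `a`
is bounded away from `1`, either `x = O(ε ^ a)` or `x` exceeds a constant (`exists_bootstrap`). It
therefore suffices to show that `F` is within a small constant of some core family.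

Weak stability. Take a counterexample of largest measure and compress it. Closeness to a core can be
pulled back along a shift (`exists_shift_back`), so the counterexample may be assumed shifted and
up-closed, while all `t`-intersecting families of larger measure are close to a core
(`exists_extremal_counterexample`). If the family depends on boundedly many coordinates, only
finitely many families are in question, and compactness in `p` reduces the claim to the exact
complete intersection theorem (`exists_core_of_maximal`). That theorem is proved by the same
extremal scheme with the two Ahlswede–Khachatrian exchanges: deleting the last relevant coordinate
(`improvable_or`) and enlarging the initial segment of symmetry
(`notMaximal_or_of_not_symmetricOn`). If the last relevant coordinate is far out, deleting it gives
a larger family differing from the old one by sets that are at least half full on a long segment,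
which have tiny measure. The larger family is close to a core, hence so is the original
(`exists_stability`).

The specific `r*` is forced because consecutive families `akFamily n t r` differ by an explicit
multiple of `(t + 2r + 1) p - (r + 1)`, so a parameter in the interior of its range wins by a fixed
margin. For tightness, `noisyFamily` loses a fraction at most `q ^ s` of `akFamily` and gains sets
of measure of order `p ^ s = (q ^ s) ^ a`; all other core families are at constant distance. -/

namespace BiasedIntersection

open Finset

variable {n : ℕ} {p : ℝ}

/-! ### The biased measure -/

theorem biasedMeasure_nonneg (h0 : 0 ≤ p) (h1 : p ≤ 1) (F : Finset (Finset (Fin n))) :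
    0 ≤ biasedMeasure p F :=
  sum_nonneg fun _ _ => mul_nonneg (pow_nonneg h0 _) (pow_nonneg (by linarith) _)

theorem biasedMeasure_mono (h0 : 0 ≤ p) (h1 : p ≤ 1) {F G : Finset (Finset (Fin n))}
    (h : F ⊆ G) : biasedMeasure p F ≤ biasedMeasure p G :=
  sum_le_sum_of_subset_of_nonneg h fun _ _ _ =>
    mul_nonneg (pow_nonneg h0 _) (pow_nonneg (by linarith) _)

theorem biasedMeasure_univ : biasedMeasure p (univ : Finset (Finset (Fin n))) = 1 := by
  have := Fintype.sum_pow_mul_eq_add_pow (Fin n) p (1 - p)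
  simpa [biasedMeasure] using this

theorem biasedMeasure_le_one (h0 : 0 ≤ p) (h1 : p ≤ 1) (F : Finset (Finset (Fin n))) :
    biasedMeasure p F ≤ 1 :=
  (biasedMeasure_mono h0 h1 (subset_univ F)).trans_eq biasedMeasure_univ

theorem biasedMeasure_empty : biasedMeasure p (∅ : Finset (Finset (Fin n))) = 0 := rfl

theorem biasedMeasure_inter_add_sdiff (F G : Finset (Finset (Fin n))) :
    biasedMeasure p (F ∩ G) + biasedMeasure p (F \ G) = biasedMeasure p F :=
  sum_inter_add_sum_sdiff F G _

theorem biasedMeasure_union_of_disjoint {F G : Finset (Finset (Fin n))} (h : Disjoint F G) :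
    biasedMeasure p (F ∪ G) = biasedMeasure p F + biasedMeasure p G :=
  sum_union h

theorem biasedMeasure_union_le (h0 : 0 ≤ p) (h1 : p ≤ 1) (F G : Finset (Finset (Fin n))) :
    biasedMeasure p (F ∪ G) ≤ biasedMeasure p F + biasedMeasure p G := by
  rw [← sdiff_union_self_eq_union, biasedMeasure_union_of_disjoint sdiff_disjoint]
  gcongr
  exact biasedMeasure_mono h0 h1 sdiff_subset

theorem biasedMeasure_compl (F : Finset (Finset (Fin n))) :
    biasedMeasure p Fᶜ = 1 - biasedMeasure p F := by
  have := biasedMeasure_union_of_disjoint (p := p) (disjoint_compl_right (a := F))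
  rw [union_compl, biasedMeasure_univ] at this
  linarith

theorem biasedMeasure_sdiff_of_subset {F G : Finset (Finset (Fin n))} (h : G ⊆ F) :
    biasedMeasure p (F \ G) = biasedMeasure p F - biasedMeasure p G := by
  have := biasedMeasure_inter_add_sdiff (p := p) F G
  rw [inter_eq_right.2 h] at this
  linarith

theorem biasedMeasure_sdiff_comm (F G : Finset (Finset (Fin n))) :
    biasedMeasure p (G \ F) = biasedMeasure p G - biasedMeasure p F + biasedMeasure p (F \ G) := by
  have h1 := biasedMeasure_inter_add_sdiff (p := p) F G
  have h2 := biasedMeasure_inter_add_sdiff (p := p) G F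
  rw [inter_comm] at h2
  linarith

theorem biasedMeasure_pos (h0 : 0 < p) (h1 : p < 1) {F : Finset (Finset (Fin n))}
    (h : F.Nonempty) : 0 < biasedMeasure p F :=
  sum_pos (fun _ _ => mul_pos (pow_pos h0 _) (pow_pos (by linarith) _)) h

theorem eq_empty_of_biasedMeasure_nonpos (h0 : 0 < p) (h1 : p < 1) {F : Finset (Finset (Fin n))}
    (h : biasedMeasure p F ≤ 0) : F = ∅ := by
  by_contra hne
  exact absurd (biasedMeasure_pos h0 h1 (nonempty_iff_ne_empty.2 hne)) (not_lt.2 h)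

theorem biasedMeasure_image_of_card_eq {f : Finset (Fin n) → Finset (Fin n)}
    {F : Finset (Finset (Fin n))} (hf : Set.InjOn f F) (hc : ∀ A ∈ F, (f A).card = A.card) :
    biasedMeasure p (F.image f) = biasedMeasure p F := by
  unfold biasedMeasure
  rw [sum_image hf]
  exact sum_congr rfl fun A hA => by rw [hc A hA]

/-- Removing an element `e` from all members of a family multiplies the measure by `(1 - p) / p`. -/
theorem biasedMeasure_image_erase {e : Fin n} {F : Finset (Finset (Fin n))}
    (he : ∀ A ∈ F, e ∈ A) :
    p * biasedMeasure p (F.image fun A => A.erase e) = (1 - p) * biasedMeasure p F := by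
  unfold biasedMeasure
  rw [sum_image, mul_sum, mul_sum]
  · refine sum_congr rfl fun A hA => ?_
    have h1 := card_erase_add_one (he A hA)
    have h2 : A.card ≤ n := (card_le_univ A).trans_eq (Fintype.card_fin n)
    have h3 : n - (A.erase e).card = (n - A.card) + 1 := by omega
    rw [h3, ← h1]; ring_nf
  · intro A hA B hB hAB
    dsimp only at hAB
    rw [← insert_erase (he A hA), hAB, insert_erase (he B hB)]

/-! ### Slices -/

/-- The slice of `F` in which the trace on `K` is fixed to be `C`, as a family that does not depend
on the coordinates in `K`. -/
def slice (F : Finset (Finset (Fin n))) (K C : Finset (Fin n)) : Finset (Finset (Fin n)) :=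
  univ.filter fun A => A \ K ∪ C ∈ F

@[simp] theorem mem_slice {F : Finset (Finset (Fin n))} {K C A : Finset (Fin n)} :
    A ∈ slice F K C ↔ A \ K ∪ C ∈ F := by simp [slice]

theorem sum_split (K : Finset (Fin n)) (g : Finset (Fin n) → ℝ) :
    ∑ A, g A = ∑ B ∈ K.powerset, ∑ S ∈ Kᶜ.powerset, g (B ∪ S) := by
  rw [← sum_product']
  refine sum_nbij' (fun A => (A ∩ K, A ∩ Kᶜ)) (fun x => x.1 ∪ x.2) ?_ ?_ ?_ ?_ ?_
  · intro A _
    simp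
  · simp
  · intro A _
    rw [← inter_union_distrib_left, union_compl, inter_univ]
  · rintro ⟨B, S⟩ h
    simp only [mem_product, mem_powerset] at h
    have hS : ∀ x ∈ S, x ∉ K := fun x hx => by simpa using h.2 hx
    ext x <;> simp only [mem_inter, mem_union, mem_compl]
    · constructor
      · rintro ⟨hx | hx, hk⟩
        · exact hx
        · exact absurd hk (hS x hx)
      · exact fun hx => ⟨Or.inl hx, h.1 hx⟩
    · constructor
      · rintro ⟨hx | hx, hk⟩
        · exact absurd (h.1 hx) hk
        · exact hx
      · exact fun hx => ⟨Or.inr hx, hS x hx⟩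
  · intro A _
    rw [← inter_union_distrib_left, union_compl, inter_univ]

theorem biasedMeasure_eq_sum_ite (F : Finset (Finset (Fin n))) :
    biasedMeasure p F = ∑ A, if A ∈ F then p ^ A.card * (1 - p) ^ (n - A.card) else 0 := by
  simp [biasedMeasure]

theorem weight_union {K B S : Finset (Fin n)} (hB : B ⊆ K) (hS : S ⊆ Kᶜ) :
    p ^ (B ∪ S).card * (1 - p) ^ (n - (B ∪ S).card) =
      (p ^ B.card * (1 - p) ^ (K.card - B.card)) *
        (p ^ S.card * (1 - p) ^ (Kᶜ.card - S.card)) := by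
  have hd : Disjoint B S := (disjoint_compl_right (a := K)).mono hB hS
  have h1 := card_le_card hB
  have h2 := card_le_card hS
  have h3 := card_compl_add_card K
  rw [Fintype.card_fin] at h3
  rw [card_union_of_disjoint hd]
  have : n - (B.card + S.card) = (K.card - B.card) + (Kᶜ.card - S.card) := by omega
  rw [this]; ring

/-- The coordinates inside and outside `K` are independent. Since a slice ignores `K`, its measure
on the whole cube is the conditional measure given the trace `C`. -/
theorem biasedMeasure_slice (F : Finset (Finset (Fin n))) {K C : Finset (Fin n)} (hC : C ⊆ K) :
    biasedMeasure p (F.filter fun A => A ∩ K = C) =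
      p ^ C.card * (1 - p) ^ (K.card - C.card) * biasedMeasure p (slice F K C) := by
  have key : biasedMeasure p (slice F K C) =
      ∑ S ∈ Kᶜ.powerset, if C ∪ S ∈ F then p ^ S.card * (1 - p) ^ (Kᶜ.card - S.card) else 0 := by
    rw [biasedMeasure_eq_sum_ite, sum_split K]
    have : ∀ B ∈ K.powerset, ∑ S ∈ Kᶜ.powerset, (if B ∪ S ∈ slice F K C then
        p ^ (B ∪ S).card * (1 - p) ^ (n - (B ∪ S).card) else 0) =
        (p ^ B.card * (1 - p) ^ (K.card - B.card)) * ∑ S ∈ Kᶜ.powerset,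
        if C ∪ S ∈ F then p ^ S.card * (1 - p) ^ (Kᶜ.card - S.card) else 0 := by
      intro B hB
      rw [mem_powerset] at hB
      rw [mul_sum]
      refine sum_congr rfl fun S hS => ?_
      rw [mem_powerset] at hS
      have : (B ∪ S) \ K ∪ C = C ∪ S := by
        rw [union_sdiff_distrib, sdiff_eq_empty_iff_subset.2 hB, empty_union, union_comm,
          sdiff_eq_self_of_disjoint (disjoint_compl_right.mono_right hS).symm]
      simp only [mem_slice, this, weight_union hB hS]
      split_ifs <;> simp
    rw [sum_congr rfl this, ← sum_mul, sum_pow_mul_eq_add_pow]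
    simp
  rw [key, biasedMeasure_eq_sum_ite, sum_split K, sum_eq_single C]
  · rw [mul_sum]
    refine sum_congr rfl fun S hS => ?_
    rw [mem_powerset] at hS
    have : (C ∪ S) ∩ K = C := by
      rw [union_inter_distrib_right, inter_eq_left.2 hC,
        disjoint_iff_inter_eq_empty.1 (disjoint_compl_right.mono_right hS).symm, union_empty]
    rw [weight_union hC hS]
    simp [this]
  · intro B hB hne
    rw [mem_powerset] at hB
    refine sum_eq_zero fun S hS => ?_
    rw [mem_powerset] at hS
    have : (B ∪ S) ∩ K = B := by
      rw [union_inter_distrib_right, inter_eq_left.2 hB,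
        disjoint_iff_inter_eq_empty.1 (disjoint_compl_right.mono_right hS).symm, union_empty]
    simp [this, hne]
  · intro h
    exact absurd (mem_powerset.2 hC) h

theorem biasedMeasure_trace_eq {K C : Finset (Fin n)} (hC : C ⊆ K) :
    biasedMeasure p (univ.filter fun A : Finset (Fin n) => A ∩ K = C) =
      p ^ C.card * (1 - p) ^ (K.card - C.card) := by
  rw [biasedMeasure_slice _ hC]
  have : slice univ K C = univ := by ext; simp
  rw [this, biasedMeasure_univ, mul_one]

theorem biasedMeasure_eq_sum_traces (F : Finset (Finset (Fin n))) (K : Finset (Fin n)) :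
    biasedMeasure p F = ∑ C ∈ K.powerset, biasedMeasure p (F.filter fun A => A ∩ K = C) := by
  unfold biasedMeasure
  rw [sum_fiberwise_of_maps_to]
  intro A _
  simp

/-- If all slices of `F` with trace in `P` are small, so is the part of `F` with trace in `P`. -/
theorem biasedMeasure_filter_trace_le (h0 : 0 ≤ p) (h1 : p ≤ 1) (F : Finset (Finset (Fin n)))
    (K : Finset (Fin n)) (P : Finset (Fin n) → Prop) [DecidablePred P] {b : ℝ} (hb : 0 ≤ b)
    (h : ∀ C ⊆ K, P C → biasedMeasure p (slice F K C) ≤ b) :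
    biasedMeasure p (F.filter fun A => P (A ∩ K)) ≤ b := by
  rw [biasedMeasure_eq_sum_traces _ K]
  have hs : ∑ C ∈ K.powerset, p ^ C.card * (1 - p) ^ (K.card - C.card) * b = b := by
    rw [← sum_mul, sum_pow_mul_eq_add_pow]; simp
  refine (sum_le_sum fun C hC => ?_).trans_eq hs
  rw [mem_powerset] at hC
  have hw : 0 ≤ p ^ C.card * (1 - p) ^ (K.card - C.card) :=
    mul_nonneg (pow_nonneg h0 _) (pow_nonneg (by linarith) _)
  by_cases hP : P C
  · refine (biasedMeasure_mono h0 h1 (filter_subset_filter _ (filter_subset _ F))).trans ?_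
    rw [biasedMeasure_slice F hC]
    exact mul_le_mul_of_nonneg_left (h C hC hP) hw
  · have : (F.filter fun A => P (A ∩ K)).filter (fun A => A ∩ K = C) = ∅ := by
      rw [filter_filter, filter_eq_empty_iff]
      rintro A - ⟨h2, rfl⟩
      exact hP h2
    rw [this, biasedMeasure_empty]
    positivity

/-! ### Basic families -/

/-- Families closed under taking supersets. -/
def UpClosed (F : Finset (Finset (Fin n))) : Prop := ∀ A ∈ F, ∀ B, A ⊆ B → B ∈ F

/-- The family of sets with at least `k` elements in `M`. -/
def coreFamily (M : Finset (Fin n)) (k : ℕ) : Finset (Finset (Fin n)) :=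
  univ.filter fun S => k ≤ (S ∩ M).card

@[simp] theorem mem_coreFamily {M S : Finset (Fin n)} {k : ℕ} :
    S ∈ coreFamily M k ↔ k ≤ (S ∩ M).card := by simp [coreFamily]

theorem akFamily_eq_coreFamily (n t r : ℕ) :
    akFamily n t r = coreFamily (initSeg n (t + 2 * r)) (t + r) := rfl

@[simp] theorem mem_initSeg {m : ℕ} {i : Fin n} : i ∈ initSeg n m ↔ i.val < m := by
  simp [initSeg]

theorem card_initSeg_of_le {m : ℕ} (h : m ≤ n) : (initSeg n m).card = m := by
  have : initSeg n m = (univ : Finset (Fin m)).map (Fin.castLEEmb h) := by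
    ext i
    simp only [mem_initSeg, mem_map, mem_univ, true_and, Fin.castLEEmb_apply]
    constructor
    · intro hi
      exact ⟨⟨i, hi⟩, rfl⟩
    · rintro ⟨j, rfl⟩
      exact j.2
  rw [this, card_map, card_fin]

theorem initSeg_of_le {m : ℕ} (h : n ≤ m) : initSeg n m = univ := by
  ext i; simp; omega

/-- The up-closure of a family. -/
def upClosure (F : Finset (Finset (Fin n))) : Finset (Finset (Fin n)) :=
  univ.filter fun B => ∃ A ∈ F, A ⊆ B

theorem subset_upClosure (F : Finset (Finset (Fin n))) : F ⊆ upClosure F := fun A hA => by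
  simp only [upClosure, mem_filter, mem_univ, true_and]
  exact ⟨A, hA, Subset.rfl⟩

theorem upClosed_upClosure (F : Finset (Finset (Fin n))) : UpClosed (upClosure F) := by
  intro A hA B hAB
  simp only [upClosure, mem_filter, mem_univ, true_and] at hA ⊢
  obtain ⟨D, hD, hDA⟩ := hA
  exact ⟨D, hD, hDA.trans hAB⟩

theorem tIntersecting_upClosure {t : ℕ} {F : Finset (Finset (Fin n))} (h : TIntersecting t F) :
    TIntersecting t (upClosure F) := by
  intro A hA B hB
  simp only [upClosure, mem_filter, mem_univ, true_and] at hA hB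
  obtain ⟨A', hA', hAA⟩ := hA
  obtain ⟨B', hB', hBB⟩ := hB
  exact (h A' hA' B' hB').trans (card_le_card (inter_subset_inter hAA hBB))

theorem image_inter_perm (σ : Equiv.Perm (Fin n)) (S M : Finset (Fin n)) :
    (S.image σ ∩ M.image σ).card = (S ∩ M).card := by
  rw [← image_inter _ _ σ.injective, card_image_of_injective _ σ.injective]

theorem image_coreFamily (σ : Equiv.Perm (Fin n)) (M : Finset (Fin n)) (k : ℕ) :
    ((coreFamily M k).image fun S => S.image σ) = coreFamily (M.image σ) k := by
  ext S
  simp only [mem_image, mem_coreFamily]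
  constructor
  · rintro ⟨S, hS, rfl⟩
    rwa [image_inter_perm]
  · intro hS
    refine ⟨S.image σ.symm, ?_, ?_⟩
    · rw [← image_inter_perm σ, image_image]
      simpa using hS
    · rw [image_image]; simp

theorem exists_perm_image_eq {M N : Finset (Fin n)} (h : M.card = N.card) :
    ∃ σ : Equiv.Perm (Fin n), M.image σ = N := by
  let e := Finset.equivOfCardEq h
  refine ⟨e.extendSubtype, ?_⟩
  refine eq_of_subset_of_card_le ?_ ?_
  · intro x hx
    obtain ⟨y, hy, rfl⟩ := mem_image.1 hx
    exact e.extendSubtype_mem y hy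
  · rw [card_image_of_injective _ (Equiv.injective _), h]

theorem biasedMeasure_coreFamily_congr {M N : Finset (Fin n)} (h : M.card = N.card) (k : ℕ) :
    biasedMeasure p (coreFamily M k) = biasedMeasure p (coreFamily N k) := by
  obtain ⟨σ, rfl⟩ := exists_perm_image_eq h
  rw [← image_coreFamily, biasedMeasure_image_of_card_eq]
  · exact (image_injective σ.injective).injOn
  · exact fun A _ => card_image_of_injective _ σ.injective

theorem familyIso_coreFamily {t r : ℕ} {M : Finset (Fin n)} (hM : M.card = t + 2 * r) :
    FamilyIso (akFamily n t r) (coreFamily M (t + r)) := by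
  have hle : t + 2 * r ≤ n := by
    rw [← hM]; exact (card_le_univ M).trans_eq (Fintype.card_fin n)
  obtain ⟨σ, hσ⟩ := exists_perm_image_eq ((card_initSeg_of_le hle).trans hM.symm)
  exact ⟨σ, by rw [akFamily_eq_coreFamily, image_coreFamily, hσ]⟩

/-- The size of `M` is left as that of the initial segment: when `t + 2 * r > n` the segment is cut
off at `n`. -/
theorem exists_core_of_familyIso {t r : ℕ} {G : Finset (Finset (Fin n))}
    (h : FamilyIso (akFamily n t r) G) :
    ∃ M : Finset (Fin n), M.card = (initSeg n (t + 2 * r)).card ∧ G = coreFamily M (t + r) := by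
  obtain ⟨σ, rfl⟩ := h
  exact ⟨_, card_image_of_injective _ σ.injective,
    by rw [akFamily_eq_coreFamily, image_coreFamily]⟩

theorem biasedMeasure_akFamily_le_akMax (n : ℕ) (p : ℝ) (t r : ℕ) :
    biasedMeasure p (akFamily n t r) ≤ akMax n p t :=
  (akMax_isGreatest n p t).2 ⟨r, rfl⟩

theorem biasedMeasure_coreFamily_eq {t r : ℕ} {M : Finset (Fin n)} (hM : M.card = t + 2 * r) :
    biasedMeasure p (coreFamily M (t + r)) = biasedMeasure p (akFamily n t r) := by
  have hle : t + 2 * r ≤ n := by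
    rw [← hM]; exact (card_le_univ M).trans_eq (Fintype.card_fin n)
  rw [akFamily_eq_coreFamily]
  exact biasedMeasure_coreFamily_congr (hM.trans (card_initSeg_of_le hle).symm) _

theorem biasedMeasure_coreFamily_le_akMax {t r : ℕ} {M : Finset (Fin n)}
    (hM : M.card = t + 2 * r) : biasedMeasure p (coreFamily M (t + r)) ≤ akMax n p t := by
  rw [biasedMeasure_coreFamily_eq hM]
  exact biasedMeasure_akFamily_le_akMax n p t r

theorem pow_le_biasedMeasure_coreFamily (h0 : 0 ≤ p) (h1 : p ≤ 1) {M D : Finset (Fin n)} {k : ℕ}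
    (hD : D ⊆ M) (hk : k ≤ D.card) :
    p ^ D.card * (1 - p) ^ (M.card - D.card) ≤ biasedMeasure p (coreFamily M k) := by
  rw [← biasedMeasure_trace_eq hD]
  refine biasedMeasure_mono h0 h1 fun A hA => ?_
  simp only [mem_filter, mem_univ, true_and] at hA
  rw [mem_coreFamily, hA]
  exact hk

theorem pow_le_akMax (h0 : 0 ≤ p) (h1 : p ≤ 1) {t : ℕ} (ht : t ≤ n) : p ^ t ≤ akMax n p t := by
  have h := pow_le_biasedMeasure_coreFamily (k := t) h0 h1 (Subset.refl (initSeg n t))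
    (card_initSeg_of_le ht).ge
  rw [card_initSeg_of_le ht, Nat.sub_self, pow_zero, mul_one] at h
  exact h.trans (biasedMeasure_akFamily_le_akMax n p t 0)

theorem akMax_le_one (h0 : 0 ≤ p) (h1 : p ≤ 1) (t : ℕ) : akMax n p t ≤ 1 := by
  obtain ⟨r, hr⟩ := (akMax_isGreatest n p t).1
  rw [← hr]
  exact biasedMeasure_le_one h0 h1 _

theorem eq_empty_of_lt {t : ℕ} {F : Finset (Finset (Fin n))} (hF : TIntersecting t F)
    (h : n < t) : F = ∅ := by
  refine eq_empty_of_forall_notMem fun A hA => ?_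
  have h1 := hF A hA A hA
  have h2 := (card_le_univ (A ∩ A)).trans_eq (Fintype.card_fin n)
  omega

end BiasedIntersection

namespace BiasedIntersection

open Finset

variable {n : ℕ} {p : ℝ}

/-! ### Cross-intersecting families -/

/-- With `T = z + (1 - z) p`, the left side splits as `p · z T^(θ-1) + q · (z + (1 - z) p / q)
T^(θ-1)`. The first bracket is at most `z ^ θ` since `z ≤ T`; the second is at most `1` by concavity
of `x ^ θ`. -/
theorem two_point_ineq {q θ z : ℝ} (hp : 0 < p) (hpq : p + q = 1) (hq : 0 < q)
    (hθ0 : 0 < θ) (hθ1 : θ ≤ 1) (hθ : p ^ θ = q) (hz0 : 0 ≤ z) (hz1 : z ≤ 1) :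
    (z + (1 - z) * p) ^ θ ≤ p * z ^ θ + q := by
  set T := z + (1 - z) * p with hT
  have hT0 : 0 < T := by
    rcases hz0.eq_or_lt with rfl | h
    · simpa [hT] using hp
    · have : 0 ≤ (1 - z) * p := mul_nonneg (by linarith) hp.le
      linarith
  have hTθ : 0 < T ^ θ := Real.rpow_pos_of_pos hT0 θ
  have hzθ : z ≤ z ^ θ := by
    have := Real.rpow_le_rpow_of_exponent_ge' hz0 hz1 hθ0.le hθ1
    simpa using this
  -- Jensen at the points `1` and `1 / p` with weights `z / T` and `(1 - z) p / T`, whose barycentre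
  -- is `1 / T`; the hypothesis `p ^ θ = q` evaluates `(1 / p) ^ θ`.
  have hconc := (Real.concaveOn_rpow hθ0.le hθ1).2 (show (1 : ℝ) ∈ Set.Ici 0 from Set.mem_Ici.2 zero_le_one)
    (show 1 / p ∈ Set.Ici 0 from Set.mem_Ici.2 (one_div_pos.2 hp).le) (show 0 ≤ z / T by positivity)
    (show 0 ≤ (1 - z) * p / T from div_nonneg (mul_nonneg (by linarith) hp.le) hT0.le)
    (by field_simp; rw [hT])
  have hcomb : (z / T) • (1 : ℝ) + ((1 - z) * p / T) • (1 / p) = 1 / T := by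
    simp only [smul_eq_mul]; field_simp; ring
  rw [hcomb] at hconc
  beta_reduce at hconc
  rw [Real.div_rpow zero_le_one hT0.le, Real.div_rpow zero_le_one hp.le, hθ] at hconc
  simp only [Real.one_rpow, smul_eq_mul, mul_one] at hconc
  have h2 : z + (1 - z) * p / q ≤ T / T ^ θ := by
    have := mul_le_mul_of_nonneg_left hconc hT0.le
    calc z + (1 - z) * p / q = T * (z / T + (1 - z) * p / T * (1 / q)) := by
          field_simp
      _ ≤ T * (1 / T ^ θ) := this
      _ = T / T ^ θ := by ring
  have h1 : z * (T ^ θ / T) ≤ z ^ θ := by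
    have : T ^ θ * z ≤ T * z ^ θ := by
      rcases hz0.eq_or_lt with rfl | hz
      · simp [Real.zero_rpow hθ0.ne']
      · have hzT : z ≤ T := by
          have : 0 ≤ (1 - z) * p := mul_nonneg (by linarith) hp.le
          linarith
        have h3 : z ^ (1 - θ) ≤ T ^ (1 - θ) :=
          Real.rpow_le_rpow hz.le hzT (by linarith)
        calc T ^ θ * z = T ^ θ * (z ^ (1 - θ) * z ^ θ) := by
              rw [← Real.rpow_add hz]; simp
          _ ≤ T ^ θ * (T ^ (1 - θ) * z ^ θ) := by gcongr
          _ = (T ^ θ * T ^ (1 - θ)) * z ^ θ := by ring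
          _ = T * z ^ θ := by rw [← Real.rpow_add hT0]; simp
    rw [← mul_div_assoc, div_le_iff₀ hT0]
    linarith
  have h2' : (z + (1 - z) * p / q) * (T ^ θ / T) ≤ 1 := by
    calc _ ≤ T / T ^ θ * (T ^ θ / T) := by gcongr
      _ = 1 := by field_simp
  have h3 : p * (z * (T ^ θ / T)) + q * ((z + (1 - z) * p / q) * (T ^ θ / T)) = T ^ θ := by
    have : p * z + q * (z + (1 - z) * p / q) = T := by
      field_simp
      rw [hT]
      linear_combination z * hpq
    calc _ = (p * z + q * (z + (1 - z) * p / q)) * (T ^ θ / T) := by ring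
      _ = T ^ θ := by rw [this]; field_simp
  calc T ^ θ = p * (z * (T ^ θ / T)) + q * ((z + (1 - z) * p / q) * (T ^ θ / T)) := h3.symm
    _ ≤ p * z ^ θ + q * 1 := by gcongr
    _ = p * z ^ θ + q := by ring

/-- Homogeneous form of the one-bit case: `U` and `V` are the values without and with the new
coordinate. This drives the induction on the number of coordinates. -/
theorem two_point_ineq' {q θ U V : ℝ} (hp : 0 < p) (hpq : p + q = 1) (hq : 0 < q)
    (hθ0 : 0 < θ) (hθ1 : θ ≤ 1) (hθ : p ^ θ = q) (hU : 0 ≤ U) (hUV : U ≤ V) :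
    (q * U + p * V) ^ θ ≤ p * U ^ θ + q * V ^ θ := by
  rcases (hU.trans hUV).eq_or_lt with h | hV
  · have hU0 : U = 0 := le_antisymm (h ▸ hUV) hU
    simp [hU0, ← h, Real.zero_rpow hθ0.ne']
  have h := two_point_ineq (z := U / V) hp hpq hq hθ0 hθ1 hθ (by positivity)
    ((div_le_one hV).2 hUV)
  have h1 : q * U + p * V = V * (U / V + (1 - U / V) * p) := by
    field_simp
    linear_combination (U : ℝ) * hpq
  have h2 : 0 ≤ U / V + (1 - U / V) * p := by
    have : U / V ≤ 1 := (div_le_one hV).2 hUV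
    have : 0 ≤ (1 - U / V) * p := mul_nonneg (by linarith) hp.le
    positivity
  rw [h1, Real.mul_rpow hV.le h2]
  calc _ ≤ V ^ θ * (p * (U / V) ^ θ + q) := by gcongr
    _ = p * U ^ θ + q * V ^ θ := by
      rw [Real.div_rpow hU hV.le]
      have : V ^ θ ≠ 0 := (Real.rpow_pos_of_pos hV θ).ne'
      field_simp

theorem sum_powerset_insert_weight {α : Type*} [DecidableEq α] (a b : ℝ) {S : Finset α} {x : α}
    (hx : x ∉ S) (f : Finset α → ℝ) :
    ∑ A ∈ (insert x S).powerset, a ^ A.card * b ^ ((insert x S).card - A.card) * f A =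
      b * ∑ A ∈ S.powerset, a ^ A.card * b ^ (S.card - A.card) * f A +
      a * ∑ A ∈ S.powerset, a ^ A.card * b ^ (S.card - A.card) * f (insert x A) := by
  rw [sum_powerset_insert hx, mul_sum, mul_sum]
  congr 1
  · refine sum_congr rfl fun A hA => ?_
    have := card_le_card (mem_powerset.1 hA)
    rw [card_insert_of_notMem hx, show S.card + 1 - A.card = (S.card - A.card) + 1 by omega]
    ring
  · refine sum_congr rfl fun A hA => ?_
    rw [card_insert_of_notMem hx, card_insert_of_notMem fun h => hx (mem_powerset.1 hA h),
      Nat.add_sub_add_right]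
    ring

/-- For an increasing `0`-`1`-valued function, the `p`-biased mean is at most a fixed power of the
`q`-biased mean. -/
theorem rpow_sum_weight_le {α : Type*} [DecidableEq α] {q θ : ℝ} (hp : 0 < p) (hpq : p + q = 1)
    (hq : 0 < q) (hθ0 : 0 < θ) (hθ1 : θ ≤ 1) (hθ : p ^ θ = q) (S : Finset α)
    (f : Finset α → ℝ) (hf : ∀ A, f A = 0 ∨ f A = 1) (hmono : ∀ A B, A ⊆ B → f A ≤ f B) :
    (∑ A ∈ S.powerset, p ^ A.card * q ^ (S.card - A.card) * f A) ^ θ ≤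
      ∑ A ∈ S.powerset, q ^ A.card * p ^ (S.card - A.card) * f A := by
  induction S using Finset.induction_on generalizing f with
  | empty =>
    rcases hf ∅ with h | h <;> simp [h, Real.zero_rpow hθ0.ne']
  | insert x S hx ih =>
    rw [sum_powerset_insert_weight p q hx, sum_powerset_insert_weight q p hx]
    have h1 := ih f hf hmono
    have h2 := ih (fun A => f (insert x A)) (fun A => hf _)
      (fun A B h => hmono _ _ (insert_subset_insert x h))
    have hf0 : ∀ A, 0 ≤ f A := fun A => by rcases hf A with h | h <;> simp [h]
    refine (two_point_ineq' hp hpq hq hθ0 hθ1 hθ ?_ ?_).trans ?_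
    · exact sum_nonneg fun A _ => mul_nonneg (by positivity) (hf0 A)
    · exact sum_le_sum fun A _ => mul_le_mul_of_nonneg_left (hmono _ _ (subset_insert x A))
        (by positivity)
    · gcongr

/-- Complements of members of `G` cannot lie in `F`, and taking complements exchanges the biases `p`
and `1 - p`. Thus the `(1 - p)`-measure of `G` is at most `1 - μ(F)`, and it dominates `μ(G) ^ θ` by
monotonicity of `G`. -/
theorem cross_intersecting_ineq {θ : ℝ} (hp : 0 < p) (hp1 : p < 1) (hθ0 : 0 < θ)
    (hθ1 : θ ≤ 1) (hθ : p ^ θ = 1 - p) {F G : Finset (Finset (Fin n))} (hG : UpClosed G)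
    (h : ∀ A ∈ F, ∀ B ∈ G, (A ∩ B).Nonempty) :
    biasedMeasure p G ^ θ ≤ 1 - biasedMeasure p F := by
  have key := rpow_sum_weight_le (α := Fin n) hp (add_sub_cancel p 1) (by linarith) hθ0 hθ1 hθ
    univ (fun A => if A ∈ G then 1 else 0) (fun A => by by_cases hA : A ∈ G <;> simp [hA])
    (fun A B hAB => by
      by_cases hA : A ∈ G
      · simp [hA, hG A hA B hAB]
      · rw [if_neg hA]; positivity)
  simp only [powerset_univ, card_univ, Fintype.card_fin, mul_ite, mul_one, mul_zero] at key
  rw [← biasedMeasure_eq_sum_ite] at key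
  refine key.trans ?_
  rw [← biasedMeasure_compl]
  refine le_trans (le_of_eq ?_)
    (biasedMeasure_mono hp.le hp1.le (F := G.image compl) fun A hA => ?_)
  · rw [← sum_filter, filter_mem_eq_inter, univ_inter, biasedMeasure,
      sum_image compl_injective.injOn]
    refine sum_congr rfl fun A _ => ?_
    have h1 := card_compl_add_card A
    rw [Fintype.card_fin] at h1
    rw [show n - A.card = Aᶜ.card by omega, show n - Aᶜ.card = A.card by omega, mul_comm]
  · obtain ⟨B, hB, rfl⟩ := mem_image.1 hA
    rw [mem_compl]
    intro hF
    obtain ⟨x, hx⟩ := h _ hF B hB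
    rw [mem_inter, mem_compl] at hx
    exact hx.1 hx.2

theorem upClosed_slice {F : Finset (Finset (Fin n))} (hF : UpClosed F) (K C : Finset (Fin n)) :
    UpClosed (slice F K C) := by
  intro A hA B hAB
  rw [mem_slice] at hA ⊢
  exact hF _ hA _ (union_subset_union (sdiff_subset_sdiff hAB Subset.rfl) Subset.rfl)

/-- The traces supply fewer than `t` common points, so another one must come from outside `K`. -/
theorem slices_cross_intersecting {t : ℕ} {F : Finset (Finset (Fin n))}
    (hF : TIntersecting t F) {K C D : Finset (Fin n)} (hC : C ⊆ K) (hD : D ⊆ K)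
    (h : (C ∩ D).card < t) : ∀ A ∈ slice F K C, ∀ B ∈ slice F K D, (A ∩ B).Nonempty := by
  intro A hA B hB
  rw [mem_slice] at hA hB
  by_contra hne
  rw [not_nonempty_iff_eq_empty] at hne
  have h1 := hF _ hA _ hB
  have h2 : (A \ K ∪ C) ∩ (B \ K ∪ D) ⊆ C ∩ D := by
    intro x hx
    simp only [mem_inter, mem_union, mem_sdiff] at hx ⊢
    have h3 : ¬ (x ∈ A ∧ x ∈ B) := by
      rw [← mem_inter, hne]; simp
    have h4 := @hC x
    have h5 := @hD x
    tauto
  exact absurd (h1.trans (card_le_card h2)) (not_le.2 h)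

/-- The exponent `a` satisfies `(1 - p) ^ a = p` and is at least `1`. -/
structure IsExponent (p a : ℝ) : Prop where
  pos : 0 < p
  lt_one : p < 1
  one_le : 1 ≤ a
  rpow_eq : (1 - p) ^ a = p

theorem IsExponent.slice_le {a : ℝ} (ha : IsExponent p a) {t : ℕ} {F : Finset (Finset (Fin n))}
    (hF : TIntersecting t F) (hup : UpClosed F) {K C D : Finset (Fin n)} (hC : C ⊆ K)
    (hD : D ⊆ K) (h : (C ∩ D).card < t) :
    biasedMeasure p (slice F K D) ≤ (1 - biasedMeasure p (slice F K C)) ^ a := by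
  have ha0 : 0 < a := by linarith [ha.one_le]
  have hθ : p ^ a⁻¹ = 1 - p := by
    conv_lhs => rw [← ha.rpow_eq]
    exact Real.rpow_rpow_inv (by linarith [ha.lt_one]) ha0.ne'
  have h1 := cross_intersecting_ineq ha.pos ha.lt_one (inv_pos.2 ha0) (inv_le_one_of_one_le₀ ha.one_le)
    hθ (upClosed_slice hup K D) (slices_cross_intersecting hF hC hD h)
  have h0 := biasedMeasure_nonneg ha.pos.le ha.lt_one.le (slice F K D)
  calc _ = (biasedMeasure p (slice F K D) ^ a⁻¹) ^ a := (Real.rpow_inv_rpow h0 ha0.ne').symm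
    _ ≤ _ := Real.rpow_le_rpow (Real.rpow_nonneg h0 _) h1 ha0.le

/-! ### Bootstrapping -/

/-- Enlarge `C` to size `t + r - 1`, so that it misses exactly `r + 1` points of `M`. A `(t +
r)`-set containing those points has only `t - 1` left for `C`. -/
theorem exists_small_inter {t r : ℕ} (ht : 1 ≤ t) {M C : Finset (Fin n)}
    (hM : M.card = t + 2 * r) (hCM : C ⊆ M) (hC : C.card < t + r) :
    ∃ D ⊆ M, D.card = t + r ∧ (D ∩ C).card < t := by
  obtain ⟨C', hCC', hC'M, hC'⟩ :=
    exists_subsuperset_card_eq hCM (n := t + r - 1) (by omega) (by omega)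
  have h1 : (M \ C').card = r + 1 := by rw [card_sdiff_of_subset hC'M]; omega
  obtain ⟨D, hD1, hDM, hD⟩ :=
    exists_subsuperset_card_eq (sdiff_subset : M \ C' ⊆ M) (n := t + r) (by omega) (by omega)
  refine ⟨D, hDM, hD, ?_⟩
  have h2 : (D ∩ C).card ≤ (D \ (M \ C')).card := by
    refine card_le_card fun x hx => ?_
    simp only [mem_inter, mem_sdiff] at hx ⊢
    exact ⟨hx.1, fun h => h.2 (hCC' hx.2)⟩
  rw [card_sdiff_of_subset hD1] at h2
  omega

/-- Each slice of `F` outside the core family faces a slice inside it. The deficiency of the latter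
is at most `μ(core \ F)` divided by the weight `p ^ (t + r) * (1 - p) ^ r` of its trace. -/
theorem IsExponent.sdiff_core_le {a : ℝ} (ha : IsExponent p a) {t r : ℕ} (ht : 1 ≤ t)
    {F : Finset (Finset (Fin n))} (hF : TIntersecting t F) (hup : UpClosed F)
    {M : Finset (Fin n)} (hM : M.card = t + 2 * r) :
    biasedMeasure p (F \ coreFamily M (t + r)) ≤
      (biasedMeasure p (coreFamily M (t + r) \ F) / (p ^ (t + r) * (1 - p) ^ r)) ^ a := by
  have hp := ha.pos
  have hp1 := ha.lt_one
  have hq : 0 < 1 - p := by linarith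
  have hy := biasedMeasure_nonneg hp.le hp1.le (coreFamily M (t + r) \ F)
  have hset : F \ coreFamily M (t + r) = F.filter fun A => (A ∩ M).card < t + r := by
    ext A; simp
  rw [hset]
  refine biasedMeasure_filter_trace_le hp.le hp1.le F M (fun C => C.card < t + r)
    (by positivity) fun C hC hCr => ?_
  obtain ⟨D, hDM, hD, hDC⟩ := exists_small_inter ht hM hC hCr
  have h1 := ha.slice_le hF hup hDM hC hDC
  refine h1.trans (Real.rpow_le_rpow ?_ ?_ (by linarith [ha.one_le]))
  · linarith [biasedMeasure_le_one hp.le hp1.le (slice F M D)]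
  · rw [le_div_iff₀ (by positivity), ← biasedMeasure_compl, mul_comm]
    have h2 : (slice F M D)ᶜ = slice Fᶜ M D := by ext; simp
    have h3 := biasedMeasure_slice (p := p) Fᶜ hDM
    rw [hD, show M.card - (t + r) = r by omega] at h3
    rw [h2, ← h3]
    refine biasedMeasure_mono hp.le hp1.le fun A hA => ?_
    simp only [mem_filter, mem_compl, mem_sdiff, mem_coreFamily] at hA ⊢
    exact ⟨by rw [hA.2, hD], hA.1⟩

end BiasedIntersection

/-! ### Constants uniform in the bias, and the self-improvement of closeness to a core -/

namespace BiasedIntersection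

open Finset

variable {n : ℕ} {p : ℝ}

/-- The range `[ζ, 1/2 - ζ]` of the bias. -/
def BiasRange (ζ p : ℝ) : Prop := ζ ≤ p ∧ p ≤ 1 / 2 - ζ

/-- The quotient `log p / log (1 - p)` is decreasing in `p`, so its values at `1/2 - ζ` and `ζ`
bound it. The lower bound exceeds `1` because `p` stays away from `1/2`. -/
theorem exists_exponent_bounds {ζ : ℝ} (hζ : 0 < ζ) (hζ4 : ζ ≤ 1 / 4) :
    ∃ a₀ a₁ : ℝ, 1 < a₀ ∧ ∀ p, BiasRange ζ p → IsExponent p (Real.logb (1 - p) p) ∧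
      a₀ ≤ Real.logb (1 - p) p ∧ Real.logb (1 - p) p ≤ a₁ := by
  have hl : Real.log (1 / 2 + ζ) < 0 := Real.log_neg (by linarith) (by linarith)
  have hl' : Real.log (1 - ζ) < 0 := Real.log_neg (by linarith) (by linarith)
  have h01 : 1 < Real.log (1 / 2 - ζ) / Real.log (1 / 2 + ζ) := by
    rw [one_lt_div_of_neg hl]
    exact Real.log_lt_log (by linarith) (by linarith)
  refine ⟨Real.log (1 / 2 - ζ) / Real.log (1 / 2 + ζ), Real.log ζ / Real.log (1 - ζ), h01, ?_⟩
  rintro p ⟨h1, h2⟩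
  have hq : Real.log (1 - p) < 0 := Real.log_neg (by linarith) (by linarith)
  have hp : Real.log p < 0 := Real.log_neg (by linarith) (by linarith)
  have hle : Real.log (1 / 2 - ζ) / Real.log (1 / 2 + ζ) ≤ Real.logb (1 - p) p := by
    rw [Real.logb, div_le_iff_of_neg hl, div_mul_eq_mul_div, div_le_iff_of_neg hq]
    have e1 : Real.log p ≤ Real.log (1 / 2 - ζ) := Real.log_le_log (by linarith) h2
    have e2 : Real.log (1 / 2 + ζ) ≤ Real.log (1 - p) :=
      Real.log_le_log (by linarith) (by linarith)
    have e3 : Real.log (1 / 2 - ζ) < 0 := Real.log_neg (by linarith) (by linarith)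
    nlinarith
  refine ⟨⟨by linarith, by linarith, h01.le.trans hle, ?_⟩, hle, ?_⟩
  · exact Real.rpow_logb (by linarith) (by linarith) (by linarith)
  · rw [Real.logb, div_le_iff_of_neg hq, div_mul_eq_mul_div, div_le_iff_of_neg hl']
    have e1 : Real.log ζ ≤ Real.log p := Real.log_le_log hζ h1
    have e2 : Real.log (1 - p) ≤ Real.log (1 - ζ) :=
      Real.log_le_log (by linarith) (by linarith)
    nlinarith

/-- From `x ≤ ((ε + x) / κ) ^ a` there are two regimes: `x ≤ ε` gives the sharp bound directly,
while `ε < x ≤ c` would give `x ≤ (2x / κ) ^ a ≤ x / 2`. -/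
theorem exists_bootstrap {ζ : ℝ} (hζ : 0 < ζ) (hζ4 : ζ ≤ 1 / 4) {t : ℕ} (ht : 1 ≤ t) (R : ℕ) :
    ∃ c C : ℝ, 0 < c ∧ 0 < C ∧ ∀ (n : ℕ) (p : ℝ), BiasRange ζ p → ∀ (r : ℕ), r ≤ R →
      ∀ M : Finset (Fin n), M.card = t + 2 * r → ∀ F : Finset (Finset (Fin n)),
      TIntersecting t F → UpClosed F → ∀ ε : ℝ, 0 ≤ ε →
      biasedMeasure p (coreFamily M (t + r)) ≤ biasedMeasure p F + ε →
      biasedMeasure p (F \ coreFamily M (t + r)) ≤ c →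
      biasedMeasure p (F \ coreFamily M (t + r)) ≤ C * ε ^ Real.logb (1 - p) p := by
  obtain ⟨a₀, a₁, ha₀, hexp⟩ := exists_exponent_bounds hζ hζ4
  set κ : ℝ := ζ ^ (t + 2 * R) with hκ
  have hκ0 : 0 < κ := pow_pos hζ _
  have hκ1 : κ ≤ 1 := pow_le_one₀ hζ.le (by linarith)
  -- Chosen so that `d ^ (a₀ - 1) = κ / 4`; then `z ≤ d` implies `z ^ a ≤ z * (κ / 4)`.
  set d : ℝ := (κ / 4) ^ (1 / (a₀ - 1)) with hd
  have hd0 : 0 < d := Real.rpow_pos_of_pos (by positivity) _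
  have hd1 : d ≤ 1 := Real.rpow_le_one (by positivity) (by linarith)
    (one_div_nonneg.2 (by linarith))
  refine ⟨κ / 2 * d, (2 / κ) ^ a₁, by positivity, Real.rpow_pos_of_pos (by positivity) _, ?_⟩
  intro n p hp r hr M hM F hF hup ε hε hμ hc
  obtain ⟨hIs, hle, hle'⟩ := hexp p hp
  set a := Real.logb (1 - p) p with ha
  set x := biasedMeasure p (F \ coreFamily M (t + r)) with hx
  have hp0 := hIs.pos
  have hp1 := hIs.lt_one
  have hx0 : 0 ≤ x := biasedMeasure_nonneg hp0.le hp1.le _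
  have hy0 := biasedMeasure_nonneg hp0.le hp1.le (coreFamily M (t + r) \ F)
  have hy : biasedMeasure p (coreFamily M (t + r) \ F) ≤ ε + x := by
    rw [biasedMeasure_sdiff_comm]; linarith
  have hκp : κ ≤ p ^ (t + r) * (1 - p) ^ r := by
    calc κ ≤ ζ ^ (t + 2 * r) :=
          pow_le_pow_of_le_one hζ.le (by linarith) (by omega)
      _ = ζ ^ (t + r) * ζ ^ r := by rw [← pow_add]; congr 1; omega
      _ ≤ _ := by
        gcongr
        · exact hp.1
        · have := hp.2; linarith
  have ha0 : 0 ≤ a := by linarith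
  have hmain : x ≤ ((ε + x) / κ) ^ a := by
    refine (hIs.sdiff_core_le ht hF hup hM).trans (Real.rpow_le_rpow (by positivity) ?_ ha0)
    exact div_le_div₀ (by linarith) hy hκ0 hκp
  rcases le_or_gt x ε with hxe | hxe
  · calc x ≤ ((ε + x) / κ) ^ a := hmain
      _ ≤ (2 / κ * ε) ^ a := by
        refine Real.rpow_le_rpow (by positivity) ?_ ha0
        rw [div_mul_eq_mul_div]
        gcongr
        linarith
      _ = (2 / κ) ^ a * ε ^ a := Real.mul_rpow (by positivity) hε
      _ ≤ (2 / κ) ^ a₁ * ε ^ a := by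
        have : 1 ≤ 2 / κ := by rw [le_div_iff₀ hκ0]; linarith
        gcongr
  · exfalso
    have hx0' : 0 < x := hε.trans_lt hxe
    set z := 2 / κ * x with hz
    have hz0 : 0 < z := by positivity
    have hzd : z ≤ d := by
      calc z ≤ 2 / κ * (κ / 2 * d) := by rw [hz]; gcongr
        _ = d := by field_simp
    have h1 : x ≤ z ^ a := by
      refine hmain.trans (Real.rpow_le_rpow (by positivity) ?_ ha0)
      rw [hz, div_mul_eq_mul_div]
      gcongr
      linarith
    have h2 : z ^ a ≤ z * (κ / 4) := by
      calc z ^ a ≤ z ^ a₀ := Real.rpow_le_rpow_of_exponent_ge hz0 (hzd.trans hd1) hle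
        _ = z * z ^ (a₀ - 1) := by
          rw [← Real.rpow_one_add' hz0.le (by linarith)]; congr 1; ring
        _ ≤ z * d ^ (a₀ - 1) := by
          gcongr
        _ = z * (κ / 4) := by
          rw [hd, ← Real.rpow_mul (by positivity), one_div_mul_cancel (by linarith),
            Real.rpow_one]
    have h3 : z * (κ / 4) = x / 2 := by rw [hz]; field_simp; norm_num
    linarith

end BiasedIntersection

namespace BiasedIntersection

open Finset

variable {n : ℕ} {p : ℝ}

/-! ### Shifting -/

/-- The set obtained from `A` by exchanging the elements `i` and `j`. -/
def swapSet (i j : Fin n) (A : Finset (Fin n)) : Finset (Fin n) := A.image (Equiv.swap i j)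

@[simp] theorem mem_swapSet {i j x : Fin n} {A : Finset (Fin n)} :
    x ∈ swapSet i j A ↔ Equiv.swap i j x ∈ A := by
  simp only [swapSet, mem_image]
  constructor
  · rintro ⟨y, hy, rfl⟩
    simpa using hy
  · exact fun h => ⟨_, h, by simp⟩

@[simp] theorem swapSet_swapSet (i j : Fin n) (A : Finset (Fin n)) :
    swapSet i j (swapSet i j A) = A := by ext; simp

theorem card_swapSet (i j : Fin n) (A : Finset (Fin n)) : (swapSet i j A).card = A.card :=
  card_image_of_injective _ (Equiv.injective _)

theorem swapSet_inter (i j : Fin n) (A B : Finset (Fin n)) :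
    swapSet i j (A ∩ B) = swapSet i j A ∩ swapSet i j B := by ext; simp

theorem card_swapSet_inter (i j : Fin n) (A B : Finset (Fin n)) :
    (swapSet i j A ∩ swapSet i j B).card = (A ∩ B).card := by
  rw [← swapSet_inter, card_swapSet]

theorem swapSet_injective (i j : Fin n) : Function.Injective (swapSet i j) :=
  Function.LeftInverse.injective (swapSet_swapSet i j)

theorem swapSet_of_mem_iff {i j : Fin n} {A : Finset (Fin n)} (h : i ∈ A ↔ j ∈ A) :
    swapSet i j A = A := by
  ext x
  rw [mem_swapSet]
  by_cases hi : x = i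
  · subst hi; simp [h]
  by_cases hj : x = j
  · subst hj; simp [h]
  rw [Equiv.swap_apply_of_ne_of_ne hi hj]

theorem swapSet_of_mem_of_notMem {i j : Fin n} {A : Finset (Fin n)} (hi : i ∈ A) (hj : j ∉ A) :
    swapSet i j A = insert j (A.erase i) := by
  have hij : i ≠ j := fun h => hj (h ▸ hi)
  ext x
  rw [mem_swapSet, mem_insert, mem_erase]
  by_cases h1 : x = i
  · subst h1; simp [hj, hij]
  by_cases h2 : x = j
  · subst h2; simp [hi]
  rw [Equiv.swap_apply_of_ne_of_ne h1 h2]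
  simp [h1, h2]

theorem swapSet_comm (i j : Fin n) (A : Finset (Fin n)) : swapSet i j A = swapSet j i A := by
  rw [swapSet, Equiv.swap_comm, swapSet]

/-- The shift of a family, replacing `j` by `i` in its members wherever possible. -/
def shift (i j : Fin n) (F : Finset (Finset (Fin n))) : Finset (Finset (Fin n)) :=
  univ.filter fun A => (A ∈ F ∧ (j ∈ A → i ∉ A → swapSet i j A ∈ F)) ∨
    (i ∈ A ∧ j ∉ A ∧ swapSet i j A ∈ F)

theorem mem_shift {i j : Fin n} {F : Finset (Finset (Fin n))} {A : Finset (Fin n)} :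
    A ∈ shift i j F ↔ (A ∈ F ∧ (j ∈ A → i ∉ A → swapSet i j A ∈ F)) ∨
    (i ∈ A ∧ j ∉ A ∧ swapSet i j A ∈ F) := by simp [shift]

theorem mem_swapSet_left {i j : Fin n} {A : Finset (Fin n)} : i ∈ swapSet i j A ↔ j ∈ A := by simp

theorem mem_swapSet_right {i j : Fin n} {A : Finset (Fin n)} : j ∈ swapSet i j A ↔ i ∈ A := by
  simp

/-- The map from a family onto its shift. -/
def shiftMap (i j : Fin n) (F : Finset (Finset (Fin n))) (A : Finset (Fin n)) : Finset (Fin n) :=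
  if j ∈ A ∧ i ∉ A ∧ swapSet i j A ∉ F then swapSet i j A else A

theorem image_shiftMap (i j : Fin n) (F : Finset (Finset (Fin n))) :
    F.image (shiftMap i j F) = shift i j F := by
  ext A
  rw [mem_image, mem_shift]
  constructor
  · rintro ⟨B, hB, rfl⟩
    unfold shiftMap
    split_ifs with h
    · right
      rw [mem_swapSet_left, mem_swapSet_right, swapSet_swapSet]
      exact ⟨h.1, h.2.1, hB⟩
    · left
      refine ⟨hB, fun h1 h2 => ?_⟩
      by_contra h3
      exact h ⟨h1, h2, h3⟩
  · rintro (⟨h1, h2⟩ | ⟨h1, h2, h3⟩)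
    · refine ⟨A, h1, if_neg ?_⟩
      rintro ⟨h3, h4, h5⟩
      exact h5 (h2 h3 h4)
    · by_cases hA : A ∈ F
      · exact ⟨A, hA, if_neg fun h => h2 h.1⟩
      · refine ⟨_, h3, ?_⟩
        unfold shiftMap
        simp only [mem_swapSet_left, mem_swapSet_right, swapSet_swapSet]
        rw [if_pos ⟨h1, h2, hA⟩]

theorem injOn_shiftMap (i j : Fin n) (F : Finset (Finset (Fin n))) :
    Set.InjOn (shiftMap i j F) F := by
  intro A hA B hB h
  unfold shiftMap at h
  split_ifs at h with h1 h2 h2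
  · exact swapSet_injective i j h
  · exact absurd (h ▸ hB) h1.2.2
  · exact absurd (h ▸ hA) h2.2.2
  · exact h

theorem biasedMeasure_shift (i j : Fin n) (F : Finset (Finset (Fin n))) :
    biasedMeasure p (shift i j F) = biasedMeasure p F := by
  rw [← image_shiftMap, biasedMeasure_image_of_card_eq (injOn_shiftMap i j F)]
  intro A _
  unfold shiftMap
  split_ifs
  · exact card_swapSet i j A
  · rfl

/-- The only delicate pair is an unmoved `A` and a moved `B`. If `A` contains `i` but not `j`, then
`B` only gained relative to its preimage; otherwise `A` may be swapped too without leaving `F`. -/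
theorem tIntersecting_shift {t : ℕ} {F : Finset (Finset (Fin n))} (hF : TIntersecting t F)
    (i j : Fin n) : TIntersecting t (shift i j F) := by
  have key : ∀ A B, A ∈ F → (i ∈ B ∧ j ∉ B ∧ swapSet i j B ∈ F) →
      (j ∈ A → i ∉ A → swapSet i j A ∈ F) → t ≤ (A ∩ B).card := by
    intro A B hA hB hA'
    by_cases h : i ∈ A ∧ j ∉ A
    · refine (hF _ hA _ hB.2.2).trans (card_le_card fun x hx => ?_)
      rw [mem_inter, swapSet_of_mem_of_notMem hB.1 hB.2.1, mem_insert, mem_erase] at hx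
      rcases hx with ⟨hx, rfl | hx'⟩
      · exact absurd hx h.2
      · exact mem_inter.2 ⟨hx, hx'.2⟩
    · rw [← card_swapSet_inter i j]
      by_cases h2 : j ∈ A ∧ i ∉ A
      · exact hF _ (hA' h2.1 h2.2) _ hB.2.2
      · rw [swapSet_of_mem_iff (A := A) (by tauto)]
        exact hF _ hA _ hB.2.2
  intro A hA B hB
  rw [mem_shift] at hA hB
  rcases hA with hA | hA <;> rcases hB with hB | hB
  · exact hF _ hA.1 _ hB.1
  · exact key A B hA.1 hB hA.2
  · rw [inter_comm]
    exact key B A hB.1 hA hB.2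
  · rw [← card_swapSet_inter i j]
    exact hF _ hA.2.2 _ hB.2.2

/-- Consequently a shift does not change how much of a family lies inside or outside a family
symmetric in `i` and `j`. -/
theorem shift_inter_of_invariant {i j : Fin n} {F H : Finset (Finset (Fin n))}
    (hH : ∀ A ∈ H, swapSet i j A ∈ H) : shift i j (F ∩ H) = shift i j F ∩ H := by
  have hH' : ∀ A, swapSet i j A ∈ H → A ∈ H := fun A hA => by
    simpa using hH _ hA
  ext A
  simp only [mem_shift, mem_inter]
  have h1 := hH A
  have h2 := hH' A
  tauto

theorem biasedMeasure_shift_inter {i j : Fin n} {F H : Finset (Finset (Fin n))}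
    (hH : ∀ A ∈ H, swapSet i j A ∈ H) :
    biasedMeasure p (shift i j F ∩ H) = biasedMeasure p (F ∩ H) := by
  rw [← shift_inter_of_invariant hH, biasedMeasure_shift]

theorem biasedMeasure_shift_sdiff {i j : Fin n} {F H : Finset (Finset (Fin n))}
    (hH : ∀ A ∈ H, swapSet i j A ∈ H) :
    biasedMeasure p (shift i j F \ H) = biasedMeasure p (F \ H) := by
  have h1 := biasedMeasure_inter_add_sdiff (p := p) F H
  have h2 := biasedMeasure_inter_add_sdiff (p := p) (shift i j F) H
  rw [biasedMeasure_shift_inter hH, biasedMeasure_shift] at h2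
  linarith

/-! ### Undoing a shift -/

theorem swapSet_mem_coreFamily {i j : Fin n} {M A : Finset (Fin n)} {k : ℕ} :
    swapSet i j A ∈ coreFamily M k ↔ A ∈ coreFamily (swapSet i j M) k := by
  rw [mem_coreFamily, mem_coreFamily, ← card_swapSet_inter i j A, swapSet_swapSet]

/-- If `E` contains `K \ C₀`, it contains the `r` points of `K` missed by any `C ⊇ C₀` of size `t +
r - 1`, leaving at most `t - 1` common points. Hence all such `C` share the neighbour `E` in the
generalized Kneser graph. -/
theorem exists_neighbour {t r : ℕ} (ht : 1 ≤ t) {K C₀ : Finset (Fin n)}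
    (hK : K.card + 1 = t + 2 * r) (hC₀ : (K \ C₀).card + 1 ≤ t + r) :
    ∃ E ⊆ K, E.card + 1 = t + r ∧ ∀ C ⊆ K, C₀ ⊆ C → C.card + 1 = t + r → (C ∩ E).card < t := by
  obtain ⟨E, hE1, hEK, hE⟩ := exists_subsuperset_card_eq (sdiff_subset : K \ C₀ ⊆ K)
    (n := t + r - 1) (by omega) (by omega)
  refine ⟨E, hEK, by omega, fun C hCK hC hCc => ?_⟩
  have h1 : C ∩ E ⊆ E \ (K \ C) := fun x hx => by
    simp only [mem_inter, mem_sdiff] at hx ⊢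
    exact ⟨hx.2, fun h => h.2 hx.1⟩
  have h2 : K \ C ⊆ E := (sdiff_subset_sdiff Subset.rfl hC).trans hE1
  have h3 := card_le_card h1
  rw [card_sdiff_of_subset h2, card_sdiff_of_subset hCK] at h3
  omega

/-- Two sets differing by one exchange share a subset `C₀` of size `t + r - 2`; `exists_neighbour`
applies to it exactly when `r + 1 ≤ t + r - 1`, that is `t ≥ 2`. For `t = 1` and `r ≥ 1` the graph
is a perfect matching, hence the restriction; for `r = 0` it has one vertex. -/
theorem kneser_connected {t r : ℕ} (hr : r = 0 ∨ 2 ≤ t) {K : Finset (Fin n)}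
    (hK : K.card + 1 = t + 2 * r) (P : Finset (Fin n) → Prop)
    (hP : ∀ C ⊆ K, ∀ D ⊆ K, C.card + 1 = t + r → D.card + 1 = t + r → (C ∩ D).card < t →
      (P C ↔ P D)) :
    ∀ C ⊆ K, ∀ D ⊆ K, C.card + 1 = t + r → D.card + 1 = t + r → (P C ↔ P D) := by
  suffices H : ∀ k, ∀ C ⊆ K, ∀ D ⊆ K, C.card + 1 = t + r → D.card + 1 = t + r →
      (D \ C).card = k → (P C ↔ P D) from fun C hC D hD h1 h2 => H _ C hC D hD h1 h2 rfl
  intro k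
  induction k with
  | zero =>
    intro C hC D hD h1 h2 h3
    rw [card_eq_zero, sdiff_eq_empty_iff_subset] at h3
    rw [eq_of_subset_of_card_le h3 (by omega)]
  | succ k ih =>
    intro C hC D hD h1 h2 h3
    have hne : (D \ C).Nonempty := card_pos.1 (by omega)
    have hne' : (C \ D).Nonempty := by
      rw [← card_pos]
      have := card_sdiff_add_card_inter C D
      have := card_sdiff_add_card_inter D C
      rw [inter_comm] at this
      omega
    obtain ⟨x, hx⟩ := hne
    obtain ⟨y, hy⟩ := hne'
    rw [mem_sdiff] at hx hy
    have hr' : r ≠ 0 := by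
      rintro rfl
      rw [eq_of_subset_of_card_le hC (by omega)] at hx
      exact hx.2 (hD hx.1)
    have ht : 2 ≤ t := hr.resolve_left hr'
    set C' := insert x (C.erase y) with hC'
    have hxy : x ∉ C.erase y := fun h => hx.2 (mem_of_mem_erase h)
    have hc : C'.card = C.card := by
      rw [hC', card_insert_of_notMem hxy, card_erase_add_one hy.1]
    have hC'K : C' ⊆ K := insert_subset (hD hx.1) ((erase_subset _ _).trans hC)
    have hce : (K \ C.erase y).card + 1 ≤ t + r := by
      rw [card_sdiff_of_subset ((erase_subset _ _).trans hC), card_erase_of_mem hy.1]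
      omega
    obtain ⟨E, hEK, hE, hEn⟩ := exists_neighbour (by omega) hK hce
    have e1 := hP C hC E hEK h1 hE (hEn C hC (erase_subset _ _) h1)
    have e2 := hP C' hC'K E hEK (by omega) hE (hEn C' hC'K (subset_insert _ _) (by omega))
    rw [e1, ← e2]
    refine ih C' hC'K D hD (by omega) h2 ?_
    have : D \ C' = (D \ C).erase x := by
      ext z
      simp only [hC', mem_sdiff, mem_insert, mem_erase]
      constructor
      · rintro ⟨hz, hz'⟩
        push Not at hz'
        refine ⟨hz'.1, hz, fun hzC => hz'.2 ?_ hzC⟩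
        rintro rfl
        exact hy.2 hz
      · rintro ⟨hz, hz', hz''⟩
        exact ⟨hz', by tauto⟩
    rw [this, card_erase_of_mem (mem_sdiff.2 hx)]
    omega

/-- The inequalities give `u ≤ v ^ a + ω` and `v ≤ u ^ a + ω`. Away from `0` and `1` the power `a`
loses at least a fixed `φ`, so going round the loop with `ω ≤ φ / 4` is impossible. Both `u` and `v`
are thus near the same endpoint. -/
theorem exists_dichotomy {a₀ κ : ℝ} (ha₀ : 1 < a₀) (hκ : 0 < κ) (hκ1 : κ ≤ 1 / 4) :
    ∃ ω : ℝ, 0 < ω ∧ ∀ a x y u v : ℝ, a₀ ≤ a → 0 ≤ u → u ≤ 1 → 0 ≤ v → v ≤ 1 →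
      u ≤ x + ω → v ≤ y + ω → y ≤ u ^ a → x ≤ v ^ a →
      (x ≤ κ ∧ y ≤ κ) ∨ (1 - κ ≤ x ∧ 1 - κ ≤ y) := by
  have hcont : ContinuousOn (fun v : ℝ => v - v ^ a₀) (Set.Icc (κ / 2) (1 - κ / 2)) := by
    refine continuousOn_id.sub (ContinuousOn.rpow_const continuousOn_id fun x hx => ?_)
    exact Or.inr (by linarith)
  obtain ⟨v₀, hv₀, hmin⟩ := isCompact_Icc.exists_isMinOn
    (Set.nonempty_Icc.2 (by linarith)) hcont
  set φ := v₀ - v₀ ^ a₀ with hφ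
  have hφ0 : 0 < φ := by
    have h := Real.rpow_lt_rpow_of_exponent_gt (x := v₀) (by linarith [hv₀.1])
      (by linarith [hv₀.2]) ha₀
    rw [Real.rpow_one] at h
    linarith
  have hle : ∀ a v : ℝ, a₀ ≤ a → κ / 2 ≤ v → v ≤ 1 - κ / 2 → v ^ a ≤ v - φ := by
    intro a v ha h1 h2
    have h3 : φ ≤ v - v ^ a₀ := hmin ⟨h1, h2⟩
    have h4 : v ^ a ≤ v ^ a₀ :=
      Real.rpow_le_rpow_of_exponent_ge (by linarith) (by linarith) ha
    linarith
  have hle' : ∀ a v : ℝ, a₀ ≤ a → 0 ≤ v → v ≤ 1 → v ^ a ≤ v := by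
    intro a v ha h1 h2
    have := Real.rpow_le_rpow_of_exponent_ge' h1 h2 zero_le_one (by linarith : 1 ≤ a)
    simpa using this
  refine ⟨min (κ / 8) (φ / 4), by positivity, ?_⟩
  intro a x y u v ha hu0 hu1 hv0 hv1 hux hvy hyu hxv
  have hω1 : min (κ / 8) (φ / 4) ≤ κ / 8 := min_le_left _ _
  have hω2 : min (κ / 8) (φ / 4) ≤ φ / 4 := min_le_right _ _
  have hu := hle' a u ha hu0 hu1
  have hv := hle' a v ha hv0 hv1
  rcases lt_or_ge v (κ / 2) with h1 | h1
  · left; constructor <;> linarith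
  rcases le_or_gt v (1 - κ / 2) with h2 | h2
  · have := hle a v ha h1 h2
    linarith
  rcases lt_or_ge u (κ / 2) with h3 | h3
  · linarith
  rcases le_or_gt u (1 - κ / 2) with h4 | h4
  · have := hle a u ha h3 h4
    linarith
  right; constructor <;> linarith

end BiasedIntersection

/-! ### Pulling closeness to a core family back along a shift -/

namespace BiasedIntersection

open Finset

variable {n : ℕ} {p : ℝ}

theorem mem_coreFamily_mono {M N A : Finset (Fin n)} {k : ℕ} (h : A ∩ M ⊆ A ∩ N)
    (hA : A ∈ coreFamily M k) : A ∈ coreFamily N k := by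
  rw [mem_coreFamily] at hA ⊢
  exact hA.trans (card_le_card h)

/-- If the shift moves towards an element outside the core, the shift can be undone for free. -/
theorem sdiff_core_le_of_shift {i j : Fin n} {F : Finset (Finset (Fin n))} (h0 : 0 ≤ p)
    (h1 : p ≤ 1) {M : Finset (Fin n)} {k : ℕ} (hj : j ∈ M) (hi : i ∉ M) :
    biasedMeasure p (F \ coreFamily M k) ≤ biasedMeasure p (shift i j F \ coreFamily M k) := by
  set G := coreFamily M k with hG
  set H := G ∩ coreFamily (swapSet i j M) k with hH
  have hinv : ∀ A ∈ H, swapSet i j A ∈ H := by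
    intro A hA
    rw [hH, mem_inter] at hA ⊢
    rw [hG, swapSet_mem_coreFamily, swapSet_mem_coreFamily, swapSet_swapSet]
    exact hA.symm
  have e1 := biasedMeasure_inter_add_sdiff (p := p) F G
  have e2 := biasedMeasure_inter_add_sdiff (p := p) (shift i j F) G
  rw [biasedMeasure_shift] at e2
  suffices h : biasedMeasure p (shift i j F ∩ G) ≤ biasedMeasure p (F ∩ G) by linarith
  have e3 := biasedMeasure_inter_add_sdiff (p := p) (F ∩ G) H
  have e4 := biasedMeasure_inter_add_sdiff (p := p) (shift i j F ∩ G) H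
  have hHG : G ∩ H = H := by rw [hH]; exact inter_eq_right.2 inter_subset_left
  rw [inter_assoc, hHG] at e3 e4
  rw [biasedMeasure_shift_inter hinv] at e4
  suffices h : biasedMeasure p ((shift i j F ∩ G) \ H) ≤ biasedMeasure p ((F ∩ G) \ H) by
    linarith
  refine biasedMeasure_mono h0 h1 fun A hA => ?_
  simp only [mem_sdiff, mem_inter] at hA ⊢
  refine ⟨⟨?_, hA.1.2⟩, hA.2⟩
  rcases mem_shift.1 hA.1.1 with h | h
  · exact h.1
  · exfalso
    refine hA.2 ?_
    rw [hH, mem_inter]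
    refine ⟨hA.1.2, mem_coreFamily_mono (fun x hx => ?_) hA.1.2⟩
    rw [mem_inter] at hx ⊢
    refine ⟨hx.1, ?_⟩
    rw [mem_swapSet, Equiv.swap_apply_of_ne_of_ne]
    · exact hx.2
    · rintro rfl
      exact hi hx.2
    · rintro rfl
      exact h.2.1 hx.1

theorem trace_measure_le {E Q : Finset (Fin n)} (hE : E ⊆ Q)
    {G F : Finset (Finset (Fin n))} (h0 : 0 ≤ p) (h1 : p ≤ 1)
    (hG : ∀ A, A ∩ Q = E → A ∈ G) :
    p ^ E.card * (1 - p) ^ (Q.card - E.card) * (1 - biasedMeasure p (slice F Q E)) ≤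
      biasedMeasure p (G \ F) := by
  have h2 : (slice F Q E)ᶜ = slice Fᶜ Q E := by ext; simp
  rw [← biasedMeasure_compl, h2, ← biasedMeasure_slice _ hE]
  refine biasedMeasure_mono h0 h1 fun A hA => ?_
  simp only [mem_filter, mem_compl, mem_sdiff] at hA ⊢
  exact ⟨hG A hA.2, hA.1⟩

theorem slice_shift_subset {i j : Fin n} (hij : i ≠ j) {F : Finset (Finset (Fin n))}
    {Q C : Finset (Fin n)} (hi : i ∈ Q) (hj : j ∈ Q) (hiC : i ∉ C) (hjC : j ∉ C) :
    slice (shift i j F) Q (insert i C) ⊆ slice F Q (insert i C) ∪ slice F Q (insert j C) := by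
  intro A hA
  rw [mem_slice] at hA
  rw [mem_union, mem_slice, mem_slice]
  rcases mem_shift.1 hA with h | h
  · exact Or.inl h.1
  · right
    have h3 := h.2.2
    rw [swapSet_of_mem_of_notMem h.1 h.2.1] at h3
    convert h3 using 1
    ext x
    simp only [mem_union, mem_sdiff, mem_insert, mem_erase]
    by_cases hx : x = i
    · subst hx; simp [hi, hij, hiC]
    by_cases hx' : x = j
    · subst hx'; simp
    simp [hx, hx']

/-- Exchanging `i` for `j` in the core affects only sets on the threshold: those with `k - 1` points
in the common part that contain exactly one of `i` and `j`. -/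
theorem trace_cases {i j : Fin n} (hij : i ≠ j) {M A : Finset (Fin n)} (hi : i ∈ M) (hj : j ∉ M)
    {k : ℕ} (hA : A ∈ coreFamily (swapSet i j M) k) (hA' : A ∉ coreFamily M k) :
    j ∈ A ∧ i ∉ A ∧ (A ∩ M.erase i).card + 1 = k := by
  rw [mem_coreFamily] at hA hA'
  rw [swapSet_of_mem_of_notMem hi hj] at hA
  have hjM : j ∉ M.erase i := fun h => hj (mem_of_mem_erase h)
  have e1 : A ∩ M = if i ∈ A then insert i (A ∩ M.erase i) else A ∩ M.erase i := by
    split_ifs with h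
    · ext x
      simp only [mem_inter, mem_insert, mem_erase]
      by_cases hx : x = i
      · subst hx; simp [h, hi]
      · simp [hx]
    · ext x
      simp only [mem_inter, mem_erase]
      by_cases hx : x = i
      · subst hx; simp [h]
      · simp [hx]
  have e2 : A ∩ insert j (M.erase i) =
      if j ∈ A then insert j (A ∩ M.erase i) else A ∩ M.erase i := by
    split_ifs with h
    · rw [inter_insert_of_mem h]
    · rw [inter_insert_of_notMem h]
  have c1 : i ∉ A ∩ M.erase i := by simp
  have c2 : j ∉ A ∩ M.erase i := fun h => hjM (mem_of_mem_inter_right h)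
  rw [e1] at hA'
  rw [e2] at hA
  split_ifs at hA hA' with h1 h2
  · rw [card_insert_of_notMem c2] at hA
    rw [card_insert_of_notMem c1] at hA'
    omega
  · rw [card_insert_of_notMem c2] at hA
    exact ⟨h1, h2, by omega⟩
  · rw [card_insert_of_notMem c1] at hA'
    omega
  · omega

/-- If a shift of a large `t`-intersecting family is close to a core family, so is the family. -/
theorem exists_shift_back {ζ : ℝ} (hζ : 0 < ζ) (hζ4 : ζ ≤ 1 / 4) {t : ℕ} (ht : 1 ≤ t) (R : ℕ)
    {κ : ℝ} (hκ : 0 < κ) :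
    ∃ η : ℝ, 0 < η ∧ ∀ (n : ℕ) (p : ℝ), BiasRange ζ p → ∀ (r : ℕ), r ≤ R → (r = 0 ∨ 2 ≤ t) →
      ∀ M : Finset (Fin n), M.card = t + 2 * r → ∀ F : Finset (Finset (Fin n)),
      TIntersecting t F → UpClosed F → ∀ i j : Fin n, i ≠ j →
      biasedMeasure p (coreFamily M (t + r)) ≤ biasedMeasure p F + η →
      biasedMeasure p (shift i j F \ coreFamily M (t + r)) ≤ η →
      ∃ M' : Finset (Fin n), M'.card = t + 2 * r ∧
        biasedMeasure p (F \ coreFamily M' (t + r)) ≤ κ := by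
  obtain ⟨a₀, a₁, ha₀, hexp⟩ := exists_exponent_bounds hζ hζ4
  set δ := min (κ / 2) (1 / 4) with hδ
  have hδ0 : 0 < δ := by positivity
  have hδκ : δ ≤ κ / 2 := min_le_left _ _
  have hδ4 : δ ≤ 1 / 4 := min_le_right _ _
  obtain ⟨ω, hω, hdich⟩ := exists_dichotomy ha₀ hδ0 hδ4
  set w : ℝ := ζ ^ (t + 2 * R + 1) with hw
  have hw0 : 0 < w := pow_pos hζ _
  refine ⟨min (κ / 2) (ω * w / 2), by positivity, ?_⟩
  intro n p hp r hr hrt M hM F hF hup i j hij hμ hS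
  obtain ⟨hIs, hle, -⟩ := hexp p hp
  set a := Real.logb (1 - p) p with ha
  have hp0 := hIs.pos
  have hp1 := hIs.lt_one
  have hη1 : min (κ / 2) (ω * w / 2) ≤ κ / 2 := min_le_left _ _
  have hη2 : min (κ / 2) (ω * w / 2) ≤ ω * w / 2 := min_le_right _ _
  set η := min (κ / 2) (ω * w / 2) with hη
  by_cases hinv : i ∈ M ↔ j ∈ M
  · refine ⟨M, hM, ?_⟩
    rw [← biasedMeasure_shift_sdiff (i := i) (j := j)]
    · linarith
    · intro A hA
      rwa [swapSet_mem_coreFamily, swapSet_of_mem_iff hinv]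
  by_cases hi : i ∈ M
  swap
  · have hj : j ∈ M := by tauto
    refine ⟨M, hM, (sdiff_core_le_of_shift hp0.le hp1.le hj hi).trans ?_⟩
    linarith
  have hj : j ∉ M := by tauto
  -- Only the case `i ∈ M`, `j ∉ M` is substantial: the shift may have merged pieces of `F`
  -- belonging to the core `M` and to its swap. `K` is the common part of the two cores and `Q`
  -- their union.
  set K := M.erase i with hK
  set Q := insert j M with hQ
  have hiK : i ∉ K := by simp [hK]
  have hjK : j ∉ K := fun h => hj (mem_of_mem_erase h)
  have hKM : K ⊆ M := erase_subset _ _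
  have hKc : K.card + 1 = t + 2 * r := by rw [← hM]; exact card_erase_add_one hi
  have hQc : Q.card = t + 2 * r + 1 := by rw [hQ, card_insert_of_notMem hj, hM]
  have hiQ : i ∈ Q := mem_insert_of_mem hi
  have hjQ : j ∈ Q := mem_insert_self _ _
  have hKQ : K ⊆ Q := hKM.trans (subset_insert _ _)
  set G := coreFamily M (t + r) with hG
  set G' := coreFamily (swapSet i j M) (t + r) with hG'
  set bi : Finset (Fin n) → ℝ := fun C => biasedMeasure p (slice F Q (insert i C)) with hbi
  set bj : Finset (Fin n) → ℝ := fun C => biasedMeasure p (slice F Q (insert j C)) with hbj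
  have nn := fun F : Finset (Finset (Fin n)) => biasedMeasure_nonneg hp0.le hp1.le F
  have le1 := fun F : Finset (Finset (Fin n)) => biasedMeasure_le_one hp0.le hp1.le F
  have hGS : biasedMeasure p (G \ shift i j F) ≤ ω * w := by
    rw [biasedMeasure_sdiff_comm, biasedMeasure_shift]; linarith
  -- The shifted family contains almost every set with trace `insert i C` on `Q`, and each of these
  -- comes from the `i`-slice or the `j`-slice of `F`.
  have hsum : ∀ C ⊆ K, C.card + 1 = t + r → 1 - bi C ≤ bj C + ω := by
    intro C hC hCc
    have hiC : i ∉ C := fun h => hiK (hC h)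
    have hjC : j ∉ C := fun h => hjK (hC h)
    have hE : insert i C ⊆ Q := insert_subset hiQ (hC.trans hKQ)
    have hEc : (insert i C).card = t + r := by rw [card_insert_of_notMem hiC, hCc]
    have h1 := trace_measure_le hE (F := shift i j F) (G := G) hp0.le hp1.le (by
      intro A hA
      rw [hG, mem_coreFamily, ← hEc, ← hA]
      refine card_le_card fun x hx => ?_
      have hx' : x ∈ insert i C := hA ▸ hx
      rw [mem_inter] at hx ⊢
      refine ⟨hx.1, ?_⟩
      rw [mem_insert] at hx'
      rcases hx' with rfl | hx'
      · exact hi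
      · exact hKM (hC hx'))
    have h2 : w ≤ p ^ (insert i C).card * (1 - p) ^ (Q.card - (insert i C).card) := by
      rw [hEc, hQc, show t + 2 * r + 1 - (t + r) = r + 1 by omega]
      calc w ≤ ζ ^ (t + 2 * r + 1) :=
            pow_le_pow_of_le_one hζ.le (by linarith) (by omega)
        _ = ζ ^ (t + r) * ζ ^ (r + 1) := by rw [← pow_add]; congr 1; omega
        _ ≤ _ := by
          gcongr
          · exact hp.1
          · have := hp.2; linarith
    have h3 : 0 ≤ 1 - biasedMeasure p (slice (shift i j F) Q (insert i C)) := by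
      linarith [le1 (slice (shift i j F) Q (insert i C))]
    have h4 : w * (1 - biasedMeasure p (slice (shift i j F) Q (insert i C))) ≤ w * ω := by
      refine (mul_le_mul_of_nonneg_right h2 h3).trans (h1.trans ?_)
      linarith
    have h5 := le_of_mul_le_mul_left h4 hw0
    have h6 := (biasedMeasure_mono hp0.le hp1.le
      (slice_shift_subset (F := F) hij hiQ hjQ hiC hjC)).trans
      (biasedMeasure_union_le hp0.le hp1.le _ _)
    simp only [hbi, hbj]
    linarith
  have hcross : ∀ C ⊆ K, ∀ D ⊆ K, (C ∩ D).card < t →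
      bj D ≤ (1 - bi C) ^ a ∧ bi D ≤ (1 - bj C) ^ a := by
    intro C hC D hD hCD
    have hiC : i ∉ C := fun h => hiK (hC h)
    have hjC : j ∉ C := fun h => hjK (hC h)
    have hiD : i ∉ D := fun h => hiK (hD h)
    have hjD : j ∉ D := fun h => hjK (hD h)
    constructor
    · refine hIs.slice_le hF hup (insert_subset hiQ (hC.trans hKQ))
        (insert_subset hjQ (hD.trans hKQ)) ?_
      rw [insert_inter_of_notMem (by simp [hij, hiD]), inter_insert_of_notMem hjC]
      exact hCD
    · refine hIs.slice_le hF hup (insert_subset hjQ (hC.trans hKQ))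
        (insert_subset hiQ (hD.trans hKQ)) ?_
      rw [insert_inter_of_notMem (by simp [hij.symm, hjD]), inter_insert_of_notMem hiC]
      exact hCD
  have hpair : ∀ C ⊆ K, ∀ D ⊆ K, C.card + 1 = t + r → D.card + 1 = t + r → (C ∩ D).card < t →
      (bj C ≤ δ ∧ bj D ≤ δ) ∨ (1 - δ ≤ bj C ∧ 1 - δ ≤ bj D) := by
    intro C hC D hD hCc hDc hCD
    refine hdich a (bj C) (bj D) (1 - bi C) (1 - bi D) hle ?_ ?_ ?_ ?_ (hsum C hC hCc)
      (hsum D hD hDc) (hcross C hC D hD hCD).1 ?_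
    · linarith [le1 (slice F Q (insert i C))]
    · linarith [nn (slice F Q (insert i C))]
    · linarith [le1 (slice F Q (insert i D))]
    · linarith [nn (slice F Q (insert i D))]
    · rw [inter_comm] at hCD
      exact (hcross D hD C hC hCD).1
  -- Adjacent traces are both almost empty or both almost full on the `j` side; connectivity makes
  -- the choice global. An empty `j` side gives the core `M`, a full one gives its swap.
  have hconn := kneser_connected hrt hKc (fun C => bj C ≤ δ) (by
    intro C hC D hD hCc hDc hCD
    rcases hpair C hC D hD hCc hDc hCD with h | h
    · exact ⟨fun _ => h.2, fun _ => h.1⟩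
    · constructor <;> intro h' <;> linarith)
  have hH : ∀ A ∈ G ∪ G', swapSet i j A ∈ G ∪ G' := by
    intro A hA
    rw [mem_union] at hA ⊢
    rw [hG, hG', swapSet_mem_coreFamily, swapSet_mem_coreFamily, swapSet_swapSet]
    exact hA.symm
  -- `G ∪ G'` is invariant under the swap, so the shift preserves the measure of `F` outside it.
  have hrest : biasedMeasure p (F \ (G ∪ G')) ≤ κ / 2 := by
    rw [← biasedMeasure_shift_sdiff hH]
    refine (biasedMeasure_mono hp0.le hp1.le (sdiff_subset_sdiff Subset.rfl
      subset_union_left)).trans ?_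
    linarith
  have hinsert : ∀ (x : Fin n) (E : Finset (Fin n)), E ⊆ Q → x ∈ E →
      (∀ y ∈ Q, y ∉ K → y ∈ E → y = x) → x ∉ K → E = insert x (E ∩ K) := by
    intro x E hE hxE hy hxK
    ext z
    rw [mem_insert, mem_inter]
    constructor
    · intro hz
      by_cases hzK : z ∈ K
      · exact Or.inr ⟨hz, hzK⟩
      · exact Or.inl (hy z (hE hz) hzK hz)
    · rintro (rfl | h)
      · exact hxE
      · exact h.1
  have hQK : ∀ y ∈ Q, y ∉ K → y = i ∨ y = j := by
    intro y hy hyK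
    rw [hQ, mem_insert] at hy
    rw [hK, mem_erase] at hyK
    tauto
  have htr : ∀ A : Finset (Fin n), A ∩ Q ∩ K = A ∩ K := fun A => by
    rw [inter_assoc, inter_eq_right.2 hKQ]
  by_cases hall : ∀ C ⊆ K, C.card + 1 = t + r → bj C ≤ δ
  · refine ⟨M, hM, ?_⟩
    have hb : biasedMeasure p (F.filter fun A =>
        j ∈ A ∩ Q ∧ i ∉ A ∩ Q ∧ (A ∩ Q ∩ K).card + 1 = t + r) ≤ δ := by
      refine biasedMeasure_filter_trace_le hp0.le hp1.le F Q
        (fun E => j ∈ E ∧ i ∉ E ∧ (E ∩ K).card + 1 = t + r) hδ0.le ?_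
      rintro E hE ⟨h1, h2, h3⟩
      rw [hinsert j E hE h1 (fun y hy hyK hyE => (hQK y hy hyK).resolve_left
        (fun h => h2 (h ▸ hyE))) hjK]
      exact hall _ inter_subset_right h3
    have hsub : F \ G ⊆ (F \ (G ∪ G')) ∪ F.filter fun A =>
        j ∈ A ∩ Q ∧ i ∉ A ∩ Q ∧ (A ∩ Q ∩ K).card + 1 = t + r := by
      intro A hA
      rw [mem_sdiff] at hA
      rw [mem_union, mem_sdiff, mem_union, mem_filter, htr]
      by_cases hAG : A ∈ G'
      · right
        obtain ⟨h1, h2, h3⟩ := trace_cases hij hi hj hAG hA.2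
        exact ⟨hA.1, mem_inter.2 ⟨h1, hjQ⟩, fun h => h2 (mem_inter.1 h).1, h3⟩
      · left
        exact ⟨hA.1, by tauto⟩
    refine (biasedMeasure_mono hp0.le hp1.le hsub).trans
      ((biasedMeasure_union_le hp0.le hp1.le _ _).trans ?_)
    linarith
  · push Not at hall
    obtain ⟨C₀, hC₀, hC₀c, hC₀b⟩ := hall
    have hall' : ∀ C ⊆ K, C.card + 1 = t + r → bi C ≤ δ := by
      intro C hC hCc
      obtain ⟨E, hEK, hEc, hE⟩ := exists_neighbour ht hKc (C₀ := C) (by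
        rw [card_sdiff_of_subset hC]; omega)
      have hCE := hE C hC Subset.rfl hCc
      have hECn : ¬ bj E ≤ δ := fun h => not_le.2 hC₀b ((hconn C₀ hC₀ E hEK hC₀c hEc).2 h)
      have hE1 : 1 - δ ≤ bj E := by
        rcases hpair C hC E hEK hCc hEc hCE with h | h
        · exact absurd h.2 hECn
        · exact h.2
      have h1 := (hcross E hEK C hC (by rwa [inter_comm])).2
      have h2 : (1 - bj E) ^ a ≤ 1 - bj E := by
        have := Real.rpow_le_rpow_of_exponent_ge' (x := 1 - bj E)
          (by linarith [le1 (slice F Q (insert j E))])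
          (by linarith [nn (slice F Q (insert j E))]) zero_le_one hIs.one_le
        simpa using this
      linarith
    refine ⟨swapSet i j M, by rw [card_swapSet, hM], ?_⟩
    have hb : biasedMeasure p (F.filter fun A =>
        i ∈ A ∩ Q ∧ j ∉ A ∩ Q ∧ (A ∩ Q ∩ K).card + 1 = t + r) ≤ δ := by
      refine biasedMeasure_filter_trace_le hp0.le hp1.le F Q
        (fun E => i ∈ E ∧ j ∉ E ∧ (E ∩ K).card + 1 = t + r) hδ0.le ?_
      rintro E hE ⟨h1, h2, h3⟩
      rw [hinsert i E hE h1 (fun y hy hyK hyE => (hQK y hy hyK).resolve_right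
        (fun h => h2 (h ▸ hyE))) hiK]
      exact hall' _ inter_subset_right h3
    have hsub : F \ G' ⊆ (F \ (G ∪ G')) ∪ F.filter fun A =>
        i ∈ A ∩ Q ∧ j ∉ A ∩ Q ∧ (A ∩ Q ∩ K).card + 1 = t + r := by
      intro A hA
      rw [mem_sdiff] at hA
      rw [mem_union, mem_sdiff, mem_union, mem_filter, htr]
      by_cases hAG : A ∈ G
      · right
        have hs := swapSet_swapSet i j M
        rw [swapSet_comm] at hs
        have hjM' : j ∈ swapSet i j M := by simp [hi]
        have hiM' : i ∉ swapSet i j M := by simp [hj]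
        obtain ⟨h1, h2, h3⟩ := trace_cases (M := swapSet i j M) hij.symm hjM' hiM'
          (A := A) (k := t + r) (by rw [hs]; exact hAG) hA.2
        have hK' : (swapSet i j M).erase j = K := by
          rw [swapSet_of_mem_of_notMem hi hj, erase_insert hjK]
        rw [hK'] at h3
        exact ⟨hA.1, mem_inter.2 ⟨h1, hiQ⟩, fun h => h2 (mem_inter.1 h).1, h3⟩
      · left
        exact ⟨hA.1, by tauto⟩
    refine (biasedMeasure_mono hp0.le hp1.le hsub).trans
      ((biasedMeasure_union_le hp0.le hp1.le _ _).trans ?_)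
    linarith

end BiasedIntersection

namespace BiasedIntersection

open Finset

variable {n : ℕ} {p : ℝ} {t : ℕ}

/-! ### Removing the last relevant coordinate -/

/-- Left-compressed families. -/
def Shifted (F : Finset (Finset (Fin n))) : Prop :=
  ∀ i j : Fin n, i < j → ∀ A ∈ F, j ∈ A → i ∉ A → swapSet i j A ∈ F

/-- For an up-closed family: membership depends on the first `m` coordinates only. -/
def DependsOn (F : Finset (Finset (Fin n))) (m : ℕ) : Prop :=
  ∀ A ∈ F, A ∩ initSeg n m ∈ F

/-- The members of `F` that leave `F` when `e` is removed. -/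
def pivotal (F : Finset (Finset (Fin n))) (e : Fin n) : Finset (Finset (Fin n)) :=
  F.filter fun A => e ∈ A ∧ A.erase e ∉ F

theorem mem_pivotal {F : Finset (Finset (Fin n))} {e : Fin n} {A : Finset (Fin n)} :
    A ∈ pivotal F e ↔ A ∈ F ∧ e ∈ A ∧ A.erase e ∉ F := by simp [pivotal]

theorem card_inter_add_card_inter {A C P : Finset (Fin n)} (hP : P ⊆ A ∪ C) (h : A ∩ C ⊆ P) :
    (A ∩ P).card + (C ∩ P).card = P.card + (A ∩ C).card := by
  rw [← card_union_add_card_inter, ← union_inter_distrib_right, inter_eq_right.2 hP]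
  congr 2
  ext x
  simp only [mem_inter]
  have := @h x
  rw [mem_inter] at this
  tauto

/-- Deleting `e` can only hurt a pair with `|A ∩ C| = t` and `e` in both. Restricting `A` to the
relevant coordinates shows that `A ∩ C` lies among them; if some `x < e` were in neither set,
shifting `e` to `x` in `A` would leave only `t - 1` common points. So the two sets cover the segment
and their sizes there are complementary. -/
theorem erase_conflict {F : Finset (Finset (Fin n))} (hF : TIntersecting t F)
    (hs : Shifted F) {e : Fin n} (hd : DependsOn F (e.val + 1))
    {A C : Finset (Fin n)} (hA : A ∈ F) (heA : e ∈ A) (hC : C ∈ F)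
    (h : (A.erase e ∩ C).card < t) :
    C ∈ pivotal F e ∧ initSeg n (e.val + 1) ⊆ A ∪ C ∧
      (A ∩ initSeg n (e.val + 1)).card + (C ∩ initSeg n (e.val + 1)).card = e.val + 1 + t := by
  have h1 := hF A hA C hC
  have he1 : A.erase e ∩ C = (A ∩ C).erase e := erase_inter _ _ _
  have heC : e ∈ C := by
    by_contra hne
    rw [he1, erase_eq_of_notMem (fun h => hne (mem_inter.1 h).2)] at h
    omega
  have heAC : e ∈ A ∩ C := mem_inter.2 ⟨heA, heC⟩
  have hlt : ((A ∩ C).erase e).card < t := he1 ▸ h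
  have hcard : (A ∩ C).card = t := by
    rw [card_erase_of_mem heAC] at hlt
    omega
  have hpre : A ∩ C ⊆ initSeg n (e.val + 1) := by
    have h2 := hF _ (hd A hA) C hC
    have h3 : A ∩ initSeg n (e.val + 1) ∩ C ⊆ A ∩ C :=
      inter_subset_inter inter_subset_left Subset.rfl
    have h4 := eq_of_subset_of_card_le h3 (by omega)
    rw [← h4]
    exact inter_subset_left.trans inter_subset_right
  have hsub : initSeg n (e.val + 1) ⊆ A ∪ C := by
    intro x hx
    by_contra hne
    rw [mem_union, not_or] at hne
    have hxe : x < e := by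
      rw [mem_initSeg] at hx
      refine lt_of_le_of_ne (Fin.le_def.2 (by omega)) ?_
      rintro rfl
      exact hne.1 heA
    have h2 := hF _ (hs x e hxe A hA heA hne.1) C hC
    rw [swapSet_comm, swapSet_of_mem_of_notMem heA hne.1, insert_inter_of_notMem hne.2] at h2
    omega
  refine ⟨mem_pivotal.2 ⟨hC, heC, fun hCe => ?_⟩, hsub, ?_⟩
  · have h2 := hF A hA _ hCe
    rw [inter_erase] at h2
    omega
  · rw [card_inter_add_card_inter hsub hpre, hcard, card_initSeg_of_le e.2]

/-- Remove `Rm` from `F` and add all sets obtained by removing `e` from a member of `F₁`. -/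
def eraseStep (F F₁ Rm : Finset (Finset (Fin n))) (e : Fin n) : Finset (Finset (Fin n)) :=
  (F \ Rm) ∪ F₁.image fun A => A.erase e

/-- Two erased sets cause no further trouble: `e` is already absent from the first, so erasing it
from the second does not change the intersection. -/
theorem tIntersecting_eraseStep {F F₁ Rm : Finset (Finset (Fin n))} (hF : TIntersecting t F)
    (hs : Shifted F) {e : Fin n} (hd : DependsOn F (e.val + 1)) (hF₁ : F₁ ⊆ pivotal F e)
    (hdis : Disjoint F₁ Rm)
    (hconf : ∀ A ∈ F₁, ∀ C ∈ pivotal F e, C ∉ Rm → initSeg n (e.val + 1) ⊆ A ∪ C →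
      (A ∩ initSeg n (e.val + 1)).card + (C ∩ initSeg n (e.val + 1)).card = e.val + 1 + t →
      False) : TIntersecting t (eraseStep F F₁ Rm e) := by
  have key : ∀ A ∈ F₁, ∀ C ∈ F, C ∉ Rm → t ≤ (A.erase e ∩ C).card := by
    intro A hA C hC hCR
    by_contra hlt
    have hA' := mem_pivotal.1 (hF₁ hA)
    obtain ⟨h1, h2, h3⟩ := erase_conflict hF hs hd hA'.1 hA'.2.1 hC (not_le.1 hlt)
    exact hconf A hA C h1 hCR h2 h3
  intro A hA B hB
  rw [eraseStep, mem_union, mem_sdiff, mem_image] at hA hB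
  rcases hA with hA | ⟨A, hA, rfl⟩ <;> rcases hB with hB | ⟨B, hB, rfl⟩
  · exact hF A hA.1 B hB.1
  · rw [inter_comm]
    exact key B hB A hA.1 hA.2
  · exact key A hA B hB.1 hB.2
  · have h1 := key A hA B (mem_pivotal.1 (hF₁ hB)).1 (disjoint_left.1 hdis hB)
    have h2 : A.erase e ∩ B.erase e = (A.erase e ∩ B).erase e := inter_erase _ _ _
    rwa [h2, erase_eq_of_notMem fun h => notMem_erase e A (mem_inter.1 h).1]

theorem biasedMeasure_eraseStep {F F₁ Rm : Finset (Finset (Fin n))} {e : Fin n}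
    (hF₁ : F₁ ⊆ pivotal F e) (hR : Rm ⊆ F) :
    p * biasedMeasure p (eraseStep F F₁ Rm e) =
      p * biasedMeasure p F - p * biasedMeasure p Rm + (1 - p) * biasedMeasure p F₁ := by
  rw [eraseStep, biasedMeasure_union_of_disjoint, mul_add, biasedMeasure_sdiff_of_subset hR,
    biasedMeasure_image_erase]
  · ring
  · exact fun A hA => (mem_pivotal.1 (hF₁ hA)).2.1
  · rw [disjoint_left]
    intro A hA hA'
    obtain ⟨B, hB, rfl⟩ := mem_image.1 hA'
    exact (mem_pivotal.1 (hF₁ hB)).2.2 (mem_sdiff.1 hA).1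

/-- `F'` has larger measure than `F`, and `F \ F'` has measure at most `b`. -/
def Improvable (t : ℕ) (p : ℝ) (F : Finset (Finset (Fin n))) (b : ℝ) : Prop :=
  ∃ F' : Finset (Finset (Fin n)), TIntersecting t F' ∧
    biasedMeasure p F < biasedMeasure p F' ∧ biasedMeasure p (F \ F') ≤ b

theorem improvable_of_eraseStep (hp : 0 < p) (hp1 : p < 1)
    {F F₁ Rm : Finset (Finset (Fin n))} (hF : TIntersecting t F)
    (hs : Shifted F) {e : Fin n} (hd : DependsOn F (e.val + 1)) (hF₁ : F₁ ⊆ pivotal F e)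
    (hR : Rm ⊆ F) (hdis : Disjoint F₁ Rm)
    (hconf : ∀ A ∈ F₁, ∀ C ∈ pivotal F e, C ∉ Rm → initSeg n (e.val + 1) ⊆ A ∪ C →
      (A ∩ initSeg n (e.val + 1)).card + (C ∩ initSeg n (e.val + 1)).card = e.val + 1 + t →
      False)
    (hgain : p * biasedMeasure p Rm < (1 - p) * biasedMeasure p F₁) {b : ℝ}
    (hb : biasedMeasure p Rm ≤ b) : Improvable t p F b := by
  refine ⟨eraseStep F F₁ Rm e, tIntersecting_eraseStep hF hs hd hF₁ hdis hconf, ?_, ?_⟩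
  · have h := biasedMeasure_eraseStep (p := p) hF₁ hR
    refine lt_of_mul_lt_mul_left ?_ hp.le
    rw [h]
    linarith
  · refine (biasedMeasure_mono hp.le hp1.le fun A hA => ?_).trans hb
    rw [mem_sdiff, eraseStep, mem_union, mem_sdiff] at hA
    by_contra hne
    exact hA.2 (Or.inl ⟨hA.1, hne⟩)

/-- The members of the family `G` with exactly `k` elements in `P`. -/
def layer (G : Finset (Finset (Fin n))) (P : Finset (Fin n)) (k : ℕ) : Finset (Finset (Fin n)) :=
  G.filter fun A => (A ∩ P).card = k

theorem mem_layer {G : Finset (Finset (Fin n))} {P : Finset (Fin n)} {k : ℕ}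
    {A : Finset (Fin n)} : A ∈ layer G P k ↔ A ∈ G ∧ (A ∩ P).card = k := by simp [layer]

/-- The sets with at least half of their possible elements in the first `m` coordinates. -/
def heavy (n m : ℕ) : Finset (Finset (Fin n)) :=
  univ.filter fun A => m ≤ 2 * (A ∩ initSeg n m).card

theorem layer_pivotal_subset {F : Finset (Finset (Fin n))} {e : Fin n} {P : Finset (Fin n)}
    {k : ℕ} : layer (pivotal F e) P k ⊆ F := fun _ hA =>
  (mem_pivotal.1 (mem_layer.1 hA).1).1

/-- Conflicts pair layer `i` only with layer `j`. One may erase `e` in either layer at the cost of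
removing the other, and since `p < 1 - p` at least one choice gains. -/
theorem improvable_of_ne (hp : 0 < p) (hp2 : p < 1 / 2)
    {F : Finset (Finset (Fin n))} (hF : TIntersecting t F) (hs : Shifted F) {e : Fin n}
    (hd : DependsOn F (e.val + 1)) {i j : ℕ} (hij : i + j = e.val + 1 + t) (hlt : i < j)
    (hne : (layer (pivotal F e) (initSeg n (e.val + 1)) i).Nonempty ∨
      (layer (pivotal F e) (initSeg n (e.val + 1)) j).Nonempty) :
    Improvable t p F (biasedMeasure p (heavy n (e.val + 1))) := by
  set gi := layer (pivotal F e) (initSeg n (e.val + 1)) i with hgi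
  set gj := layer (pivotal F e) (initSeg n (e.val + 1)) j with hgj
  have hp1 : p < 1 := by linarith
  have hdis : Disjoint gi gj := by
    rw [disjoint_left]
    intro A hA hA'
    rw [hgi, mem_layer] at hA
    rw [hgj, mem_layer] at hA'
    omega
  have hj : biasedMeasure p gj ≤ biasedMeasure p (heavy n (e.val + 1)) := by
    refine biasedMeasure_mono hp.le hp1.le fun A hA => ?_
    rw [hgj, mem_layer] at hA
    simp only [heavy, mem_filter, mem_univ, true_and]
    omega
  have nni := biasedMeasure_nonneg hp.le hp1.le gi
  have nnj := biasedMeasure_nonneg hp.le hp1.le gj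
  by_cases hg : p * biasedMeasure p gj < (1 - p) * biasedMeasure p gi
  · refine improvable_of_eraseStep hp hp1 hF hs hd (filter_subset _ _) layer_pivotal_subset hdis
      ?_ hg hj
    intro A hA C hC hCR _ hc
    replace hA := mem_layer.1 hA
    rw [mem_layer] at hCR
    exact hCR ⟨hC, by omega⟩
  · rw [not_lt] at hg
    -- When the light layer is the one removed, it is no larger than the heavy one, so the removed
    -- measure is bounded by `heavy` in both cases.
    have hle : biasedMeasure p gi ≤ biasedMeasure p gj := by nlinarith
    have hpos : 0 < biasedMeasure p gj := by
      rcases hne with h | h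
      · exact (biasedMeasure_pos hp hp1 h).trans_le hle
      · exact biasedMeasure_pos hp hp1 h
    refine improvable_of_eraseStep hp hp1 hF hs hd (F₁ := gj) (filter_subset _ _)
      layer_pivotal_subset hdis.symm ?_ (by nlinarith) (hle.trans hj)
    intro A hA C hC hCR _ hc
    replace hA := mem_layer.1 hA
    rw [mem_layer] at hCR
    exact hCR ⟨hC, by omega⟩

theorem sum_biasedMeasure_filter (G : Finset (Finset (Fin n))) (Q : Finset (Fin n))
    (c : ℕ) (hc : ∀ A ∈ G, (Q \ A).card = c) :
    ∑ x ∈ Q, biasedMeasure p (G.filter fun A => x ∉ A) = c * biasedMeasure p G := by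
  unfold biasedMeasure
  rw [mul_sum]
  simp_rw [sum_filter]
  rw [sum_comm]
  refine sum_congr rfl fun A hA => ?_
  rw [← sum_filter, sum_const, nsmul_eq_mul, filter_notMem_eq_sdiff, hc A hA]

/-- The middle layer conflicts with itself, but two sets that both miss some `x` do not cover the
segment. Each set misses `r` of the `m - 1` coordinates other than `e`, where `m = e + 1`, so some
`x` is missed by a fraction at least `r / (m - 1) > p` of the layer. Keeping those sets and removing
the rest is profitable. -/
theorem improvable_of_middle (hp : 0 < p) (hp2 : p < 1 / 2)
    {F : Finset (Finset (Fin n))} (hF : TIntersecting t F) (hs : Shifted F) {e : Fin n}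
    (hd : DependsOn F (e.val + 1)) {r : ℕ} (hr : e.val + 1 = t + 2 * r)
    (hne : (layer (pivotal F e) (initSeg n (e.val + 1)) (t + r)).Nonempty)
    (hpr : (e.val : ℝ) * p < r) :
    Improvable t p F (biasedMeasure p (heavy n (e.val + 1))) := by
  set g := layer (pivotal F e) (initSeg n (e.val + 1)) (t + r) with hg
  have hp1 : p < 1 := by linarith
  have hPc : (initSeg n (e.val + 1)).card = e.val + 1 := card_initSeg_of_le e.2
  have heP : e ∈ (initSeg n (e.val + 1)) := by simp
  have hpos : 0 < biasedMeasure p g := biasedMeasure_pos hp hp1 hne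
  have hsum := sum_biasedMeasure_filter (p := p) g ((initSeg n (e.val + 1)).erase e) r (by
    intro A hA
    rw [hg, mem_layer, mem_pivotal] at hA
    have h1 : (initSeg n (e.val + 1)).erase e \ A = (initSeg n (e.val + 1)) \ A := by
      ext x
      simp only [mem_sdiff, mem_erase]
      constructor
      · tauto
      · rintro ⟨h1, h2⟩
        exact ⟨⟨fun h => h2 (h ▸ hA.1.2.1), h1⟩, h2⟩
    have h2 := card_sdiff_add_card_inter (initSeg n (e.val + 1)) A
    rw [inter_comm (initSeg n (e.val + 1)) A] at h2
    rw [h1]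
    omega)
  obtain ⟨x, hx, hxg⟩ : ∃ x ∈ (initSeg n (e.val + 1)).erase e,
      p * biasedMeasure p g < biasedMeasure p (g.filter fun A => x ∉ A) := by
    by_contra hcon
    push Not at hcon
    have h1 := sum_le_sum hcon
    rw [hsum, sum_const, card_erase_of_mem heP, hPc, nsmul_eq_mul, Nat.add_sub_cancel] at h1
    nlinarith
  have hxP := mem_of_mem_erase hx
  refine improvable_of_eraseStep hp hp1 hF hs hd (F₁ := g.filter fun A => x ∉ A)
    (Rm := g \ g.filter fun A => x ∉ A)
    ((filter_subset _ _).trans (filter_subset _ _))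
    (sdiff_subset.trans layer_pivotal_subset) disjoint_sdiff ?_ ?_ ?_
  · intro A hA C hC hCR hsub hc
    rw [mem_filter] at hA
    have hCg : C ∈ g := by
      have hA1 := hA.1
      rw [hg, mem_layer] at hA1 ⊢
      exact ⟨hC, by omega⟩
    have hxC : x ∉ C := by
      intro hxC
      exact hCR (by simp [hCg, hxC])
    have := hsub hxP
    rw [mem_union] at this
    tauto
  · rw [biasedMeasure_sdiff_of_subset (filter_subset _ _)]
    linarith
  · refine biasedMeasure_mono hp.le hp1.le fun A hA => ?_
    have hA := (mem_sdiff.1 hA).1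
    rw [hg, mem_layer] at hA
    simp only [heavy, mem_filter, mem_univ, true_and]
    omega

/-- A shifted `t`-intersecting family whose last relevant coordinate is the `m`-th can be improved,
unless `m = t + 2r` with `r / (t + 2r - 1) ≤ p`. -/
theorem improvable_or (hp : 0 < p) (hp2 : p < 1 / 2)
    {F : Finset (Finset (Fin n))} (hF : TIntersecting t F) (hs : Shifted F) {e : Fin n}
    (hd : DependsOn F (e.val + 1)) (hd' : ¬ DependsOn F e.val) :
    Improvable t p F (biasedMeasure p (heavy n (e.val + 1))) ∨
      ∃ r : ℕ, e.val + 1 = t + 2 * r ∧ (r : ℝ) ≤ (e.val : ℝ) * p := by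
  have hPc : (initSeg n (e.val + 1)).card = e.val + 1 := card_initSeg_of_le e.2
  obtain ⟨A, hA, hAn⟩ : ∃ A ∈ F, A ∩ initSeg n e.val ∉ F := by
    unfold DependsOn at hd'
    push Not at hd'
    exact hd'
  have hB := hd A hA
  set B := A ∩ initSeg n (e.val + 1) with hBdef
  have hBe : B.erase e = A ∩ initSeg n e.val := by
    ext x
    simp only [hBdef, mem_erase, mem_inter, mem_initSeg, ne_eq, Fin.ext_iff]
    have : x.val < e.val + 1 ↔ x.val = e.val ∨ x.val < e.val := by omega
    constructor
    · rintro ⟨h1, h2, h3⟩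
      exact ⟨h2, by omega⟩
    · rintro ⟨h1, h2⟩
      exact ⟨by omega, h1, by omega⟩
  have hBpiv : B ∈ pivotal F e := by
    rw [mem_pivotal, hBe]
    refine ⟨hB, ?_, hAn⟩
    by_contra heB
    rw [erase_eq_of_notMem heB] at hBe
    exact hAn (hBe ▸ hB)
  have hBP : B ∩ (initSeg n (e.val + 1)) = B := inter_eq_left.2 inter_subset_right
  have hBlayer : B ∈ layer (pivotal F e) (initSeg n (e.val + 1)) B.card := mem_layer.2 ⟨hBpiv, by rw [hBP]⟩
  have hBt : t ≤ B.card := by simpa using hF B hB B hB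
  have hBm : B.card ≤ e.val + 1 := hPc ▸ card_le_card inter_subset_right
  -- A pivotal set of size `k` on the segment conflicts with size `m + t - k`; the layer is
  -- self-paired precisely when `2k = m + t`.
  rcases lt_trichotomy (2 * B.card) (e.val + 1 + t) with h | h | h
  · exact Or.inl (improvable_of_ne hp hp2 hF hs hd (i := B.card) (j := e.val + 1 + t - B.card)
      (by omega) (by omega) (Or.inl ⟨B, hBlayer⟩))
  · have hr : e.val + 1 = t + 2 * (B.card - t) := by omega
    rcases le_or_gt ((B.card - t : ℕ) : ℝ) ((e.val : ℝ) * p) with h' | h'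
    · exact Or.inr ⟨_, hr, h'⟩
    · refine Or.inl (improvable_of_middle hp hp2 hF hs hd hr ?_ h')
      rw [show t + (B.card - t) = B.card by omega]
      exact ⟨B, hBlayer⟩
  · exact Or.inl (improvable_of_ne hp hp2 hF hs hd (i := e.val + 1 + t - B.card) (j := B.card)
      (by omega) (by omega) (Or.inr ⟨B, hBlayer⟩))

end BiasedIntersection

namespace BiasedIntersection

open Finset

variable {n : ℕ} {p : ℝ} {t : ℕ}

/-! ### Enlarging the symmetric initial segment -/

/-- The family is invariant under permutations of the first `l` coordinates. -/
def SymmetricOn (F : Finset (Finset (Fin n))) (l : ℕ) : Prop :=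
  ∀ a b : Fin n, a.val < l → b.val < l → ∀ A ∈ F, swapSet a b A ∈ F

/-- The members of `F` that leave `F` when some smaller element is replaced by `l`. -/
def movable (F : Finset (Finset (Fin n))) (l : Fin n) : Finset (Finset (Fin n)) :=
  F.filter fun A => l ∉ A ∧ ∃ a ∈ A, a < l ∧ swapSet a l A ∉ F

theorem mem_movable {F : Finset (Finset (Fin n))} {l : Fin n} {A : Finset (Fin n)} :
    A ∈ movable F l ↔ A ∈ F ∧ l ∉ A ∧ ∃ a ∈ A, a < l ∧ swapSet a l A ∉ F := by simp [movable]

/-- By symmetry on the coordinates below `l`, it does not matter which element is replaced by `l`.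
-/
theorem swapSet_notMem_of_movable {F : Finset (Finset (Fin n))} {l : Fin n}
    (hsym : SymmetricOn F l.val) {A : Finset (Fin n)} (hA : A ∈ movable F l) {a : Fin n}
    (ha : a ∈ A) (hal : a < l) : swapSet a l A ∉ F := by
  obtain ⟨hAF, hlA, b, hb, hbl, hbF⟩ := mem_movable.1 hA
  intro h
  have h1 := hsym a b hal hbl _ h
  refine hbF ?_
  convert h1 using 1
  rcases eq_or_ne a b with rfl | hab
  · rw [swapSet_of_mem_iff Iff.rfl]
  have haB : a ∉ swapSet a l A := by simp [hlA]
  have hbB : b ∈ swapSet a l A := by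
    rw [mem_swapSet, Equiv.swap_apply_of_ne_of_ne hab.symm hbl.ne]
    exact hb
  rw [swapSet_comm a b, swapSet_of_mem_of_notMem hbB haB, swapSet_of_mem_of_notMem hb hlA,
    swapSet_of_mem_of_notMem ha hlA]
  ext x
  simp only [mem_insert, mem_erase]
  by_cases hxa : x = a
  · subst hxa; simp [hab, ha]
  by_cases hxb : x = b
  · subst hxb; simp [hbl.ne, hxa]
  · simp [hxa, hxb]

/-- The analogue of `erase_conflict`: symmetry below `l` forces `A ∪ C` to cover the segment, and
shifting a common element beyond `l` down to `l` rules out common elements outside it. -/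
theorem swap_conflict {F : Finset (Finset (Fin n))} (hF : TIntersecting t F) (hs : Shifted F)
    {l : Fin n} (hsym : SymmetricOn F l.val) {A C : Finset (Fin n)} (hA : A ∈ F) (hlA : l ∉ A)
    {a : Fin n} (ha : a ∈ A) (hal : a < l) (hC : C ∈ F) (h : (swapSet a l A ∩ C).card < t) :
    C ∈ movable F l ∧ a ∈ C ∧ (A ∩ C).card = t ∧
      (A ∩ initSeg n l.val).card + (C ∩ initSeg n l.val).card = l.val + t ∧
      A ∩ C ⊆ initSeg n l.val := by
  have h1 := hF A hA C hC
  rw [swapSet_of_mem_of_notMem ha hlA] at h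
  have he : A.erase a ∩ C = (A ∩ C).erase a := erase_inter _ _ _
  have hlC : l ∉ C := by
    intro hlC
    have hl : l ∉ A.erase a ∩ C := fun h => hlA (mem_of_mem_erase (mem_inter.1 h).1)
    rw [insert_inter_of_mem hlC, card_insert_of_notMem hl, he] at h
    have := pred_card_le_card_erase (s := A ∩ C) (a := a)
    omega
  rw [insert_inter_of_notMem hlC, he] at h
  have haC : a ∈ C := by
    by_contra hne
    rw [erase_eq_of_notMem (fun h => hne (mem_inter.1 h).2)] at h
    omega
  have haAC : a ∈ A ∩ C := mem_inter.2 ⟨ha, haC⟩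
  have hcard : (A ∩ C).card = t := by
    rw [card_erase_of_mem haAC] at h
    omega
  have hsub : initSeg n l.val ⊆ A ∪ C := by
    intro x hx
    by_contra hne
    rw [mem_union, not_or] at hne
    have h2 := hF _ (hsym a x hal (mem_initSeg.1 hx) A hA) C hC
    rw [swapSet_of_mem_of_notMem ha hne.1, insert_inter_of_notMem hne.2, he] at h2
    omega
  have hpre : A ∩ C ⊆ initSeg n l.val := by
    intro z hz
    by_contra hne
    rw [mem_initSeg, not_lt] at hne
    have hz' := mem_inter.1 hz
    have hlz : l < z := lt_of_le_of_ne (Fin.le_def.2 hne) (by rintro rfl; exact hlA hz'.1)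
    have h2 := hF _ (hs l z hlz A hA hz'.1 hlA) C hC
    rw [swapSet_comm, swapSet_of_mem_of_notMem hz'.1 hlA, insert_inter_of_notMem hlC,
      erase_inter, card_erase_of_mem hz, hcard] at h2
    have : 0 < (A ∩ C).card := card_pos.2 ⟨z, hz⟩
    omega
  refine ⟨mem_movable.2 ⟨hC, hlC, a, haC, hal, fun hCa => ?_⟩, haC, hcard, ?_, hpre⟩
  · have h2 := hF A hA _ hCa
    rw [swapSet_of_mem_of_notMem haC hlC, inter_insert_of_notMem hlA, inter_erase] at h2
    omega
  · rw [card_inter_add_card_inter hsub hpre, hcard, card_initSeg_of_le l.2.le]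

/-- All sets obtained from members of `F₁` by replacing an element below `l` by `l`. -/
def pushed (F₁ : Finset (Finset (Fin n))) (l : Fin n) : Finset (Finset (Fin n)) :=
  F₁.biUnion fun A => (A ∩ initSeg n l.val).image fun a => swapSet a l A

theorem mem_pushed {F₁ : Finset (Finset (Fin n))} {l : Fin n} {B : Finset (Fin n)} :
    B ∈ pushed F₁ l ↔ ∃ A ∈ F₁, ∃ a ∈ A, a < l ∧ swapSet a l A = B := by
  simp only [pushed, mem_biUnion, mem_image, mem_inter, mem_initSeg, Fin.lt_def, and_assoc]

/-- Remove `Rm` from `F` and add `pushed F₁ l`. -/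
def pushStep (F F₁ Rm : Finset (Finset (Fin n))) (l : Fin n) : Finset (Finset (Fin n)) :=
  (F \ Rm) ∪ pushed F₁ l

/-- A pair of pushed sets may lose one common element through the second replacement, but both
contain `l`, which compensates. -/
theorem tIntersecting_pushStep {F F₁ Rm : Finset (Finset (Fin n))} (hF : TIntersecting t F)
    (hs : Shifted F) {l : Fin n} (hsym : SymmetricOn F l.val) (hF₁ : F₁ ⊆ movable F l)
    (hdis : Disjoint F₁ Rm)
    (hconf : ∀ A ∈ F₁, ∀ C ∈ movable F l, C ∉ Rm → ∀ a, a ∈ A → a ∈ C → a < l →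
      (A ∩ C).card = t → A ∩ C ⊆ initSeg n l.val →
      (A ∩ initSeg n l.val).card + (C ∩ initSeg n l.val).card = l.val + t → False) :
    TIntersecting t (pushStep F F₁ Rm l) := by
  have key : ∀ B ∈ pushed F₁ l, ∀ C ∈ F, C ∉ Rm → t ≤ (B ∩ C).card := by
    intro B hB C hC hCR
    obtain ⟨A, hA, a, ha, hal, rfl⟩ := mem_pushed.1 hB
    by_contra hlt
    have hA' := mem_movable.1 (hF₁ hA)
    obtain ⟨h1, h2, h3, h4, h5⟩ :=
      swap_conflict hF hs hsym hA'.1 hA'.2.1 ha hal hC (not_le.1 hlt)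
    exact hconf A hA C h1 hCR a ha h2 hal h3 h5 h4
  intro A hA B hB
  rw [pushStep, mem_union, mem_sdiff] at hA hB
  rcases hA with hA | hA <;> rcases hB with hB | hB
  · exact hF A hA.1 B hB.1
  · rw [inter_comm]
    exact key B hB A hA.1 hA.2
  · exact key A hA B hB.1 hB.2
  · obtain ⟨C, hC, a, ha, hal, rfl⟩ := mem_pushed.1 hB
    have hC' := mem_movable.1 (hF₁ hC)
    have h1 := key A hA C hC'.1 (disjoint_left.1 hdis hC)
    have hlA : l ∈ A := by
      obtain ⟨A', -, a', ha', -, rfl⟩ := mem_pushed.1 hA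
      simp [ha']
    rw [swapSet_of_mem_of_notMem ha hC'.2.1, inter_insert_of_mem hlA, inter_erase,
      card_insert_of_notMem]
    · have := pred_card_le_card_erase (s := A ∩ C) (a := a)
      omega
    · exact fun h => hC'.2.1 (mem_inter.1 (mem_of_mem_erase h)).2

theorem biasedMeasure_pushStep {F F₁ Rm : Finset (Finset (Fin n))} {l : Fin n}
    (hsym : SymmetricOn F l.val) (hF₁ : F₁ ⊆ movable F l) (hR : Rm ⊆ F) :
    biasedMeasure p (pushStep F F₁ Rm l) =
      biasedMeasure p F - biasedMeasure p Rm + biasedMeasure p (pushed F₁ l) := by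
  rw [pushStep, biasedMeasure_union_of_disjoint, biasedMeasure_sdiff_of_subset hR]
  rw [disjoint_left]
  intro B hB hB'
  obtain ⟨A, hA, a, ha, hal, rfl⟩ := mem_pushed.1 hB'
  exact swapSet_notMem_of_movable hsym (hF₁ hA) ha hal (mem_sdiff.1 hB).1

/-- Double counting of pairs `(A, a)`: pushing preserves weight, each `A` has `i` choices of `a`,
and a pushed set can arise only through the `l + 1 - i` elements of the segment that it misses. -/
theorem biasedMeasure_pushed_ge (hp : 0 ≤ p) (hp1 : p ≤ 1) {F₁ : Finset (Finset (Fin n))}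
    {l : Fin n} {i : ℕ} (hl : ∀ A ∈ F₁, l ∉ A)
    (hi : ∀ A ∈ F₁, (A ∩ initSeg n l.val).card = i) :
    (i : ℝ) * biasedMeasure p F₁ ≤ ((l.val + 1 - i : ℕ) : ℝ) * biasedMeasure p (pushed F₁ l) := by
  set w : Finset (Fin n) → ℝ := fun A => p ^ A.card * (1 - p) ^ (n - A.card) with hw
  have hw0 : ∀ A, 0 ≤ w A := fun A =>
    mul_nonneg (pow_nonneg hp _) (pow_nonneg (by linarith) _)
  have e1 : (i : ℝ) * biasedMeasure p F₁ =
      ∑ x ∈ F₁.sigma fun A => A ∩ initSeg n l.val, w x.1 := by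
    rw [sum_sigma, biasedMeasure, mul_sum]
    refine sum_congr rfl fun A hA => ?_
    dsimp only
    rw [sum_const, hi A hA, nsmul_eq_mul]
  have e2 : ((l.val + 1 - i : ℕ) : ℝ) * biasedMeasure p (pushed F₁ l) =
      ∑ x ∈ (pushed F₁ l).sigma fun B => initSeg n l.val \ B, w x.1 := by
    rw [sum_sigma, biasedMeasure, mul_sum]
    refine sum_congr rfl fun B hB => ?_
    obtain ⟨A, hA, a, ha, hal, rfl⟩ := mem_pushed.1 hB
    have haP : a ∈ A ∩ initSeg n l.val := mem_inter.2 ⟨ha, mem_initSeg.2 hal⟩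
    have h1 : initSeg n l.val \ swapSet a l A = insert a (initSeg n l.val \ A) := by
      rw [swapSet_of_mem_of_notMem ha (hl A hA)]
      ext x
      simp only [mem_sdiff, mem_insert, mem_erase, mem_initSeg]
      by_cases hxa : x = a
      · subst hxa
        have : x ≠ l := hal.ne
        simpa [this] using hal
      · by_cases hxl : x = l
        · subst hxl; simp [hxa]
        · simp [hxa, hxl]
    have h2 := card_sdiff_add_card_inter (initSeg n l.val) A
    rw [inter_comm, hi A hA, card_initSeg_of_le l.2.le] at h2
    dsimp only
    rw [sum_const, h1, card_insert_of_notMem (by simp [ha]), nsmul_eq_mul]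
    congr 2
    omega
  rw [e1, e2]
  set φ : (Σ _ : Finset (Fin n), Fin n) → (Σ _ : Finset (Fin n), Fin n) :=
    fun x => ⟨swapSet x.2 l x.1, x.2⟩ with hφ
  have hinj : Function.Injective φ := by
    rintro ⟨A, a⟩ ⟨B, b⟩ h
    simp only [hφ, Sigma.mk.injEq, heq_eq_eq] at h
    obtain ⟨h, rfl⟩ := h
    rw [swapSet_injective _ _ h]
  calc ∑ x ∈ F₁.sigma fun A => A ∩ initSeg n l.val, w x.1
      = ∑ x ∈ (F₁.sigma fun A => A ∩ initSeg n l.val).image φ, w x.1 := by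
        rw [sum_image hinj.injOn]
        refine sum_congr rfl fun x _ => ?_
        simp only [hφ, hw, card_swapSet]
    _ ≤ _ := by
        refine sum_le_sum_of_subset_of_nonneg ?_ fun x _ _ => hw0 _
        intro x hx
        obtain ⟨⟨A, a⟩, hAa, rfl⟩ := mem_image.1 hx
        simp only [mem_sigma, mem_inter, mem_initSeg] at hAa
        simp only [hφ, mem_sigma, mem_sdiff, mem_initSeg]
        refine ⟨mem_pushed.2 ⟨A, hAa.1, a, hAa.2.1, hAa.2.2, rfl⟩, hAa.2.2, ?_⟩
        rw [mem_swapSet_left]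
        exact hl A hAa.1

/-- A family is improvable if its measure is not maximal among `t`-intersecting families. -/
def NotMaximal (t : ℕ) (p : ℝ) (F : Finset (Finset (Fin n))) : Prop :=
  ∃ F' : Finset (Finset (Fin n)), TIntersecting t F' ∧ biasedMeasure p F < biasedMeasure p F'

theorem notMaximal_of_pushStep {F F₁ Rm : Finset (Finset (Fin n))} (hF : TIntersecting t F)
    (hs : Shifted F) {l : Fin n} (hsym : SymmetricOn F l.val) (hF₁ : F₁ ⊆ movable F l)
    (hR : Rm ⊆ F) (hdis : Disjoint F₁ Rm)
    (hconf : ∀ A ∈ F₁, ∀ C ∈ movable F l, C ∉ Rm → ∀ a, a ∈ A → a ∈ C → a < l →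
      (A ∩ C).card = t → A ∩ C ⊆ initSeg n l.val →
      (A ∩ initSeg n l.val).card + (C ∩ initSeg n l.val).card = l.val + t → False)
    (hgain : biasedMeasure p Rm < biasedMeasure p (pushed F₁ l)) : NotMaximal t p F := by
  refine ⟨_, tIntersecting_pushStep hF hs hsym hF₁ hdis hconf, ?_⟩
  rw [biasedMeasure_pushStep hsym hF₁ hR]
  linarith

theorem layer_movable_subset {F : Finset (Finset (Fin n))} {l : Fin n} {P : Finset (Fin n)}
    {k : ℕ} : layer (movable F l) P k ⊆ F := fun _ hA =>
  (mem_movable.1 (mem_layer.1 hA).1).1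

/-- If neither layer could profitably replace the other, double counting and `t ≥ 2` would give `i
μ(gi) ≤ (j - 1) μ(gj)` and `j μ(gj) ≤ (i - 1) μ(gi)`, which is impossible. -/
theorem notMaximal_of_ne (ht : 2 ≤ t) (hp : 0 < p) (hp1 : p < 1)
    {F : Finset (Finset (Fin n))} (hF : TIntersecting t F) (hs : Shifted F) {l : Fin n}
    (hsym : SymmetricOn F l.val) {i j : ℕ} (hij : i + j = l.val + t) (hne : i ≠ j)
    (hi0 : 1 ≤ i) (hil : i ≤ l.val)
    (hnon : (layer (movable F l) (initSeg n l.val) i).Nonempty) : NotMaximal t p F := by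
  set gi := layer (movable F l) (initSeg n l.val) i with hgi
  set gj := layer (movable F l) (initSeg n l.val) j with hgj
  have hdis : Disjoint gi gj := by
    rw [disjoint_left]
    intro A hA hA'
    rw [hgi, mem_layer] at hA
    rw [hgj, mem_layer] at hA'
    omega
  have posi : 0 < biasedMeasure p gi := biasedMeasure_pos hp hp1 hnon
  have nnj := biasedMeasure_nonneg hp.le hp1.le gj
  have gei := biasedMeasure_pushed_ge hp.le hp1.le (F₁ := gi) (l := l) (i := i)
    (fun A hA => (mem_movable.1 (mem_layer.1 hA).1).2.1) (fun A hA => (mem_layer.1 hA).2)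
  have gej := biasedMeasure_pushed_ge hp.le hp1.le (F₁ := gj) (l := l) (i := j)
    (fun A hA => (mem_movable.1 (mem_layer.1 hA).1).2.1) (fun A hA => (mem_layer.1 hA).2)
  by_cases h1 : biasedMeasure p gj < biasedMeasure p (pushed gi l)
  · refine notMaximal_of_pushStep hF hs hsym (filter_subset _ _) layer_movable_subset hdis ?_ h1
    intro A hA C hC hCR a _ _ _ _ _ hc
    rw [mem_layer] at hCR
    replace hA := mem_layer.1 hA
    exact hCR ⟨hC, by omega⟩
  by_cases h2 : biasedMeasure p gi < biasedMeasure p (pushed gj l)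
  · refine notMaximal_of_pushStep hF hs hsym (F₁ := gj) (filter_subset _ _)
      layer_movable_subset hdis.symm ?_ h2
    intro A hA C hC hCR a _ _ _ _ _ hc
    rw [mem_layer] at hCR
    replace hA := mem_layer.1 hA
    exact hCR ⟨hC, by omega⟩
  exfalso
  rw [not_lt] at h1 h2
  have e1 : (i : ℝ) * biasedMeasure p gi ≤ ((l.val + 1 - i : ℕ) : ℝ) * biasedMeasure p gj :=
    gei.trans (mul_le_mul_of_nonneg_left h1 (Nat.cast_nonneg _))
  have e2 : (j : ℝ) * biasedMeasure p gj ≤ ((l.val + 1 - j : ℕ) : ℝ) * biasedMeasure p gi :=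
    gej.trans (mul_le_mul_of_nonneg_left h2 (Nat.cast_nonneg _))
  have hi' : (1 : ℝ) ≤ i := by exact_mod_cast hi0
  have hj' : ((l.val + 1 - i : ℕ) : ℝ) + 1 ≤ j := by
    have : l.val + 1 - i + 1 ≤ j := by omega
    exact_mod_cast this
  have hi'' : ((l.val + 1 - j : ℕ) : ℝ) + 1 ≤ i := by
    have : l.val + 1 - j + 1 ≤ i := by omega
    exact_mod_cast this
  have e3 : (i : ℝ) * biasedMeasure p gi ≤ ((j : ℝ) - 1) * biasedMeasure p gj :=
    e1.trans (mul_le_mul_of_nonneg_right (by linarith) nnj)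
  have e4 : (j : ℝ) * biasedMeasure p gj ≤ ((i : ℝ) - 1) * biasedMeasure p gi :=
    e2.trans (mul_le_mul_of_nonneg_right (by linarith) posi.le)
  nlinarith

/-- Among the rearrangements of `B` within the segment, take one with smallest intersection with
`C`. It covers the segment together with `C`, since otherwise a common element could be moved to an
uncovered place. Inclusion-exclusion then gives the bound. -/
theorem le_card_add_card_of_symmetricOn (ht : 1 ≤ t) {F : Finset (Finset (Fin n))}
    (hF : TIntersecting t F) {l : ℕ} (hl : l ≤ n) (hsym : SymmetricOn F l)
    {B C : Finset (Fin n)} (hB : B ∈ F) (hBl : B ⊆ initSeg n l) (hC : C ∈ F) :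
    l + t ≤ B.card + (C ∩ initSeg n l).card := by
  obtain ⟨D, hD, hmin⟩ := exists_min_image
    (F.filter fun D => D ⊆ initSeg n l ∧ D.card = B.card) (fun D => (D ∩ C).card)
    ⟨B, by simp [hB, hBl]⟩
  rw [mem_filter] at hD
  obtain ⟨hDF, hDl, hDc⟩ := hD
  have h1 := hF D hDF C hC
  obtain ⟨x, hx⟩ : (D ∩ C).Nonempty := card_pos.1 (by omega)
  have hx' := mem_inter.1 hx
  have hsub : initSeg n l ⊆ D ∪ C := by
    intro y hy
    by_contra hne
    rw [mem_union, not_or] at hne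
    have h2 := hsym x y (mem_initSeg.1 (hDl hx'.1)) (mem_initSeg.1 hy) D hDF
    have h3 := hmin _ (by
      rw [mem_filter, card_swapSet]
      refine ⟨h2, ?_, hDc⟩
      rw [swapSet_of_mem_of_notMem hx'.1 hne.1]
      exact insert_subset hy ((erase_subset _ _).trans hDl))
    rw [swapSet_of_mem_of_notMem hx'.1 hne.1, insert_inter_of_notMem hne.2, erase_inter,
      card_erase_of_mem hx] at h3
    omega
  have h2 := card_inter_add_card_inter hsub (inter_subset_left.trans hDl)
  rw [inter_eq_left.2 hDl, card_initSeg_of_le hl, hDc] at h2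
  omega

/-- Pushing a conflict-free part of the self-paired layer `g` gains as soon as that part has measure
greater than `p μ(g)`. Such a part exists unless `g` is closed under deleting elements beyond `l`;
in that case a minimal member of `g` lies inside the segment and forces `F` into the core family. -/
theorem notMaximal_or_of_middle (ht : 1 ≤ t) (hp : 0 < p) (hp2 : p < 1 / 2)
    {F : Finset (Finset (Fin n))} (hF : TIntersecting t F) (hup : UpClosed F) (hs : Shifted F)
    {l : Fin n} (hsym : SymmetricOn F l.val) {r : ℕ} (hr : l.val = t + 2 * r)
    (hpr : (r : ℝ) + 1 ≤ (t + 2 * r + 1) * p)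
    (hnon : (layer (movable F l) (initSeg n l.val) (t + r)).Nonempty) :
    NotMaximal t p F ∨ F ⊆ coreFamily (initSeg n l.val) (t + r) := by
  set g := layer (movable F l) (initSeg n l.val) (t + r) with hg
  have hp1 : p < 1 := by linarith
  have hgF : ∀ A ∈ g, A ∈ F := fun A hA => layer_movable_subset hA
  by_cases hQ : ∃ k, l < k ∧ ∃ A ∈ g, k ∈ A ∧ A.erase k ∉ g
  · left
    obtain ⟨k, hlk, A₀, hA₀, hkA₀, hA₀e⟩ := hQ
    have hkP : k ∉ initSeg n l.val := fun h => lt_asymm hlk (mem_initSeg.1 h)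
    -- The classes `P1` and `P0` are matched by deleting `k`, so `P1` is a `p`-fraction of their
    -- union. The unmatched classes are `Q` and `B`; adding the larger of them to `P1` beats the
    -- fraction `p`, since `p < 1/2` and `Q` has positive measure.
    set P1 := g.filter fun A => k ∈ A ∧ A.erase k ∈ g with hP1
    set Q := g.filter fun A => k ∈ A ∧ A.erase k ∉ g with hQ
    set P0 := g.filter fun A => k ∉ A ∧ insert k A ∈ g with hP0
    set B := g.filter fun A => k ∉ A ∧ insert k A ∉ g with hB
    have eP0 : P0 = P1.image fun A => A.erase k := by
      ext A
      simp only [hP0, hP1, mem_image, mem_filter]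
      constructor
      · rintro ⟨h1, h2, h3⟩
        exact ⟨insert k A, ⟨h3, by simp, by rwa [erase_insert h2]⟩, erase_insert h2⟩
      · rintro ⟨D, ⟨h1, h2, h3⟩, rfl⟩
        exact ⟨h3, by simp, by rwa [insert_erase h2]⟩
    have m1 : p * biasedMeasure p P0 = (1 - p) * biasedMeasure p P1 := by
      rw [eP0, biasedMeasure_image_erase]
      exact fun A hA => (mem_filter.1 hA).2.1
    have d1 : Disjoint P1 Q := disjoint_filter.2 fun A _ h h' => h'.2 h.2
    have d2 : Disjoint P1 B := disjoint_filter.2 fun A _ h h' => h'.1 h.1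
    have d3 : Disjoint P0 B := disjoint_filter.2 fun A _ h h' => h'.2 h.2
    have d4 : Disjoint (P1 ∪ Q) (P0 ∪ B) := by
      rw [disjoint_left]
      intro A hA hA'
      simp only [hP1, hQ, hP0, hB, mem_union, mem_filter] at hA hA'
      tauto
    have eg : g = (P1 ∪ Q) ∪ (P0 ∪ B) := by
      ext A
      simp only [hP1, hQ, hP0, hB, mem_union, mem_filter]
      tauto
    have mg : biasedMeasure p g = biasedMeasure p P1 + biasedMeasure p Q +
        (biasedMeasure p P0 + biasedMeasure p B) := by
      rw [← biasedMeasure_union_of_disjoint d1, ← biasedMeasure_union_of_disjoint d3,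
        ← biasedMeasure_union_of_disjoint d4, ← eg]
    have posQ : 0 < biasedMeasure p Q :=
      biasedMeasure_pos hp hp1 ⟨A₀, mem_filter.2 ⟨hA₀, hkA₀, hA₀e⟩⟩
    have nnB := biasedMeasure_nonneg hp.le hp1.le B
    have hP1m : biasedMeasure p P1 = p * (biasedMeasure p P1 + biasedMeasure p P0) := by
      linarith
    have main : ∀ W ⊆ g, p * biasedMeasure p g < biasedMeasure p W →
        (∀ A ∈ W, ∀ C ∈ W, ∀ a, a ∈ A → a ∈ C → a < l → (A ∩ C).card = t →
          A ∩ C ⊆ initSeg n l.val → False) → NotMaximal t p F := by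
      intro W hW hWm hWc
      refine notMaximal_of_pushStep hF hs hsym (F₁ := W) (Rm := g \ W)
        (hW.trans (filter_subset _ _)) (fun A hA => hgF A (mem_sdiff.1 hA).1) disjoint_sdiff ?_ ?_
      · intro A hA C hC hCR a haA haC hal hAC hsub hc
        have hA2 := (mem_layer.1 (hW hA)).2
        have hCg : C ∈ g := mem_layer.2 ⟨hC, by omega⟩
        have hCW : C ∈ W := by
          by_contra hne
          exact hCR (mem_sdiff.2 ⟨hCg, hne⟩)
        exact hWc A hA C hCW a haA haC hal hAC hsub
      · have ge := biasedMeasure_pushed_ge hp.le hp1.le (F₁ := W) (l := l) (i := t + r)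
          (fun A hA => (mem_movable.1 (mem_layer.1 (hW hA)).1).2.1)
          (fun A hA => (mem_layer.1 (hW hA)).2)
        rw [show l.val + 1 - (t + r) = r + 1 by omega] at ge
        rw [biasedMeasure_sdiff_of_subset hW]
        push_cast at ge
        have nng := biasedMeasure_nonneg hp.le hp1.le g
        have e1 : ((r : ℝ) + 1) * biasedMeasure p g ≤
            (t + 2 * r + 1) * p * biasedMeasure p g := mul_le_mul_of_nonneg_right hpr nng
        have e2 : ((t : ℝ) + 2 * r + 1) * (p * biasedMeasure p g) <
            (t + 2 * r + 1) * biasedMeasure p W :=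
          mul_lt_mul_of_pos_left hWm (by positivity)
        have e3 : (0 : ℝ) < (r : ℝ) + 1 := by positivity
        refine lt_of_mul_lt_mul_left ?_ e3.le
        nlinarith
    rcases le_total (biasedMeasure p B) (biasedMeasure p Q) with hBQ | hBQ
    -- All these sets contain `k`, which lies beyond `l`, whereas a conflicting pair meets only
    -- inside the segment.
    · refine main (P1 ∪ Q) (union_subset (filter_subset _ _) (filter_subset _ _)) ?_ ?_
      · rw [biasedMeasure_union_of_disjoint d1, mg]
        nlinarith
      · intro A hA C hC a _ _ _ _ hsub
        have hk : k ∈ A ∩ C := by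
          simp only [hP1, hQ, mem_union, mem_filter] at hA hC
          rw [mem_inter]; tauto
        exact hkP (hsub hk)
    · refine main (P1 ∪ B) (union_subset (filter_subset _ _) (filter_subset _ _)) ?_ ?_
      · rw [biasedMeasure_union_of_disjoint d2, mg]
        nlinarith
      · have aux : ∀ A ∈ P1 ∪ B, ∀ C ∈ P1 ∪ B, k ∉ C → ∀ a, a ∈ A → a ∈ C → a < l →
            (A ∩ C).card = t → False := by
          intro A hA C hC hkC a haA haC hal hAC
          have hCB : C ∈ B := by
            simp only [hP1, hB, mem_union, mem_filter] at hC ⊢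
            tauto
          obtain ⟨hCg, -, hCk⟩ := mem_filter.1 hCB
          have hCmov := mem_movable.1 (mem_layer.1 hCg).1
          have hlk' : l ∉ insert k C := by
            rw [mem_insert, not_or]
            exact ⟨hlk.ne, hCmov.2.1⟩
          -- Adding `k` takes `C` out of `g`, so `insert k C` is no longer movable and its pushed
          -- version lies in `F`. Paired with `A.erase k ∈ F`, it would have only `t - 1` common
          -- points.
          have hsw : swapSet a l (insert k C) ∈ F := by
            by_contra hne
            refine hCk (mem_layer.2 ⟨mem_movable.2 ⟨hup C hCmov.1 _ (subset_insert _ _), hlk', a,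
              mem_insert_of_mem haC, hal, hne⟩, ?_⟩)
            rw [insert_inter_of_notMem hkP]
            exact (mem_layer.1 hCg).2
          have hAe : A.erase k ∈ F := by
            rcases mem_union.1 hA with h | h
            · exact hgF _ (mem_filter.1 h).2.2
            · have h' := mem_filter.1 h
              rw [erase_eq_of_notMem h'.2.1]
              exact hgF _ h'.1
          have hlA : l ∉ A := by
            have hAg : A ∈ g := by
              rcases mem_union.1 hA with h | h
              · exact (mem_filter.1 h).1
              · exact (mem_filter.1 h).1
            exact (mem_movable.1 (mem_layer.1 hAg).1).2.1
          have h1 := hF _ hAe _ hsw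
          have h2 : A.erase k ∩ swapSet a l (insert k C) ⊆ (A ∩ C).erase a := by
            rw [swapSet_of_mem_of_notMem (mem_insert_of_mem haC) hlk']
            intro x hx
            simp only [mem_inter, mem_erase, mem_insert] at hx ⊢
            have : x ≠ l := by rintro rfl; exact hlA hx.1.2
            tauto
          have h3 := card_le_card h2
          rw [card_erase_of_mem (mem_inter.2 ⟨haA, haC⟩), hAC] at h3
          omega
        intro A hA C hC a haA haC hal hAC hsub
        by_cases hkC : k ∈ C
        · have hkA : k ∉ A := fun h => hkP (hsub (mem_inter.2 ⟨h, hkC⟩))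
          exact aux C hC A hA hkA a haC haA hal (by rwa [inter_comm])
        · exact aux A hA C hC hkC a haA haC hal hAC
  · right
    push Not at hQ
    obtain ⟨A, hA, hmin⟩ := exists_min_image g card hnon
    have hAP : A ⊆ initSeg n l.val := by
      intro k hk
      by_contra hne
      have hlA : l ∉ A := (mem_movable.1 (mem_layer.1 hA).1).2.1
      rw [mem_initSeg, not_lt] at hne
      have hlk : l < k := lt_of_le_of_ne (Fin.le_def.2 hne) (by rintro rfl; exact hlA hk)
      have h1 := hmin _ (hQ k hlk A hA hk)
      exact absurd (card_erase_lt_of_mem hk) (not_lt.2 h1)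
    intro C hC
    have h1 := le_card_add_card_of_symmetricOn ht hF l.2.le hsym (hgF A hA) hAP hC
    have h2 := (mem_layer.1 hA).2
    rw [inter_eq_left.2 hAP] at h2
    rw [mem_coreFamily]
    omega

theorem notMaximal_or_of_not_symmetricOn (ht : 2 ≤ t) (hp : 0 < p) (hp2 : p < 1 / 2)
    {F : Finset (Finset (Fin n))} (hF : TIntersecting t F) (hup : UpClosed F) (hs : Shifted F)
    {l : Fin n} (hsym : SymmetricOn F l.val) (hsym' : ¬ SymmetricOn F (l.val + 1))
    (hpr : ∀ r : ℕ, l.val = t + 2 * r → (r : ℝ) + 1 ≤ (t + 2 * r + 1) * p) :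
    NotMaximal t p F ∨
      ∃ r : ℕ, l.val = t + 2 * r ∧ F ⊆ coreFamily (initSeg n l.val) (t + r) := by
  have key : ∀ a : Fin n, a < l → ∀ A ∈ F, swapSet a l A ∉ F → A ∈ movable F l ∧ a ∈ A := by
    intro a hal A hA hne
    have haA : a ∈ A := by
      by_contra haA
      by_cases hlA : l ∈ A
      · exact hne (hs a l hal A hA hlA haA)
      · rw [swapSet_of_mem_iff (by tauto)] at hne
        exact hne hA
    have hlA : l ∉ A := by
      intro hlA
      rw [swapSet_of_mem_iff (by tauto)] at hne
      exact hne hA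
    exact ⟨mem_movable.2 ⟨hA, hlA, a, haA, hal, hne⟩, haA⟩
  obtain ⟨A, hA, a, haA, hal⟩ : ∃ A ∈ movable F l, ∃ a ∈ A, a < l := by
    unfold SymmetricOn at hsym'
    push Not at hsym'
    obtain ⟨a, b, ha, hb, A, hA, hne⟩ := hsym'
    rcases lt_or_ge a l with hal | hal
    · rcases lt_or_ge b l with hbl | hbl
      · exact absurd (hsym a b hal hbl A hA) hne
      · obtain rfl : b = l := Fin.ext (by have := Fin.le_def.1 hbl; omega)
        obtain ⟨h1, h2⟩ := key a hal A hA hne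
        exact ⟨A, h1, a, h2, hal⟩
    · obtain rfl : a = l := Fin.ext (by have := Fin.le_def.1 hal; omega)
      rcases lt_or_ge b a with hbl | hbl
      · rw [swapSet_comm] at hne
        obtain ⟨h1, h2⟩ := key b hbl A hA hne
        exact ⟨A, h1, b, h2, hbl⟩
      · obtain rfl : b = a := Fin.ext (by have := Fin.le_def.1 hbl; omega)
        rw [swapSet_of_mem_iff Iff.rfl] at hne
        exact absurd hA hne
  set i := (A ∩ initSeg n l.val).card with hi
  have hi1 : 1 ≤ i := card_pos.2 ⟨a, mem_inter.2 ⟨haA, mem_initSeg.2 hal⟩⟩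
  have hil : i ≤ l.val := by
    rw [← card_initSeg_of_le l.2.le]; exact card_le_card inter_subset_right
  have hAl : A ∈ layer (movable F l) (initSeg n l.val) i := mem_layer.2 ⟨hA, rfl⟩
  by_cases h2 : 2 * i = l.val + t
  · have hl : l.val = t + 2 * (i - t) := by omega
    refine (notMaximal_or_of_middle (by omega) hp hp2 hF hup hs hsym hl (hpr _ hl) ?_).imp_right
      fun h => ⟨_, hl, h⟩
    rw [show t + (i - t) = i by omega]
    exact ⟨A, hAl⟩
  · exact Or.inl (notMaximal_of_ne ht hp (by linarith) hF hs hsym (i := i) (j := l.val + t - i)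
      (by omega) (by omega) hi1 hil ⟨A, hAl⟩)

/-- A shifted family of maximal measure is contained in one of the extremal families. -/
theorem subset_coreFamily_of_shifted_of_maximal (ht : 1 ≤ t) (hp : 0 < p) (hp2 : p < 1 / 2)
    {F : Finset (Finset (Fin n))} (hF : TIntersecting t F) (hup : UpClosed F) (hs : Shifted F)
    (hmax : ¬ NotMaximal t p F) (hne : F.Nonempty) :
    ∃ r : ℕ, t + 2 * r ≤ n ∧ (r : ℝ) ≤ (t + 2 * r - 1) * p ∧
      F ⊆ coreFamily (initSeg n (t + 2 * r)) (t + r) := by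
  have hdn : DependsOn F n := by
    intro A hA
    rw [initSeg_of_le le_rfl, inter_univ]
    exact hA
  classical
  have hex : ∃ m, DependsOn F m := ⟨n, hdn⟩
  set m := Nat.find hex with hm
  have hdm : DependsOn F m := Nat.find_spec hex
  have hmn : m ≤ n := Nat.find_min' hex hdn
  have hm0 : m ≠ 0 := by
    intro h0
    obtain ⟨A, hA⟩ := hne
    have h1 := hdm A hA
    have h2 := hF _ h1 _ h1
    have h3 : A ∩ initSeg n m = ∅ := by
      rw [h0]; ext x; simp
    rw [h3] at h2
    simp at h2
    omega
  obtain ⟨e, he⟩ : ∃ e : Fin n, e.val + 1 = m := ⟨⟨m - 1, by omega⟩, by simp; omega⟩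
  have hdm' : ¬ DependsOn F e.val := Nat.find_min hex (by omega)
  rw [← he] at hdm
  rcases improvable_or hp hp2 hF hs hdm hdm' with ⟨F', h1, h2, -⟩ | ⟨r, hr, hrp⟩
  · exact absurd ⟨F', h1, h2⟩ hmax
  have hev : (e.val : ℝ) = t + 2 * r - 1 := by
    have : (e.val : ℝ) + 1 = t + 2 * r := by exact_mod_cast hr
    linarith
  rw [hev] at hrp
  have ht' : (1 : ℝ) ≤ t := by exact_mod_cast ht
  by_cases hsymm : SymmetricOn F (t + 2 * r)
  · refine ⟨r, by omega, hrp, fun A hA => ?_⟩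
    rw [hr] at hdm
    have h1 := le_card_add_card_of_symmetricOn ht hF (by omega) hsymm (hdm A hA)
      inter_subset_right hA
    rw [mem_coreFamily]
    omega
  · have hsym0 : ∃ l, ¬ SymmetricOn F l := ⟨_, hsymm⟩
    set s := Nat.find hsym0 with hs'
    have hns : ¬ SymmetricOn F s := Nat.find_spec hsym0
    have hsle : s ≤ t + 2 * r := Nat.find_min' hsym0 hsymm
    have hs0 : s ≠ 0 := by
      intro h0
      rw [h0] at hns
      exact hns fun a _ ha => absurd ha (Nat.not_lt_zero _)
    obtain ⟨l, hl⟩ : ∃ l : Fin n, l.val + 1 = s := ⟨⟨s - 1, by omega⟩, by simp; omega⟩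
    have hsyml : SymmetricOn F l.val := by
      have := Nat.find_min hsym0 (show l.val < Nat.find hsym0 by omega)
      push Not at this
      exact this
    rw [← hl] at hns
    -- Both inequalities are inherited from `r` by smaller parameters, because `r - 2rp` increases
    -- with `r` when `p < 1/2`.
    have hfinal : ∀ r' : ℕ, l.val = t + 2 * r' →
        (r' : ℝ) + 1 ≤ (t + 2 * r' + 1) * p ∧ (r' : ℝ) ≤ (t + 2 * r' - 1) * p := by
      intro r' hr'
      have h1 : (r' : ℝ) + 1 ≤ r := by
        have : r' + 1 ≤ r := by omega
        exact_mod_cast this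
      have hr0 : (0 : ℝ) ≤ r' := Nat.cast_nonneg _
      constructor <;> nlinarith
    -- For `t = 1` the bound reads `r ≤ 2rp`, which forces `r = 0`; then membership in the core
    -- family is immediate from intersecting a set with itself.
    have ht2 : 2 ≤ t ∨ r = 0 := by
      by_contra hcon
      push Not at hcon
      have h1 : t = 1 := by omega
      have h2 : (1 : ℝ) ≤ r := by exact_mod_cast Nat.one_le_iff_ne_zero.2 hcon.2
      rw [h1] at hrp
      push_cast at hrp
      nlinarith
    rcases ht2 with ht2 | hr0
    · rcases notMaximal_or_of_not_symmetricOn ht2 hp hp2 hF hup hs hsyml hns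
        (fun r' hr' => (hfinal r' hr').1) with h | ⟨r', hr', hsub⟩
      · exact absurd h hmax
      · refine ⟨r', by omega, (hfinal r' hr').2, ?_⟩
        rw [← hr']
        exact hsub
    · refine ⟨0, by omega, by simp; nlinarith, fun A hA => ?_⟩
      have h1 := hF _ (hdm A hA) _ (hdm A hA)
      rw [inter_self, hr, hr0] at h1
      rw [mem_coreFamily]
      exact h1

end BiasedIntersection

namespace BiasedIntersection

open Finset

variable {n : ℕ} {p : ℝ} {t : ℕ}

/-! ### Extremal counterexamples -/

theorem sum_swapSet_lt {i j : Fin n} (hij : i < j) {A : Finset (Fin n)} (hj : j ∈ A)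
    (hi : i ∉ A) : ∑ x ∈ swapSet i j A, x.val < ∑ x ∈ A, x.val := by
  rw [swapSet_comm, swapSet_of_mem_of_notMem hj hi, sum_insert (fun h => hi (mem_of_mem_erase h)),
    ← add_sum_erase A _ hj]
  exact Nat.add_lt_add_right (Fin.lt_def.1 hij) _

theorem sum_shift_lt {i j : Fin n} (hij : i < j) {F : Finset (Finset (Fin n))}
    {A : Finset (Fin n)} (hA : A ∈ F) (hj : j ∈ A) (hi : i ∉ A) (hne : swapSet i j A ∉ F) :
    ∑ A ∈ shift i j F, ∑ x ∈ A, x.val < ∑ A ∈ F, ∑ x ∈ A, x.val := by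
  rw [← image_shiftMap, sum_image (injOn_shiftMap i j F)]
  refine sum_lt_sum (fun B _ => ?_) ⟨A, hA, ?_⟩
  · unfold shiftMap
    split_ifs with h
    · exact (sum_swapSet_lt hij h.1 h.2.1).le
    · exact le_rfl
  · rw [shiftMap, if_pos ⟨hj, hi, hne⟩]
    exact sum_swapSet_lt hij hj hi

/-- If a property of large `t`-intersecting families that passes to subfamilies and can be pulled
back along shifts fails, then it fails for some shifted up-closed family such that it holds for
all `t`-intersecting families of larger measure. -/
theorem exists_extremal_counterexample (hp : 0 < p) (hp1 : p < 1)
    (P : Finset (Finset (Fin n)) → Prop) (θ : ℝ)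
    (hmono : ∀ F F', F ⊆ F' → P F' → P F)
    (hshift : ∀ F, TIntersecting t F → UpClosed F → θ ≤ biasedMeasure p F →
      ∀ i j : Fin n, i < j → P (shift i j F) → P F)
    {F₀ : Finset (Finset (Fin n))} (hF₀ : TIntersecting t F₀) (hθ : θ ≤ biasedMeasure p F₀)
    (hP₀ : ¬ P F₀) :
    ∃ F, TIntersecting t F ∧ UpClosed F ∧ Shifted F ∧ θ ≤ biasedMeasure p F ∧ ¬ P F ∧
      ∀ F', TIntersecting t F' → biasedMeasure p F < biasedMeasure p F' → P F' := by
  classical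
  set S := univ.filter fun F : Finset (Finset (Fin n)) =>
    TIntersecting t F ∧ θ ≤ biasedMeasure p F ∧ ¬ P F with hS
  have memS : ∀ F, F ∈ S ↔ TIntersecting t F ∧ θ ≤ biasedMeasure p F ∧ ¬ P F := by simp [hS]
  -- Maximal measure makes the counterexample up-closed. Minimizing the total of the elements among
  -- the maximizers then makes it shifted, since a nontrivial shift keeps the measure and lowers
  -- this total.
  obtain ⟨F₁, hF₁, hmax⟩ := exists_max_image S (biasedMeasure p) ⟨F₀, (memS _).2 ⟨hF₀, hθ, hP₀⟩⟩
  obtain ⟨F, hF, hmin⟩ := exists_min_image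
    (S.filter fun F => biasedMeasure p F = biasedMeasure p F₁)
    (fun F => ∑ A ∈ F, ∑ x ∈ A, x.val) ⟨F₁, mem_filter.2 ⟨hF₁, rfl⟩⟩
  rw [mem_filter] at hF
  obtain ⟨hFS, hFm⟩ := hF
  obtain ⟨hFt, hFθ, hFP⟩ := (memS F).1 hFS
  have hlarge : ∀ F', TIntersecting t F' → biasedMeasure p F < biasedMeasure p F' → P F' := by
    intro F' hF' hlt
    by_contra hP
    have := hmax F' ((memS F').2 ⟨hF', hFθ.trans hlt.le, hP⟩)
    linarith
  have hup : UpClosed F := by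
    have heq : F = upClosure F := by
      by_contra hne
      have hpos : 0 < biasedMeasure p (upClosure F \ F) := by
        refine biasedMeasure_pos hp hp1 (sdiff_nonempty.2 fun h => hne ?_)
        exact Subset.antisymm (subset_upClosure F) h
      rw [biasedMeasure_sdiff_of_subset (subset_upClosure F)] at hpos
      exact hFP (hmono _ _ (subset_upClosure F)
        (hlarge _ (tIntersecting_upClosure hFt) (by linarith)))
    rw [heq]
    exact upClosed_upClosure F
  refine ⟨F, hFt, hup, ?_, hFθ, hFP, hlarge⟩
  intro i j hij A hA hj hi
  by_contra hne
  have h1 := sum_shift_lt hij hA hj hi hne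
  refine absurd (hmin (shift i j F) ?_) (not_le.2 h1)
  rw [mem_filter, memS, biasedMeasure_shift]
  exact ⟨⟨tIntersecting_shift hFt i j, hFθ, fun h => hFP (hshift F hFt hup hFθ i j hij h)⟩, hFm⟩

/-! ### The extremal families -/

/-- `F` is contained, up to measure `c`, in an extremal family with parameter at most `R`. -/
def CloseToCore (t R : ℕ) (p c : ℝ) (F : Finset (Finset (Fin n))) : Prop :=
  ∃ r ≤ R, (r = 0 ∨ 2 ≤ t) ∧ ∃ M : Finset (Fin n), M.card = t + 2 * r ∧
    biasedMeasure p (F \ coreFamily M (t + r)) ≤ c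

theorem CloseToCore.of_subset (hp : 0 ≤ p) (hp1 : p ≤ 1) {R : ℕ} {c : ℝ}
    {F F' : Finset (Finset (Fin n))} (h : F ⊆ F') (hF' : CloseToCore t R p c F') :
    CloseToCore t R p c F := by
  obtain ⟨r, hr, hrt, M, hM, hc⟩ := hF'
  exact ⟨r, hr, hrt, M, hM,
    (biasedMeasure_mono hp hp1 (sdiff_subset_sdiff h Subset.rfl)).trans hc⟩

/-- Constants for which being somewhat close to a core family implies being very close. -/
theorem exists_constants {ζ : ℝ} (hζ : 0 < ζ) (hζ4 : ζ ≤ 1 / 4) (ht : 1 ≤ t) (R : ℕ) :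
    ∃ c c₁ ε₁ C : ℝ, 0 < c ∧ c < c₁ ∧ 0 < ε₁ ∧ ε₁ ≤ 1 ∧ 0 < C ∧
      ∀ (n : ℕ) (p : ℝ), BiasRange ζ p → ∀ F : Finset (Finset (Fin n)), TIntersecting t F →
      UpClosed F → ∀ ε : ℝ, 0 ≤ ε → akMax n p t * (1 - ε) ≤ biasedMeasure p F →
      (CloseToCore t R p c₁ F → CloseToCore t R p (C * ε ^ Real.logb (1 - p) p) F) ∧
      (ε ≤ ε₁ → CloseToCore t R p c₁ F → CloseToCore t R p c F) ∧
      (ε ≤ ε₁ → ∀ i j : Fin n, i ≠ j → CloseToCore t R p c (shift i j F) →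
        CloseToCore t R p c F) := by
  obtain ⟨c₁, C, hc₁, hC, hboot⟩ := exists_bootstrap hζ hζ4 ht R
  obtain ⟨η, hη, hback⟩ := exists_shift_back hζ hζ4 ht R hc₁
  obtain ⟨a₀, a₁, ha₀, hexp⟩ := exists_exponent_bounds hζ hζ4
  -- `c` is below the tolerance `η` of the shift-back lemma, which returns closeness `c₁`; for small
  -- `ε` the bootstrap brings `c₁` back to `c`, so shifts can be undone without losing accuracy.
  set c := min η (c₁ / 2) with hc
  have hc0 : 0 < c := by positivity
  have hcη : c ≤ η := min_le_left _ _
  have hcc : c ≤ c₁ / 2 := min_le_right _ _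
  refine ⟨c, c₁, min 1 (min η (c / C)), C, hc0, by linarith, by positivity, min_le_left _ _, hC,
    ?_⟩
  intro n p hp F hF hup ε hε hμ
  obtain ⟨hIs, hle, -⟩ := hexp p hp
  have hp0 := hIs.pos
  have hp1 := hIs.lt_one
  have hcore : ∀ r (M : Finset (Fin n)), M.card = t + 2 * r →
      biasedMeasure p (coreFamily M (t + r)) ≤ biasedMeasure p F + ε := by
    intro r M hM
    have h1 := biasedMeasure_coreFamily_le_akMax (p := p) hM
    have h2 := akMax_le_one (n := n) hp0.le hp1.le t
    nlinarith
  have hmain : CloseToCore t R p c₁ F →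
      CloseToCore t R p (C * ε ^ Real.logb (1 - p) p) F := by
    rintro ⟨r, hr, hrt, M, hM, h⟩
    exact ⟨r, hr, hrt, M, hM, hboot n p hp r hr M hM F hF hup ε hε (hcore r M hM) h⟩
  have hmain' : ε ≤ min 1 (min η (c / C)) → CloseToCore t R p c₁ F →
      CloseToCore t R p c F := by
    intro hε1 h
    obtain ⟨r, hr, hrt, M, hM, h⟩ := hmain h
    refine ⟨r, hr, hrt, M, hM, h.trans ?_⟩
    have e1 : ε ≤ 1 := hε1.trans (min_le_left _ _)
    have e2 : ε ≤ c / C := hε1.trans ((min_le_right _ _).trans (min_le_right _ _))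
    have e3 : ε ^ Real.logb (1 - p) p ≤ ε := by
      have := Real.rpow_le_rpow_of_exponent_ge' hε e1 zero_le_one hIs.one_le
      simpa using this
    calc C * ε ^ Real.logb (1 - p) p ≤ C * (c / C) := by
          gcongr
          exact e3.trans e2
      _ = c := by field_simp
  refine ⟨hmain, hmain', ?_⟩
  rintro hε1 i j hij ⟨r, hr, hrt, M, hM, h⟩
  have e2 : ε ≤ η := hε1.trans ((min_le_right _ _).trans (min_le_left _ _))
  obtain ⟨M', hM', h'⟩ := hback n p hp r hr hrt M hM F hF hup i j hij
    ((hcore r M hM).trans (by linarith)) (h.trans hcη)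
  exact hmain' hε1 ⟨r, hr, hrt, M', hM', h'⟩

/-- The inequality rearranges to `r (1 - 2p) ≤ (t - 1) p`, and `1 - 2p ≥ 2ζ`. -/
theorem exists_param_bound {ζ : ℝ} (hζ : 0 < ζ) (ht : 1 ≤ t) :
    ∃ R : ℕ, ∀ p, BiasRange ζ p → ∀ r : ℕ, (r : ℝ) ≤ (t + 2 * r - 1) * p →
      r ≤ R ∧ (r = 0 ∨ 2 ≤ t) := by
  obtain ⟨R, hR⟩ := exists_nat_gt ((t : ℝ) / (2 * ζ))
  refine ⟨R, fun p hp r hr => ?_⟩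
  obtain ⟨h1, h2⟩ := hp
  have ht' : (1 : ℝ) ≤ t := by exact_mod_cast ht
  have hr0 : (0 : ℝ) ≤ r := Nat.cast_nonneg _
  have hlin : (r : ℝ) * (2 * ζ) ≤ (t - 1) * p := by nlinarith
  constructor
  · rw [div_lt_iff₀ (by positivity)] at hR
    have : (r : ℝ) * (2 * ζ) < R * (2 * ζ) := by nlinarith
    exact_mod_cast (lt_of_mul_lt_mul_right this (by positivity)).le
  · by_contra hcon
    push Not at hcon
    have : t = 1 := by omega
    rw [this] at hlin
    have h3 : (0 : ℝ) < r := by exact_mod_cast Nat.pos_of_ne_zero hcon.1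
    have h4 : 0 < (r : ℝ) * (2 * ζ) := by positivity
    norm_num at hlin
    nlinarith

/-- The biased complete intersection theorem, with a description of the extremal families. -/
theorem exists_core_of_maximal {ζ : ℝ} (hζ : 0 < ζ) (hζ4 : ζ ≤ 1 / 4) (ht : 1 ≤ t) {R : ℕ}
    (hR : ∀ p, BiasRange ζ p → ∀ r : ℕ, (r : ℝ) ≤ (t + 2 * r - 1) * p →
      r ≤ R ∧ (r = 0 ∨ 2 ≤ t)) (htn : t ≤ n) (hp : BiasRange ζ p)
    {F : Finset (Finset (Fin n))} (hF : TIntersecting t F)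
    (hμ : akMax n p t ≤ biasedMeasure p F) :
    ∃ r ≤ R, (r = 0 ∨ 2 ≤ t) ∧ ∃ M : Finset (Fin n), M.card = t + 2 * r ∧
      F ⊆ coreFamily M (t + r) := by
  classical
  have hp0 : 0 < p := hζ.trans_le hp.1
  have hp2 : p < 1 / 2 := by linarith [hp.2]
  have hp1 : p < 1 := by linarith
  obtain ⟨c, c₁, ε₁, C, hc, hcc, hε₁, -, hC, hconst⟩ := exists_constants hζ hζ4 ht R
  have hpos : 0 < akMax n p t := (pow_pos hp0 t).trans_le (pow_le_akMax hp0.le hp1.le htn)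
  have hexp0 : Real.logb (1 - p) p ≠ 0 := by
    obtain ⟨a₀, a₁, ha₀, hexp⟩ := exists_exponent_bounds hζ hζ4
    have := (hexp p hp).2.1
    linarith
  obtain ⟨Fm, hFm, hmax⟩ := exists_max_image
    (univ.filter fun F : Finset (Finset (Fin n)) => TIntersecting t F) (biasedMeasure p)
    ⟨F, by simpa using hF⟩
  rw [mem_filter] at hFm
  have hmax' : ∀ F', TIntersecting t F' → biasedMeasure p F' ≤ biasedMeasure p Fm :=
    fun F' hF' => hmax F' (by simpa using hF')
  have hakm : akMax n p t ≤ biasedMeasure p Fm := hμ.trans (hmax' F hF)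
  -- At the threshold of maximal measure a shifted extremal counterexample is itself maximal, hence
  -- contained in a core family, which contradicts its not being close to one.
  have hclose : ∀ F' : Finset (Finset (Fin n)), TIntersecting t F' → biasedMeasure p Fm ≤ biasedMeasure p F' →
      CloseToCore t R p c F' := by
    intro F' hF' hμ'
    by_contra hP
    obtain ⟨E, hE, hEup, hEs, hEμ, hEP, -⟩ := exists_extremal_counterexample hp0 hp1
      (CloseToCore t R p c) (biasedMeasure p Fm)
      (fun F F' h h' => h'.of_subset hp0.le hp1.le h)
      (fun F hF hup hμF i j hij h =>
        (hconst n p hp F hF hup 0 le_rfl (by linarith)).2.2 hε₁.le i j hij.ne h) hF' hμ' hP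
    have hEne : E.Nonempty := by
      rw [nonempty_iff_ne_empty]
      rintro rfl
      rw [biasedMeasure_empty] at hEμ
      linarith
    obtain ⟨r, hrn, hrp, hsub⟩ := subset_coreFamily_of_shifted_of_maximal ht hp0 hp2 hE hEup hEs
      (by
        rintro ⟨E', hE', hlt⟩
        linarith [hmax' E' hE']) hEne
    obtain ⟨h1, h2⟩ := hR p hp r hrp
    refine hEP ⟨r, h1, h2, _, card_initSeg_of_le hrn, ?_⟩
    rw [sdiff_eq_empty_iff_subset.2 hsub, biasedMeasure_empty]
    exact hc.le
  have hcore : ∀ F' : Finset (Finset (Fin n)), TIntersecting t F' → biasedMeasure p Fm ≤ biasedMeasure p F' →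
      ∃ r ≤ R, (r = 0 ∨ 2 ≤ t) ∧ ∃ M : Finset (Fin n), M.card = t + 2 * r ∧
      F' ⊆ coreFamily M (t + r) := by
    intro F' hF' hμ'
    have hμu := hμ'.trans (biasedMeasure_mono hp0.le hp1.le (subset_upClosure F'))
    obtain ⟨r, hr, hrt, M, hM, h⟩ := hclose _ (tIntersecting_upClosure hF') hμu
    -- The bootstrap with `ε = 0` upgrades closeness to exact containment.
    obtain ⟨r, hr, hrt, M, hM, h⟩ := (hconst n p hp _ (tIntersecting_upClosure hF')
      (upClosed_upClosure F') 0 le_rfl (by linarith)).1 ⟨r, hr, hrt, M, hM, h.trans hcc.le⟩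
    rw [Real.zero_rpow hexp0, mul_zero] at h
    exact ⟨r, hr, hrt, M, hM, (subset_upClosure F').trans
      (sdiff_eq_empty_iff_subset.1 (eq_empty_of_biasedMeasure_nonpos hp0 hp1 h))⟩
  obtain ⟨r, hr, hrt, M, hM, h⟩ := hcore Fm hFm.2 le_rfl
  have h1 := biasedMeasure_mono hp0.le hp1.le h
  have h2 := biasedMeasure_coreFamily_le_akMax (p := p) hM
  exact hcore F hF (by linarith)

end BiasedIntersection

namespace BiasedIntersection

open Finset

variable {n : ℕ} {p : ℝ} {t : ℕ}

/-! ### Weak stability for families on a bounded ground set -/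

theorem continuous_biasedMeasure (F : Finset (Finset (Fin n))) :
    Continuous fun p : ℝ => biasedMeasure p F := by
  unfold biasedMeasure
  fun_prop

/-- Near each `p₀` a family attaining the maximum at `p₀` stays ahead of `F` by continuity;
compactness gives a common margin. -/
theorem exists_uniform_gap {ζ : ℝ} {F : Finset (Finset (Fin n))}
    (h : ∀ p, BiasRange ζ p → biasedMeasure p F < akMax n p t) :
    ∃ δ : ℝ, 0 < δ ∧ ∀ p, BiasRange ζ p → biasedMeasure p F + δ ≤ akMax n p t := by
  refine (isCompact_Icc (a := ζ) (b := 1 / 2 - ζ)).induction_on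
    (p := fun S => ∃ δ : ℝ, 0 < δ ∧ ∀ p ∈ S, biasedMeasure p F + δ ≤ akMax n p t)
    ⟨1, one_pos, by simp⟩ ?_ ?_ ?_
  · rintro S T hST ⟨δ, hδ, hT⟩
    exact ⟨δ, hδ, fun p hp => hT p (hST hp)⟩
  · rintro S T ⟨δ, hδ, hS⟩ ⟨δ', hδ', hT⟩
    refine ⟨min δ δ', by positivity, ?_⟩
    rintro p (hp | hp)
    · linarith [hS p hp, min_le_left δ δ']
    · linarith [hT p hp, min_le_right δ δ']
  · intro p₀ hp₀
    have h0 := h p₀ hp₀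
    obtain ⟨r, hr⟩ := (akMax_isGreatest n p₀ t).1
    dsimp only at hr
    set d := (akMax n p₀ t - biasedMeasure p₀ F) / 2 with hd
    have hd0 : 0 < d := by rw [hd]; linarith
    have hcont : Continuous fun p : ℝ =>
        biasedMeasure p (akFamily n t r) - biasedMeasure p F :=
      (continuous_biasedMeasure _).sub (continuous_biasedMeasure _)
    refine ⟨{p | d < biasedMeasure p (akFamily n t r) - biasedMeasure p F},
      mem_nhdsWithin_of_mem_nhds ((isOpen_lt continuous_const hcont).mem_nhds ?_), d, hd0, ?_⟩
    · simp only [Set.mem_ofPred_eq, hr]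
      rw [hd]; linarith
    · intro p hp
      simp only [Set.mem_ofPred_eq] at hp
      have := biasedMeasure_akFamily_le_akMax n p t r
      linarith

/-- There are finitely many families on at most `N` points. Each one not contained in an admissible
core family is below the maximum for every `p` by the exact theorem, hence uniformly so. -/
theorem exists_core_of_bounded {ζ : ℝ} (hζ : 0 < ζ) (hζ4 : ζ ≤ 1 / 4) (ht : 1 ≤ t) {R : ℕ}
    (hR : ∀ p, BiasRange ζ p → ∀ r : ℕ, (r : ℝ) ≤ (t + 2 * r - 1) * p →
      r ≤ R ∧ (r = 0 ∨ 2 ≤ t)) (N : ℕ) :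
    ∃ ε : ℝ, 0 < ε ∧ ∀ n ≤ N, t ≤ n → ∀ p, BiasRange ζ p → ∀ F : Finset (Finset (Fin n)),
      TIntersecting t F → akMax n p t * (1 - ε) ≤ biasedMeasure p F →
      ∃ r ≤ R, (r = 0 ∨ 2 ≤ t) ∧ ∃ M : Finset (Fin n), M.card = t + 2 * r ∧
        F ⊆ coreFamily M (t + r) := by
  have hone : ∀ n, t ≤ n → ∀ F : Finset (Finset (Fin n)), ∃ ε : ℝ, 0 < ε ∧ ∀ p, BiasRange ζ p →
      TIntersecting t F → akMax n p t * (1 - ε) ≤ biasedMeasure p F →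
      ∃ r ≤ R, (r = 0 ∨ 2 ≤ t) ∧ ∃ M : Finset (Fin n), M.card = t + 2 * r ∧
        F ⊆ coreFamily M (t + r) := by
    intro n htn F
    by_cases hF : TIntersecting t F
    swap
    · exact ⟨1, one_pos, fun _ _ h => absurd h hF⟩
    by_cases hcon : ∃ r ≤ R, (r = 0 ∨ 2 ≤ t) ∧ ∃ M : Finset (Fin n), M.card = t + 2 * r ∧
        F ⊆ coreFamily M (t + r)
    · exact ⟨1, one_pos, fun _ _ _ _ => hcon⟩
    obtain ⟨δ, hδ, hgap⟩ := exists_uniform_gap (ζ := ζ) (F := F) (t := t) (fun p hp => by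
      by_contra hge
      exact hcon (exists_core_of_maximal hζ hζ4 ht hR htn hp hF (not_lt.1 hge)))
    refine ⟨δ / 2, by positivity, fun p hp _ hμ => ?_⟩
    have h1 := hgap p hp
    have h2 := akMax_le_one (n := n) (p := p) (hζ.le.trans hp.1) (by linarith [hp.2]) t
    nlinarith
  have hall : ∀ n, t ≤ n → ∃ ε : ℝ, 0 < ε ∧ ∀ p, BiasRange ζ p →
      ∀ F : Finset (Finset (Fin n)), TIntersecting t F →
      akMax n p t * (1 - ε) ≤ biasedMeasure p F →
      ∃ r ≤ R, (r = 0 ∨ 2 ≤ t) ∧ ∃ M : Finset (Fin n), M.card = t + 2 * r ∧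
        F ⊆ coreFamily M (t + r) := by
    intro n htn
    choose ε hε hmain using hone n htn
    obtain ⟨F₀, -, hmin⟩ := exists_min_image (univ : Finset (Finset (Finset (Fin n)))) ε
      univ_nonempty
    refine ⟨ε F₀, hε F₀, fun p hp F hF hμ => hmain F p hp hF ?_⟩
    have h0 : 0 ≤ akMax n p t := (pow_nonneg (hζ.le.trans hp.1) t).trans
      (pow_le_akMax (hζ.le.trans hp.1) (by linarith [hp.2]) htn)
    have := hmin F (mem_univ F)
    nlinarith
  induction N with
  | zero => exact ⟨1, one_pos, fun n hn htn => by omega⟩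
  | succ N ih =>
    obtain ⟨ε, hε, h⟩ := ih
    by_cases htN : t ≤ N + 1
    swap
    · exact ⟨1, one_pos, fun n hn htn => by omega⟩
    obtain ⟨ε', hε', h'⟩ := hall (N + 1) htN
    refine ⟨min ε ε', by positivity, fun n hn htn p hp F hF hμ => ?_⟩
    have h0 : 0 ≤ akMax n p t := (pow_nonneg (hζ.le.trans hp.1) t).trans
      (pow_le_akMax (hζ.le.trans hp.1) (by linarith [hp.2]) htn)
    have e1 := min_le_left ε ε'
    have e2 := min_le_right ε ε'
    rcases hn.lt_or_eq with hlt | rfl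
    · exact h n (by omega) htn p hp F hF (by nlinarith)
    · exact h' p hp F hF (by nlinarith)

/-! ### Families depending on the first `m` coordinates -/

/-- The family induced by `F` on the first `m` coordinates. -/
def restrictFamily {m : ℕ} (h : m ≤ n) (F : Finset (Finset (Fin n))) : Finset (Finset (Fin m)) :=
  univ.filter fun A => A.map (Fin.castLEEmb h) ∈ F

theorem mem_restrictFamily {m : ℕ} {h : m ≤ n} {F : Finset (Finset (Fin n))}
    {A : Finset (Fin m)} : A ∈ restrictFamily h F ↔ A.map (Fin.castLEEmb h) ∈ F := by
  simp [restrictFamily]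

theorem initSeg_eq_map {m : ℕ} (h : m ≤ n) : initSeg n m = univ.map (Fin.castLEEmb h) := by
  ext i
  simp only [mem_initSeg, mem_map, mem_univ, true_and, Fin.castLEEmb_apply]
  constructor
  · intro hi
    exact ⟨⟨i, hi⟩, rfl⟩
  · rintro ⟨j, rfl⟩
    exact j.2

theorem exists_map_eq_inter {m : ℕ} (h : m ≤ n) (A : Finset (Fin n)) :
    ∃ B : Finset (Fin m), B.map (Fin.castLEEmb h) = A ∩ initSeg n m := by
  have h1 : A ∩ initSeg n m ⊆ univ.map (Fin.castLEEmb h) := by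
    rw [← initSeg_eq_map h]; exact inter_subset_right
  obtain ⟨B, -, hB⟩ := subset_map_iff.1 h1
  exact ⟨B, hB.symm⟩

theorem biasedMeasure_restrictFamily {m : ℕ} (h : m ≤ n) {F : Finset (Finset (Fin n))}
    (hup : UpClosed F) (hd : DependsOn F m) :
    biasedMeasure p (restrictFamily h F) = biasedMeasure p F := by
  have hc := card_initSeg_of_le h
  rw [biasedMeasure_eq_sum_traces F (initSeg n m)]
  have h1 : ∀ C ∈ (initSeg n m).powerset, biasedMeasure p (F.filter fun A =>
      A ∩ initSeg n m = C) = if C ∈ F then p ^ C.card * (1 - p) ^ (m - C.card) else 0 := by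
    intro C hC
    rw [mem_powerset] at hC
    split_ifs with hCF
    · have e1 := biasedMeasure_trace_eq (p := p) hC
      rw [hc] at e1
      rw [← e1]
      congr 1
      ext A
      simp only [mem_filter, mem_univ, true_and, and_iff_right_iff_imp]
      rintro rfl
      exact hup _ hCF _ inter_subset_left
    · rw [filter_eq_empty_iff.2, biasedMeasure_empty]
      rintro A hA rfl
      exact hCF (hd A hA)
  rw [sum_congr rfl h1, ← sum_filter, biasedMeasure]
  refine sum_bij (fun A _ => A.map (Fin.castLEEmb h)) ?_ ?_ ?_ ?_
  · intro A hA
    rw [mem_restrictFamily] at hA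
    rw [mem_filter, mem_powerset, initSeg_eq_map h]
    exact ⟨map_subset_map.2 (subset_univ A), hA⟩
  · intro A _ B _ hAB
    exact map_injective _ hAB
  · intro C hC
    rw [mem_filter, mem_powerset] at hC
    obtain ⟨B, hB⟩ := exists_map_eq_inter h C
    rw [inter_eq_left.2 hC.1] at hB
    exact ⟨B, mem_restrictFamily.2 (hB ▸ hC.2), hB⟩
  · intro A _
    rw [card_map]

theorem upClosed_coreFamily (M : Finset (Fin n)) (k : ℕ) : UpClosed (coreFamily M k) := by
  intro A hA B hAB
  rw [mem_coreFamily] at hA ⊢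
  exact hA.trans (card_le_card (inter_subset_inter hAB Subset.rfl))

/-- Lifting a family from `[m]` keeps its measure. Even if its core was cut off at `m`, the lift is
contained in the family with the same `r` on `[n]`. -/
theorem akMax_mono (hp : 0 ≤ p) (hp1 : p ≤ 1) {m : ℕ} (h : m ≤ n) :
    akMax m p t ≤ akMax n p t := by
  obtain ⟨r, hr⟩ := (akMax_isGreatest m p t).1
  dsimp only at hr
  rw [← hr]
  set F := coreFamily (initSeg n m ∩ initSeg n (t + 2 * r)) (t + r) with hF
  have hd : DependsOn F m := by
    intro A hA
    rw [hF, mem_coreFamily] at hA ⊢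
    rwa [inter_assoc, ← inter_assoc (initSeg n m), inter_self]
  have hJ : restrictFamily h F = akFamily m t r := by
    ext A
    have e1 : A.map (Fin.castLEEmb h) ∩ (initSeg n m ∩ initSeg n (t + 2 * r)) =
        (A ∩ initSeg m (t + 2 * r)).map (Fin.castLEEmb h) := by
      ext x
      simp only [mem_inter, mem_map, mem_initSeg, Fin.castLEEmb_apply]
      constructor
      · rintro ⟨⟨a, ha, rfl⟩, h1, h2⟩
        exact ⟨a, ⟨ha, h2⟩, rfl⟩
      · rintro ⟨a, ⟨ha, h2⟩, rfl⟩
        exact ⟨⟨a, ha, rfl⟩, a.2, h2⟩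
    rw [mem_restrictFamily, hF, mem_coreFamily, e1, card_map, akFamily_eq_coreFamily,
      mem_coreFamily]
  rw [← hJ, biasedMeasure_restrictFamily h (upClosed_coreFamily _ _) hd]
  refine (biasedMeasure_mono hp hp1 fun A hA => ?_).trans
    (biasedMeasure_akFamily_le_akMax n p t r)
  exact mem_coreFamily_mono (inter_subset_inter Subset.rfl inter_subset_right) hA

theorem exists_core_of_dependsOn {ζ : ℝ} (hζ : 0 < ζ) (hζ4 : ζ ≤ 1 / 4) (ht : 1 ≤ t) {R : ℕ}
    (hR : ∀ p, BiasRange ζ p → ∀ r : ℕ, (r : ℝ) ≤ (t + 2 * r - 1) * p →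
      r ≤ R ∧ (r = 0 ∨ 2 ≤ t)) {m : ℕ} (htm : t ≤ m) :
    ∃ ε : ℝ, 0 < ε ∧ ∀ n, t ≤ n → ∀ p, BiasRange ζ p → ∀ F : Finset (Finset (Fin n)),
      TIntersecting t F → UpClosed F → DependsOn F m →
      akMax n p t * (1 - ε) ≤ biasedMeasure p F →
      ∃ r ≤ R, (r = 0 ∨ 2 ≤ t) ∧ ∃ M : Finset (Fin n), M.card = t + 2 * r ∧
        F ⊆ coreFamily M (t + r) := by
  obtain ⟨ε, hε, hmain⟩ := exists_core_of_bounded hζ hζ4 ht hR m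
  refine ⟨min ε 1, by positivity, fun n htn p hp F hF hup hd hμ => ?_⟩
  have hp0 : 0 ≤ p := hζ.le.trans hp.1
  have hp1 : p ≤ 1 := by linarith [hp.2]
  have h0 : ∀ n, t ≤ n → 0 ≤ akMax n p t := fun n hn =>
    (pow_nonneg hp0 t).trans (pow_le_akMax hp0 hp1 hn)
  have e1 := min_le_left ε 1
  have e2 := min_le_right ε 1
  rcases le_or_gt n m with hnm | hnm
  · exact hmain n hnm htn p hp F hF (by nlinarith [h0 n htn])
  · have hmn := hnm.le
    have hJ : TIntersecting t (restrictFamily hmn F) := by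
      intro A hA B hB
      rw [mem_restrictFamily] at hA hB
      have := hF _ hA _ hB
      rwa [← map_inter, card_map] at this
    obtain ⟨r, hr, hrt, M, hM, hsub⟩ := hmain m le_rfl htm p hp (restrictFamily hmn F) hJ (by
      rw [biasedMeasure_restrictFamily hmn hup hd]
      have := akMax_mono (t := t) hp0 hp1 hmn
      nlinarith [h0 m htm])
    refine ⟨r, hr, hrt, M.map (Fin.castLEEmb hmn), by rw [card_map, hM], fun A hA => ?_⟩
    obtain ⟨B, hB⟩ := exists_map_eq_inter hmn A
    have h1 := hsub (mem_restrictFamily.2 (hB ▸ hd A hA))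
    rw [mem_coreFamily] at h1 ⊢
    refine h1.trans ?_
    rw [← card_map (Fin.castLEEmb hmn), map_inter, hB]
    exact card_le_card (inter_subset_inter inter_subset_left Subset.rfl)

/-! ### Weak stability -/

/-- A trace containing at least half of `K` has weight at most `√(p(1 - p)) ^ |K|`, and there are at
most `2 ^ |K|` traces. -/
theorem biasedMeasure_half_sq_le (hp : 0 < p) (hp2 : p ≤ 1 / 2) (K : Finset (Fin n)) :
    biasedMeasure p (univ.filter fun A : Finset (Fin n) => K.card ≤ 2 * (A ∩ K).card) ^ 2 ≤
      (4 * p * (1 - p)) ^ K.card := by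
  have hq : 0 < 1 - p := by linarith
  set s := Real.sqrt ((p * (1 - p)) ^ K.card) with hs
  have hpq : 0 ≤ (p * (1 - p)) ^ K.card := by positivity
  have hle : biasedMeasure p (univ.filter fun A : Finset (Fin n) =>
      K.card ≤ 2 * (A ∩ K).card) ≤ 2 ^ K.card * s := by
    rw [biasedMeasure_eq_sum_traces _ K]
    have : ∑ C ∈ K.powerset, s = 2 ^ K.card * s := by
      rw [sum_const, card_powerset, nsmul_eq_mul]; push_cast; rfl
    rw [← this]
    refine sum_le_sum fun C hC => ?_
    rw [mem_powerset] at hC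
    by_cases hCK : K.card ≤ 2 * C.card
    · refine (biasedMeasure_mono hp.le (by linarith) (filter_subset_filter _
        (subset_univ _))).trans ?_
      rw [biasedMeasure_trace_eq hC]
      refine Real.le_sqrt_of_sq_le ?_
      have hcK := card_le_card hC
      obtain ⟨d, hd⟩ := Nat.exists_eq_add_of_le hCK
      calc (p ^ C.card * (1 - p) ^ (K.card - C.card)) ^ 2
          = p ^ (2 * C.card) * (1 - p) ^ (2 * (K.card - C.card)) := by
            rw [mul_pow, ← pow_mul, ← pow_mul, mul_comm C.card, mul_comm (K.card - C.card)]
        _ = p ^ K.card * (p ^ d * (1 - p) ^ (K.card - d)) := by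
            rw [hd, pow_add, show 2 * (K.card - C.card) = K.card - d by omega]; ring
        _ ≤ p ^ K.card * ((1 - p) ^ d * (1 - p) ^ (K.card - d)) := by
            gcongr; linarith
        _ = (p * (1 - p)) ^ K.card := by
            rw [← pow_add, mul_pow, show d + (K.card - d) = K.card by omega]
    · rw [filter_eq_empty_iff.2, biasedMeasure_empty]
      · exact Real.sqrt_nonneg _
      · rintro A hA rfl
        exact hCK (mem_filter.1 hA).2
  have h0 := biasedMeasure_nonneg hp.le (by linarith) (univ.filter fun A : Finset (Fin n) =>
      K.card ≤ 2 * (A ∩ K).card)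
  calc _ ≤ (2 ^ K.card * s) ^ 2 := by gcongr
    _ = (4 * p * (1 - p)) ^ K.card := by
      rw [mul_pow, hs, Real.sq_sqrt hpq, ← pow_mul, mul_comm K.card 2, pow_mul, ← mul_pow]
      norm_num
      ring

theorem exists_half_small {ζ δ : ℝ} (hζ : 0 < ζ) (hζ4 : ζ ≤ 1 / 4) (hδ : 0 < δ) :
    ∃ m₀ : ℕ, ∀ (n : ℕ) (p : ℝ), BiasRange ζ p → ∀ K : Finset (Fin n), m₀ ≤ K.card →
      biasedMeasure p (univ.filter fun A : Finset (Fin n) => K.card ≤ 2 * (A ∩ K).card) ≤ δ := by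
  have hρ1 : 1 - 4 * ζ ^ 2 < 1 := by nlinarith
  have hρ0 : 0 ≤ 1 - 4 * ζ ^ 2 := by nlinarith
  obtain ⟨m₀, hm₀⟩ := exists_pow_lt_of_lt_one (show 0 < δ ^ 2 by positivity) hρ1
  refine ⟨m₀, fun n p hp K hK => ?_⟩
  obtain ⟨h1, h2⟩ := hp
  have h3 := biasedMeasure_half_sq_le (p := p) (by linarith) (by linarith) K
  refine (pow_le_pow_iff_left₀ (biasedMeasure_nonneg (by linarith) (by linarith) _) hδ.le
    two_ne_zero).1 ?_
  refine h3.trans (le_trans ?_ hm₀.le)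
  calc (4 * p * (1 - p)) ^ K.card ≤ (1 - 4 * ζ ^ 2) ^ K.card := by
        refine pow_le_pow_left₀ (mul_nonneg (by linarith) (by linarith)) ?_ _
        nlinarith
    _ ≤ (1 - 4 * ζ ^ 2) ^ m₀ := pow_le_pow_of_le_one hρ0 hρ1.le hK

/-- Stability with an unspecified small threshold, but in the sharp form. -/
theorem exists_stability {ζ : ℝ} (hζ : 0 < ζ) (hζ4 : ζ ≤ 1 / 4) (ht : 1 ≤ t) :
    ∃ (R : ℕ) (ε₀ C : ℝ), 0 < ε₀ ∧ ε₀ ≤ 1 ∧ 0 < C ∧ ∀ (n : ℕ) (p : ℝ), t ≤ n → BiasRange ζ p →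
      ∀ F : Finset (Finset (Fin n)), TIntersecting t F → ∀ ε : ℝ, 0 ≤ ε → ε ≤ ε₀ →
      akMax n p t * (1 - ε) ≤ biasedMeasure p F →
      CloseToCore t R p (C * ε ^ Real.logb (1 - p) p) F := by
  obtain ⟨R, hR⟩ := exists_param_bound (t := t) hζ ht
  obtain ⟨c, c₁, ε₁, C, hc, hcc, hε₁, hε₁1, hC, hconst⟩ := exists_constants hζ hζ4 ht R
  obtain ⟨m₁, hm₁⟩ := exists_half_small hζ hζ4 (show 0 < c₁ - c by linarith)
  -- Beyond `m₁` the sets removed by an exchange have measure at most `c₁ - c`; beyond `t + 2 * R`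
  -- the exceptional alternative of `improvable_or` cannot occur.
  set m := max m₁ (t + 2 * R) with hm
  obtain ⟨ε₂, hε₂, hdep⟩ := exists_core_of_dependsOn hζ hζ4 ht hR (m := m)
    (le_max_of_le_right (by omega))
  set ε₀ := min ε₁ ε₂ with hε₀
  have hε₀1 : ε₀ ≤ ε₁ := min_le_left _ _
  have hε₀2 : ε₀ ≤ ε₂ := min_le_right _ _
  have hε₀0 : 0 < ε₀ := by positivity
  refine ⟨R, ε₀, C, hε₀0, hε₀1.trans hε₁1, hC, ?_⟩
  intro n p htn hp F hF ε hε hεε hμ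
  have hp0 : 0 < p := hζ.trans_le hp.1
  have hp2 : p < 1 / 2 := by linarith [hp.2]
  have hp1 : p < 1 := by linarith
  have hak : 0 ≤ akMax n p t := (pow_nonneg hp0.le t).trans (pow_le_akMax hp0.le hp1.le htn)
  have hweak : ∀ F : Finset (Finset (Fin n)), TIntersecting t F →
      akMax n p t * (1 - ε₀) ≤ biasedMeasure p F → CloseToCore t R p c F := by
    intro F₁ hF₁ hμ₁
    by_contra hP
    obtain ⟨E, hE, hEup, hEs, hEμ, hEP, hElarge⟩ := exists_extremal_counterexample hp0 hp1
      (CloseToCore t R p c) (akMax n p t * (1 - ε₀))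
      (fun F F' h h' => h'.of_subset hp0.le hp1.le h)
      (fun F hF hup hμF i j hij h =>
        (hconst n p hp F hF hup ε₀ hε₀0.le hμF).2.2 hε₀1 i j hij.ne h) hF₁ hμ₁ hP
    by_cases hdm : DependsOn E m
    · obtain ⟨r, hr, hrt, M, hM, hsub⟩ := hdep n htn p hp E hE hEup hdm (by nlinarith)
      refine hEP ⟨r, hr, hrt, M, hM, ?_⟩
      rw [sdiff_eq_empty_iff_subset.2 hsub, biasedMeasure_empty]
      exact hc.le
    classical
    have hdn : DependsOn E n := by
      intro A hA
      rw [initSeg_of_le le_rfl, inter_univ]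
      exact hA
    have hex : ∃ k, DependsOn E k := ⟨n, hdn⟩
    set k := Nat.find hex with hk
    have hdk : DependsOn E k := Nat.find_spec hex
    have hkn : k ≤ n := Nat.find_min' hex hdn
    have hmk : m < k := by
      by_contra hle
      refine hdm fun A hA => hEup _ (hdk A hA) _ (inter_subset_inter Subset.rfl fun x hx => ?_)
      rw [mem_initSeg] at hx ⊢
      omega
    obtain ⟨e, he⟩ : ∃ e : Fin n, e.val + 1 = k := ⟨⟨k - 1, by omega⟩, by simp; omega⟩
    have hdk' : ¬ DependsOn E e.val := Nat.find_min hex (by omega)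
    rw [← he] at hdk
    rcases improvable_or hp0 hp2 hE hEs hdk hdk' with ⟨E', h1, h2, h3⟩ | ⟨r, hr, hrp⟩
    · obtain ⟨r, hr, hrt, M, hM, hclose⟩ := hElarge E' h1 h2
      refine hEP ((hconst n p hp E hE hEup ε₀ hε₀0.le hEμ).2.1 hε₀1 ⟨r, hr, hrt, M, hM, ?_⟩)
      have hcard : (initSeg n (e.val + 1)).card = e.val + 1 := card_initSeg_of_le e.2
      have h4 := hm₁ n p hp (initSeg n (e.val + 1)) (by
        rw [hcard, he]
        exact (le_max_left _ _).trans hmk.le)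
      rw [hcard] at h4
      -- The improved family is `c`-close by extremality and the exchange costs at most `c₁ - c`, so
      -- `E` is `c₁`-close, and the constants return this to `c`.
      have h5 : E \ coreFamily M (t + r) ⊆ (E \ E') ∪ (E' \ coreFamily M (t + r)) := by
        intro A hA
        simp only [mem_union, mem_sdiff] at hA ⊢
        tauto
      have h6 := (biasedMeasure_mono hp0.le hp1.le h5).trans
        (biasedMeasure_union_le hp0.le hp1.le _ _)
      unfold heavy at h3
      linarith
    · have hev : (e.val : ℝ) = t + 2 * r - 1 := by
        have : (e.val : ℝ) + 1 = t + 2 * r := by exact_mod_cast hr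
        linarith
      rw [hev] at hrp
      have h1 := (hR p hp r hrp).1
      have h2 : t + 2 * R ≤ m := le_max_right _ _
      omega
  have hFu := tIntersecting_upClosure hF
  have hμu := hμ.trans (biasedMeasure_mono hp0.le hp1.le (subset_upClosure F))
  have h1 := hweak _ hFu (by nlinarith)
  obtain ⟨r, hr, hrt, M, hM, h⟩ := h1
  exact ((hconst n p hp _ hFu (upClosed_upClosure F) ε hε hμu).1
    ⟨r, hr, hrt, M, hM, h.trans hcc.le⟩).of_subset hp0.le hp1.le (subset_upClosure F)

end BiasedIntersection

namespace BiasedIntersection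

open Finset

variable {n : ℕ} {p : ℝ} {t : ℕ}

/-! ### Comparing the families `akFamily n t r` -/

theorem biasedMeasure_layer_univ (S : Finset (Fin n)) (k : ℕ) :
    biasedMeasure p (layer univ S k) = S.card.choose k * (p ^ k * (1 - p) ^ (S.card - k)) := by
  rw [biasedMeasure_eq_sum_traces _ S]
  have h1 : ∀ C ∈ S.powerset, biasedMeasure p ((layer univ S k).filter fun A => A ∩ S = C) =
      if C.card = k then p ^ k * (1 - p) ^ (S.card - k) else 0 := by
    intro C hC
    rw [mem_powerset] at hC
    split_ifs with hCk
    · have h2 := biasedMeasure_trace_eq (p := p) hC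
      rw [hCk] at h2
      rw [← h2]
      congr 1
      ext A
      simp only [mem_filter, mem_layer, mem_univ, true_and, and_iff_right_iff_imp]
      rintro rfl
      exact hCk
    · rw [filter_eq_empty_iff.2, biasedMeasure_empty]
      rintro A hA rfl
      exact hCk (mem_layer.1 hA).2
  rw [sum_congr rfl h1, ← sum_filter, sum_const, nsmul_eq_mul, ← card_powersetCard,
    powersetCard_eq_filter]

/-- The sets with exactly `k` elements in `S` and with trace `U` on `T`. -/
theorem biasedMeasure_layer_trace {S T U : Finset (Fin n)} (hST : Disjoint S T) (hU : U ⊆ T)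
    (k : ℕ) :
    biasedMeasure p ((layer univ S k).filter fun A => A ∩ T = U) =
      p ^ U.card * (1 - p) ^ (T.card - U.card) *
        (S.card.choose k * (p ^ k * (1 - p) ^ (S.card - k))) := by
  rw [biasedMeasure_slice _ hU, ← biasedMeasure_layer_univ]
  congr 2
  ext A
  have : (A \ T ∪ U) ∩ S = A ∩ S := by
    ext x
    have h1 : x ∈ S → x ∉ T := fun h => disjoint_left.1 hST h
    have h2 := @hU x
    simp only [mem_inter, mem_union, mem_sdiff]
    tauto
  rw [mem_slice, mem_layer, mem_layer, this]
  simp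

theorem card_inter_split {S S' A : Finset (Fin n)} (h : S ⊆ S') :
    (A ∩ S').card = (A ∩ S).card + (A ∩ (S' \ S)).card := by
  rw [← card_union_of_disjoint, ← inter_union_distrib_left, union_sdiff_of_subset h]
  exact disjoint_sdiff.mono inter_subset_right inter_subset_right

theorem initSeg_mono {k m : ℕ} (h : k ≤ m) : initSeg n k ⊆ initSeg n m := fun x hx => by
  rw [mem_initSeg] at hx ⊢
  omega

theorem card_initSeg_sdiff {k m : ℕ} (h : k ≤ m) (hm : m ≤ n) :
    (initSeg n m \ initSeg n k).card = m - k := by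
  rw [card_sdiff_of_subset (initSeg_mono h), card_initSeg_of_le hm,
    card_initSeg_of_le (h.trans hm)]

/-- Only the threshold matters: a set is gained if it has `t + r - 1` points in the old core and
both new points, and lost if it has `t + r` and neither. The sign of the last factor makes the
measures unimodal in `r`. -/
theorem biasedMeasure_akFamily_succ_sub (ht : 1 ≤ t) {r : ℕ} (hn : t + 2 * (r + 1) ≤ n) :
    ((r : ℝ) + 1) * (biasedMeasure p (akFamily n t (r + 1)) - biasedMeasure p (akFamily n t r)) =
      ((t + 2 * r).choose (t + r) : ℝ) * (p ^ (t + r) * (1 - p) ^ (r + 1)) *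
        ((t + 2 * r + 1) * p - (r + 1)) := by
  set S := initSeg n (t + 2 * r) with hS
  set S' := initSeg n (t + 2 * (r + 1)) with hS'
  set T := S' \ S with hT
  have hSS : S ⊆ S' := initSeg_mono (by omega)
  have hST : Disjoint S T := disjoint_sdiff
  have hSc : S.card = t + 2 * r := card_initSeg_of_le (by omega)
  have hTc : T.card = 2 := by
    rw [hT, card_initSeg_sdiff (by omega) hn]; omega
  have e1 : akFamily n t (r + 1) \ akFamily n t r =
      (layer univ S (t + r - 1)).filter fun A => A ∩ T = T := by
    ext A
    rw [akFamily_eq_coreFamily, akFamily_eq_coreFamily, mem_sdiff, mem_coreFamily, mem_coreFamily,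
      mem_filter, mem_layer, card_inter_split hSS, ← hS, ← hT]
    have h1 : (A ∩ T).card ≤ 2 := hTc ▸ card_le_card inter_subset_right
    constructor
    · rintro ⟨h2, h3⟩
      refine ⟨⟨mem_univ _, by omega⟩, eq_of_subset_of_card_le inter_subset_right ?_⟩
      omega
    · rintro ⟨⟨-, h2⟩, h3⟩
      rw [h3, hTc]
      omega
  have e2 : akFamily n t r \ akFamily n t (r + 1) =
      (layer univ S (t + r)).filter fun A => A ∩ T = ∅ := by
    ext A
    rw [akFamily_eq_coreFamily, akFamily_eq_coreFamily, mem_sdiff, mem_coreFamily, mem_coreFamily,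
      mem_filter, mem_layer, card_inter_split hSS, ← card_eq_zero, ← hS, ← hT]
    have := mem_univ A
    constructor
    · rintro ⟨h2, h3⟩
      exact ⟨⟨this, by omega⟩, by omega⟩
    · rintro ⟨⟨-, h2⟩, h3⟩
      omega
  have h1 := biasedMeasure_sdiff_comm (p := p) (akFamily n t r) (akFamily n t (r + 1))
  rw [e1, e2, biasedMeasure_layer_trace hST Subset.rfl, biasedMeasure_layer_trace hST
    (empty_subset _), hSc, hTc, card_empty] at h1
  obtain ⟨k, hk⟩ : ∃ k, t + r = k + 1 := ⟨t + r - 1, by omega⟩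
  have h2 := Nat.choose_succ_right_eq (t + 2 * r) k
  have h3 : t + 2 * r - k = r + 1 := by omega
  rw [h3] at h2
  have h4 : ((t + 2 * r).choose (k + 1) : ℝ) * (k + 1) = (t + 2 * r).choose k * (r + 1) := by
    exact_mod_cast h2
  have h5 : (t : ℝ) + r = k + 1 := by exact_mod_cast hk
  rw [hk, show k + 1 - 1 = k by omega, h3, show t + 2 * r - (k + 1) = r by omega] at h1
  rw [hk]
  have h6 : biasedMeasure p (akFamily n t (r + 1)) - biasedMeasure p (akFamily n t r) =
      p ^ 2 * ((t + 2 * r).choose k * (p ^ k * (1 - p) ^ (r + 1))) -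
      (1 - p) ^ 2 * ((t + 2 * r).choose (k + 1) * (p ^ (k + 1) * (1 - p) ^ r)) := by
    simp only [Nat.sub_self, pow_zero, mul_one, one_mul, Nat.sub_zero] at h1
    linarith
  rw [h6]
  have h7 : (t : ℝ) + 2 * r + 1 = (k + 1) + (r + 1) := by linarith
  rw [h7]
  have h8 : ((r : ℝ) + 1) * (p ^ 2 * ((t + 2 * r).choose k * (p ^ k * (1 - p) ^ (r + 1)))) =
      ((t + 2 * r).choose (k + 1) * (k + 1)) * (p ^ 2 * (p ^ k * (1 - p) ^ (r + 1))) := by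
    rw [h4]; ring
  rw [mul_sub, h8]
  ring

theorem biasedMeasure_akFamily_le_of_le (ht : 1 ≤ t) (hp : 0 < p) (hp2 : p < 1 / 2) {r s : ℕ}
    (hrs : r ≤ s) (hs : (s : ℝ) ≤ (t + 2 * s - 1) * p) (hn : t + 2 * s ≤ n) :
    biasedMeasure p (akFamily n t r) ≤ biasedMeasure p (akFamily n t s) := by
  induction s, hrs using Nat.le_induction with
  | base => exact le_rfl
  | succ s hrs ih =>
    push_cast at hs
    refine (ih (by nlinarith) (by omega)).trans ?_
    have h1 := biasedMeasure_akFamily_succ_sub (p := p) ht hn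
    have h2 : 0 ≤ ((t + 2 * s).choose (t + s) : ℝ) * (p ^ (t + s) * (1 - p) ^ (s + 1)) *
        ((t + 2 * s + 1) * p - (s + 1)) := by
      have : 0 ≤ 1 - p := by linarith
      refine mul_nonneg (by positivity) (by linarith)
    rw [← h1] at h2
    have h3 := nonneg_of_mul_nonneg_right h2 (by positivity)
    linarith

theorem biasedMeasure_akFamily_le_of_ge (ht : 1 ≤ t) (hp : 0 < p) (hp2 : p < 1 / 2) {r s : ℕ}
    (hrs : s ≤ r) (hs : (t + 2 * s + 1) * p ≤ (s : ℝ) + 1) (hn : t + 2 * r ≤ n) :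
    biasedMeasure p (akFamily n t r) ≤ biasedMeasure p (akFamily n t s) := by
  induction r, hrs using Nat.le_induction with
  | base => exact le_rfl
  | succ r hrs ih =>
    refine le_trans ?_ (ih (by omega))
    have hsr : (s : ℝ) ≤ r := by exact_mod_cast hrs
    have h1 := biasedMeasure_akFamily_succ_sub (p := p) ht hn
    have h2 : ((t + 2 * r).choose (t + r) : ℝ) * (p ^ (t + r) * (1 - p) ^ (r + 1)) *
        ((t + 2 * r + 1) * p - (r + 1)) ≤ 0 := by
      have : 0 ≤ 1 - p := by linarith
      refine mul_nonpos_of_nonneg_of_nonpos (by positivity) ?_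
      nlinarith
    rw [← h1] at h2
    have h3 : biasedMeasure p (akFamily n t (r + 1)) - biasedMeasure p (akFamily n t r) ≤ 0 := by
      by_contra hcon
      rw [not_le] at hcon
      have : 0 < (r : ℝ) + 1 := by positivity
      nlinarith [mul_pos this hcon]
    linarith

/-- Core families with an oversized core are contained in core families with a genuine core. -/
theorem coreFamily_subset_of_lt {M N : Finset (Fin n)} {r r₀ : ℕ} (h : n < t + 2 * r)
    (h₀ : n ≤ t + 2 * r₀ + 1) (h₀' : t + 2 * r₀ ≤ n) (hN : N.card = t + 2 * r₀) :
    coreFamily M (t + r) ⊆ coreFamily N (t + r₀) := by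
  intro A hA
  rw [mem_coreFamily] at hA ⊢
  have h1 : (A ∩ M).card ≤ A.card := card_le_card inter_subset_left
  have h2 := card_sdiff_add_card_inter A N
  have h3 : (A \ N).card ≤ Nᶜ.card := card_le_card fun x hx => by
    rw [mem_sdiff] at hx
    rw [mem_compl]
    exact hx.2
  have h4 := card_compl_add_card N
  rw [Fintype.card_fin] at h4
  omega

theorem akMax_eq (ht : 1 ≤ t) (hp : 0 < p) (hp2 : p < 1 / 2) {s : ℕ}
    (hs : (s : ℝ) ≤ (t + 2 * s - 1) * p) (hs' : (t + 2 * s + 1) * p ≤ (s : ℝ) + 1)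
    (hn : t + 2 * s ≤ n) : akMax n p t = biasedMeasure p (akFamily n t s) := by
  refine le_antisymm ?_ (biasedMeasure_akFamily_le_akMax n p t s)
  have hle : ∀ r, t + 2 * r ≤ n →
      biasedMeasure p (akFamily n t r) ≤ biasedMeasure p (akFamily n t s) := by
    intro r hr
    rcases le_total r s with h | h
    · exact biasedMeasure_akFamily_le_of_le ht hp hp2 h hs hn
    · exact biasedMeasure_akFamily_le_of_ge ht hp hp2 h hs' hr
  obtain ⟨r, hr⟩ := (akMax_isGreatest n p t).1
  dsimp only at hr
  rw [← hr]
  rcases le_or_gt (t + 2 * r) n with h | h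
  · exact hle r h
  -- An oversized `r` is dominated by the largest genuine parameter, `(n - t) / 2`.
  · refine le_trans ?_ (hle ((n - t) / 2) (by omega))
    rw [akFamily_eq_coreFamily, akFamily_eq_coreFamily]
    exact biasedMeasure_mono hp.le (by linarith) (coreFamily_subset_of_lt h (by omega) (by omega)
      (card_initSeg_of_le (by omega)))

theorem le_mul_of_div_le (ht : 1 ≤ t) {r : ℕ} {x : ℝ}
    (h : (r : ℝ) / ((t : ℝ) + 2 * (r : ℝ) - 1) ≤ x) : (r : ℝ) ≤ (t + 2 * r - 1) * x := by
  have ht' : (1 : ℝ) ≤ t := by exact_mod_cast ht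
  have hr : (0 : ℝ) ≤ r := Nat.cast_nonneg _
  rcases (show (0 : ℝ) ≤ t + 2 * r - 1 by linarith).eq_or_lt with h0 | h0
  · have : (r : ℝ) = 0 := by linarith
    rw [← h0, this]; simp
  · rw [div_le_iff₀ h0] at h
    linarith

theorem mul_le_of_le_div {r : ℕ} {x : ℝ}
    (h : x ≤ ((r : ℝ) + 1) / ((t : ℝ) + 2 * (r : ℝ) + 1)) :
    (t + 2 * r + 1) * x ≤ (r : ℝ) + 1 := by
  rw [le_div_iff₀ (by positivity)] at h
  linarith

/-- In the interior of its range of parameters, an extremal family beats the other ones by a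
definite margin. -/
theorem biasedMeasure_akFamily_add_gap_le {ζ : ℝ} (hζ : 0 < ζ) (ht : 1 ≤ t)
    (hp : BiasRange ζ p) {r s : ℕ} (hn : t + 2 * s ≤ n) (hrn : t + 2 * r ≤ n) (hrs : r ≠ s)
    (h1 : (s : ℝ) / ((t : ℝ) + 2 * (s : ℝ) - 1) + ζ < p)
    (h2 : p < ((s : ℝ) + 1) / ((t : ℝ) + 2 * (s : ℝ) + 1) - ζ) :
    biasedMeasure p (akFamily n t r) + ζ ^ (t + 2 * s + 2) ≤
      biasedMeasure p (akFamily n t s) := by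
  have hp0 : 0 < p := hζ.trans_le hp.1
  have hp2 : p < 1 / 2 := by linarith [hp.2]
  have hq : ζ ≤ 1 - p := by linarith [hp.2]
  have hζ1 : ζ ≤ 1 := by linarith [hp.1]
  have ht' : (1 : ℝ) ≤ t := by exact_mod_cast ht
  have hs0 : (0 : ℝ) ≤ s := Nat.cast_nonneg _
  -- The distance `ζ` of `p` from the endpoints becomes a linear slack, so already the step between
  -- `s` and its neighbour has the required size; monotonicity handles the remaining parameters.
  have e1 := le_mul_of_div_le (t := t) ht (r := s) (x := p - ζ) (by linarith)
  have e2 := mul_le_of_le_div (t := t) (r := s) (x := p + ζ) (by linarith)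
  have hw : ∀ k : ℕ, ζ ^ (t + 2 * k + 1) ≤
      ((t + 2 * k).choose (t + k) : ℝ) * (p ^ (t + k) * (1 - p) ^ (k + 1)) := by
    intro k
    have hc : (1 : ℝ) ≤ (t + 2 * k).choose (t + k) := by
      exact_mod_cast Nat.choose_pos (by omega)
    calc ζ ^ (t + 2 * k + 1) = 1 * (ζ ^ (t + k) * ζ ^ (k + 1)) := by
          rw [← pow_add, one_mul]; congr 1; omega
      _ ≤ _ := by
        gcongr
        exact hp.1
  rcases lt_or_gt_of_ne hrs with h | h
  · obtain ⟨k, rfl⟩ : ∃ k, s = k + 1 := ⟨s - 1, by omega⟩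
    push_cast at e1 e2 hs0
    have hk0 : (0 : ℝ) ≤ k := Nat.cast_nonneg _
    have m1 := biasedMeasure_akFamily_le_of_le (n := n) ht hp0 hp2 (show r ≤ k by omega)
      (by nlinarith) (by omega)
    have m2 := biasedMeasure_akFamily_succ_sub (p := p) ht hn
    have m3 : ζ * ((k : ℝ) + 1) ≤ (t + 2 * k + 1) * p - (k + 1) := by nlinarith
    have m4 : ζ ^ (t + 2 * k + 1) * (ζ * ((k : ℝ) + 1)) ≤
        ((t + 2 * k).choose (t + k) : ℝ) * (p ^ (t + k) * (1 - p) ^ (k + 1)) *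
        ((t + 2 * k + 1) * p - (k + 1)) :=
      mul_le_mul (hw k) m3 (by positivity) ((pow_pos hζ _).le.trans (hw k))
    rw [← m2] at m4
    have m5 : ((k : ℝ) + 1) * (ζ ^ (t + 2 * k + 1) * ζ) ≤ ((k : ℝ) + 1) *
        (biasedMeasure p (akFamily n t (k + 1)) - biasedMeasure p (akFamily n t k)) := by
      linarith
    have m6 := le_of_mul_le_mul_left m5 (by positivity)
    have m7 : ζ ^ (t + 2 * (k + 1) + 2) ≤ ζ ^ (t + 2 * k + 1) * ζ := by
      rw [← pow_succ]
      exact pow_le_pow_of_le_one hζ.le hζ1 (by omega)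
    linarith
  · have m1 := biasedMeasure_akFamily_le_of_ge (n := n) ht hp0 hp2 (show s + 1 ≤ r by omega)
      (by push_cast; nlinarith) hrn
    have m2 := biasedMeasure_akFamily_succ_sub (p := p) (n := n) (r := s) ht (by omega)
    have m3 : ζ * ((s : ℝ) + 1) ≤ (s + 1) - (t + 2 * s + 1) * p := by nlinarith
    have m4 : ζ ^ (t + 2 * s + 1) * (ζ * ((s : ℝ) + 1)) ≤
        ((t + 2 * s).choose (t + s) : ℝ) * (p ^ (t + s) * (1 - p) ^ (s + 1)) *
        ((s + 1) - (t + 2 * s + 1) * p) :=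
      mul_le_mul (hw s) m3 (by positivity) ((pow_pos hζ _).le.trans (hw s))
    have m5 : ((s : ℝ) + 1) * (ζ ^ (t + 2 * s + 1) * ζ) ≤ ((s : ℝ) + 1) *
        (biasedMeasure p (akFamily n t s) - biasedMeasure p (akFamily n t (s + 1))) := by
      linarith
    have m6 := le_of_mul_le_mul_left m5 (by positivity)
    have m7 : ζ ^ (t + 2 * s + 2) = ζ ^ (t + 2 * s + 1) * ζ := pow_succ _ _
    linarith

end BiasedIntersection

namespace BiasedIntersection

open Finset

variable {n : ℕ} {p : ℝ} {t : ℕ}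

/-! ### Stability -/

theorem stability (ht : 1 ≤ t) {ζ : ℝ} (hζ : 0 < ζ) (hζ4 : ζ ≤ 1 / 4) :
    ∃ C : ℝ, 0 < C ∧
      ∀ (n : ℕ) (p : ℝ), ζ ≤ p → p ≤ 1 / 2 - ζ →
      ∀ ε : ℝ, 0 < ε →
      ∀ F : Finset (Finset (Fin n)), TIntersecting t F →
        akMax n p t * (1 - ε) ≤ biasedMeasure p F →
        (∃ (r : ℕ) (G : Finset (Finset (Fin n))), FamilyIso (akFamily n t r) G ∧
          biasedMeasure p (F \ G) ≤ C * ε ^ Real.logb (1 - p) p) ∧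
        (∀ r : ℕ, t + 2 * r ≤ n →
          (r : ℝ) / ((t : ℝ) + 2 * (r : ℝ) - 1) + ζ < p →
          p < ((r : ℝ) + 1) / ((t : ℝ) + 2 * (r : ℝ) + 1) - ζ →
          ∃ G : Finset (Finset (Fin n)), FamilyIso (akFamily n t r) G ∧
            biasedMeasure p (F \ G) ≤ C * ε ^ Real.logb (1 - p) p) := by
  obtain ⟨a₀, a₁, ha₀, ha⟩ := exists_exponent_bounds hζ hζ4
  obtain ⟨R, ε₀, C, hε₀, hε₀1, hC, hstab⟩ := exists_stability hζ hζ4 ht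
  obtain ⟨R', hR'⟩ := exists_param_bound hζ ht
  set gap : ℝ := ζ ^ (t + 2 * R' + 2) with hgap
  have hgap0 : 0 < gap := pow_pos hζ _
  set ε₁ : ℝ := min ε₀ (gap / (2 * (C + 1))) with hε₁
  have hε₁0 : 0 < ε₁ := lt_min hε₀ (by positivity)
  have hε₁1 : ε₁ ≤ 1 := (min_le_left _ _).trans hε₀1
  have hiso : ∀ n r : ℕ, FamilyIso (akFamily n t r) (akFamily n t r) := fun n r =>
    ⟨1, by simp⟩
  -- The second term makes the bound at least `1`, hence trivial, when `ε > ε₁`.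
  refine ⟨max C (ε₁ ^ a₁)⁻¹, lt_max_of_lt_left hC, ?_⟩
  intro n p hp1 hp2 ε hε F hF hFε
  have hp : BiasRange ζ p := ⟨hp1, hp2⟩
  obtain ⟨-, ha0, ha1⟩ := ha p hp
  set a := Real.logb (1 - p) p
  have hp0 : 0 < p := hζ.trans_le hp1
  have hple : p ≤ 1 := by linarith
  have hεa : 0 < ε ^ a := Real.rpow_pos_of_pos hε _
  have hmono : C * ε ^ a ≤ max C (ε₁ ^ a₁)⁻¹ * ε ^ a := by
    gcongr
    exact le_max_left _ _
  have hbig : ε₁ < ε → ∀ G : Finset (Finset (Fin n)),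
      biasedMeasure p (F \ G) ≤ max C (ε₁ ^ a₁)⁻¹ * ε ^ a := by
    intro h G
    have h1 : ε₁ ^ a₁ ≤ ε ^ a := (Real.rpow_le_rpow_of_exponent_ge hε₁0 hε₁1 ha1).trans
      (Real.rpow_le_rpow hε₁0.le h.le (by linarith))
    have h2 : 0 < ε₁ ^ a₁ := Real.rpow_pos_of_pos hε₁0 _
    calc biasedMeasure p (F \ G) ≤ 1 := biasedMeasure_le_one hp0.le hple _
      _ = (ε₁ ^ a₁)⁻¹ * ε₁ ^ a₁ := (inv_mul_cancel₀ h2.ne').symm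
      _ ≤ _ := by
        gcongr
        exact le_max_right _ _
  rcases lt_or_ge ε₁ ε with hlt | hle
  · exact ⟨⟨0, _, hiso n 0, hbig hlt _⟩, fun r _ _ _ => ⟨_, hiso n r, hbig hlt _⟩⟩
  rcases lt_or_ge n t with hn | hn
  · rw [eq_empty_of_lt hF hn]
    have h0 : ∀ G : Finset (Finset (Fin n)), biasedMeasure p (∅ \ G) ≤
        max C (ε₁ ^ a₁)⁻¹ * ε ^ a := by
      intro G
      rw [empty_sdiff, biasedMeasure_empty]
      exact (by positivity : 0 ≤ C * ε ^ a).trans hmono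
    exact ⟨⟨0, _, hiso n 0, h0 _⟩, fun r _ _ _ => ⟨_, hiso n r, h0 _⟩⟩
  obtain ⟨r, -, -, M, hM, hFM⟩ :=
    hstab n p hn hp F hF ε hε.le (hle.trans (min_le_left _ _)) hFε
  refine ⟨⟨r, _, familyIso_coreFamily hM, hFM.trans hmono⟩, fun s hs h1 h2 => ?_⟩
  suffices hrs : r = s by
    subst hrs
    exact ⟨_, familyIso_coreFamily hM, hFM.trans hmono⟩
  by_contra hrs
  have hrn : t + 2 * r ≤ n := by
    rw [← hM]; exact (card_le_univ M).trans_eq (Fintype.card_fin n)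
  -- If `r` differed from `s`, then `μ(F)` would be at most `akMax - gap + Cε`, below `akMax * (1 -
  -- ε)` since `(C + 1) ε ≤ gap / 2`.
  have m1 := biasedMeasure_akFamily_add_gap_le hζ ht hp hs hrn hrs h1 h2
  have m2 := biasedMeasure_akFamily_le_akMax n p t s
  have m3 := biasedMeasure_inter_add_sdiff (p := p) F (coreFamily M (t + r))
  have m4 := biasedMeasure_mono hp0.le hple
    (inter_subset_right : F ∩ coreFamily M (t + r) ⊆ coreFamily M (t + r))
  rw [biasedMeasure_coreFamily_eq hM] at m4
  have m5 : gap ≤ ζ ^ (t + 2 * s + 2) := by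
    have := (hR' p hp s (le_mul_of_div_le ht (by linarith))).1
    exact pow_le_pow_of_le_one hζ.le (by linarith) (by omega)
  have m6 : ε ^ a ≤ ε := by
    calc ε ^ a ≤ ε ^ (1 : ℝ) :=
          Real.rpow_le_rpow_of_exponent_ge hε (hle.trans hε₁1) (by linarith)
      _ = ε := Real.rpow_one _
  have m7 : ε ≤ gap / (2 * (C + 1)) := hle.trans (min_le_right _ _)
  rw [le_div_iff₀ (by positivity)] at m7
  have m8 : akMax n p t * ε ≤ 1 * ε := by
    gcongr
    exact akMax_le_one hp0.le hple t
  have m9 : C * ε ^ a ≤ C * ε := by gcongr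
  nlinarith

/-! ### Tightness -/

/-- Two members of the second kind may meet in only `t - 2` points of the core; the block of `s ≥ 2`
common points makes up for this. -/
theorem noisyFamily_tIntersecting {r s : ℕ} (hs : 2 ≤ s) (hn : t + 2 * r + s ≤ n) :
    TIntersecting t (noisyFamily n t r s) := by
  intro A hA B hB
  simp only [noisyFamily, mem_filter, mem_univ, true_and] at hA hB
  set M := initSeg n (t + 2 * r)
  set T := initSeg n (t + 2 * r + s) \ M with hT
  have hTc : T.card = s := by
    rw [hT, card_initSeg_sdiff (by omega) hn]; omega
  have hMc : M.card = t + 2 * r := card_initSeg_of_le (by omega)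
  have hMT : Disjoint M T := disjoint_sdiff
  have h1 := card_union_add_card_inter (A ∩ M) (B ∩ M)
  have h2 : (A ∩ M ∪ B ∩ M).card ≤ M.card :=
    card_le_card (union_subset inter_subset_right inter_subset_right)
  have h3 : (A ∩ M ∩ (B ∩ M)).card + (A ∩ B ∩ T).card ≤ (A ∩ B).card := by
    rw [← card_union_of_disjoint]
    · refine card_le_card fun x => ?_
      simp only [mem_union, mem_inter]
      tauto
    · exact hMT.mono (inter_subset_left.trans inter_subset_right) inter_subset_right
  rcases hA with ⟨hA, hA'⟩ | ⟨hA, hA'⟩ <;> rcases hB with ⟨hB, hB'⟩ | ⟨hB, hB'⟩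
  · omega
  · have h4 : 1 ≤ (A ∩ B ∩ T).card := by
      rw [inter_assoc, inter_eq_right.2 hB']
      exact hA'.card_pos
    omega
  · have h4 : 1 ≤ (A ∩ B ∩ T).card := by
      rw [inter_comm A B, inter_assoc, inter_eq_right.2 hA']
      exact hB'.card_pos
    omega
  · have h4 : (A ∩ B ∩ T).card = s := by
      rw [inter_assoc, inter_eq_right.2 hB', inter_eq_right.2 hA', hTc]
    omega

/-- The measure of the members of `akFamily n t r` that avoid a set outside of its core. -/
theorem biasedMeasure_akFamily_avoid {r : ℕ} {T : Finset (Fin n)}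
    (hT : Disjoint (initSeg n (t + 2 * r)) T) :
    biasedMeasure p ((akFamily n t r).filter fun A => A ∩ T = ∅) =
      (1 - p) ^ T.card * biasedMeasure p (akFamily n t r) := by
  rw [biasedMeasure_slice _ (empty_subset T)]
  have : slice (akFamily n t r) T ∅ = akFamily n t r := by
    ext A
    have h : (A \ T ∪ ∅) ∩ initSeg n (t + 2 * r) = A ∩ initSeg n (t + 2 * r) := by
      ext x
      have h1 : x ∈ initSeg n (t + 2 * r) → x ∉ T := fun h => disjoint_left.1 hT h
      simp only [mem_inter, mem_union, mem_sdiff, notMem_empty, or_false]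
      tauto
    rw [mem_slice, akFamily_eq_coreFamily, mem_coreFamily, mem_coreFamily, h]
  rw [this]
  simp

theorem akFamily_sdiff_subset_noisyFamily (n t r s : ℕ) :
    akFamily n t r \ (akFamily n t r).filter
      (fun A => A ∩ (initSeg n (t + 2 * r + s) \ initSeg n (t + 2 * r)) = ∅) ⊆
      noisyFamily n t r s := by
  intro A hA
  rw [mem_sdiff, mem_filter, not_and] at hA
  have h1 := hA.1
  rw [akFamily_eq_coreFamily, mem_coreFamily] at h1
  simp only [noisyFamily, mem_filter, mem_univ, true_and]
  exact Or.inl ⟨h1, nonempty_iff_ne_empty.2 (hA.2 hA.1)⟩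

theorem biasedMeasure_noisyFamily_sdiff_ge (h0 : 0 ≤ p) (h1 : p ≤ 1) {r s : ℕ}
    (hn : t + 2 * r + s ≤ n) (G : Finset (Finset (Fin n))) :
    biasedMeasure p (akFamily n t r \ G) - (1 - p) ^ s * biasedMeasure p (akFamily n t r) ≤
      biasedMeasure p (noisyFamily n t r s \ G) := by
  set T := initSeg n (t + 2 * r + s) \ initSeg n (t + 2 * r) with hT
  have hTc : T.card = s := by
    rw [hT, card_initSeg_sdiff (by omega) hn]; omega
  have hsub := akFamily_sdiff_subset_noisyFamily n t r s
  have h2 := biasedMeasure_akFamily_avoid (p := p) (t := t) (r := r) (T := T) disjoint_sdiff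
  rw [hTc] at h2
  rw [← h2, sub_le_iff_le_add]
  refine (biasedMeasure_mono h0 h1 ?_).trans (biasedMeasure_union_le h0 h1 _ _)
  intro A hA
  rw [mem_sdiff] at hA
  rw [mem_union]
  by_cases h : A ∈ (akFamily n t r).filter fun A => A ∩ T = ∅
  · exact Or.inr h
  · exact Or.inl (mem_sdiff.2 ⟨hsub (mem_sdiff.2 ⟨hA.1, h⟩), hA.2⟩)

theorem pow_le_trace_weight {ζ : ℝ} (hζ : 0 < ζ) (hp : BiasRange ζ p) (D K : Finset (Fin n))
    (hD : D ⊆ K) : ζ ^ K.card ≤ p ^ D.card * (1 - p) ^ (K.card - D.card) := by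
  have h1 : ζ ≤ 1 - p := by linarith [hp.2, hp.1]
  have h2 : ζ ≤ p := hp.1
  have h0 : 0 ≤ p := hζ.le.trans h2
  have h3 := card_le_card hD
  calc ζ ^ K.card = ζ ^ D.card * ζ ^ (K.card - D.card) := by rw [← pow_add]; congr 1; omega
    _ ≤ _ := by gcongr

/-- A core family is not contained in a core family with a different core. -/
theorem exists_trace_of_ne {M N : Finset (Fin n)} {r k : ℕ} (ht : 1 ≤ t)
    (hM : M.card = t + 2 * r) (hN : N.card = t + 2 * k) (h : M ≠ N) :
    ∃ D ⊆ M, D.card = t + r ∧ (D ∩ N).card < t + k := by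
  have h1 : M.card - N.card ≤ (M \ N).card := le_card_sdiff N M
  have h2 : r = k → 1 ≤ (M \ N).card := by
    rintro rfl
    refine card_pos.2 (sdiff_nonempty.2 fun hsub => h ?_)
    exact eq_of_subset_of_card_le hsub (by omega)
  -- Put as many elements of `M \ N` as possible into `D`. At least `2 (r - k)` are available if `r
  -- > k`, and one if `r = k`; for `r < k` the size of `D` suffices.
  obtain ⟨P, hP, hPc⟩ := exists_subset_card_eq (min_le_right (t + r) (M \ N).card)
  obtain ⟨D, hPD, hDM, hD⟩ := exists_subsuperset_card_eq (hP.trans sdiff_subset)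
    (hPc.trans_le (min_le_left _ _)) (show t + r ≤ M.card by omega)
  refine ⟨D, hDM, hD, ?_⟩
  have h3 : (D ∩ N).card ≤ (D \ P).card := card_le_card fun x hx => by
    rw [mem_inter] at hx
    exact mem_sdiff.2 ⟨hx.1, fun hxP => (mem_sdiff.1 (hP hxP)).2 hx.2⟩
  rw [card_sdiff_of_subset hPD, hPc, hD] at h3
  omega

/-- Distinct core families are far apart. -/
theorem exists_le_biasedMeasure_akFamily_sdiff {ζ : ℝ} (hζ : 0 < ζ) (hζ4 : ζ ≤ 1 / 4)
    (ht : 1 ≤ t) (R : ℕ) : ∃ d, 0 < d ∧ ∀ (n : ℕ) (p : ℝ), BiasRange ζ p → ∀ r ≤ R,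
      t + 2 * r ≤ n → akMax n p t = biasedMeasure p (akFamily n t r) →
      ∀ (k : ℕ) (N : Finset (Fin n)), N.card = t + 2 * k → initSeg n (t + 2 * r) ≠ N →
        d ≤ biasedMeasure p (akFamily n t r \ coreFamily N (t + k)) := by
  obtain ⟨m, hm⟩ := exists_half_small hζ hζ4 (δ := ζ ^ t / 2) (by positivity)
  refine ⟨min (ζ ^ t / 2) (ζ ^ (t + 2 * R + m)), by positivity, ?_⟩
  intro n p hp r hr hn hmax k N hN hne
  have hp0 : 0 < p := hζ.trans_le hp.1
  have hple : p ≤ 1 := by linarith [hp.2]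
  -- A large core gives a family too small to cover half of the extremal measure; for a small core a
  -- single trace on `M ∪ N` already has bounded weight.
  rcases le_or_gt m N.card with h | h
  · refine (min_le_left _ _).trans ?_
    have h1 := biasedMeasure_inter_add_sdiff (p := p) (akFamily n t r) (coreFamily N (t + k))
    have h2 := hm n p hp N h
    have h3 : biasedMeasure p (akFamily n t r ∩ coreFamily N (t + k)) ≤
        biasedMeasure p (univ.filter fun A => N.card ≤ 2 * (A ∩ N).card) := by
      refine biasedMeasure_mono hp0.le hple fun A hA => ?_
      have hA := mem_coreFamily.1 (mem_inter.1 hA).2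
      exact mem_filter.2 ⟨mem_univ _, by omega⟩
    have h4 : ζ ^ t ≤ p ^ t := pow_le_pow_left₀ hζ.le hp.1 t
    have h5 := pow_le_akMax hp0.le hple (show t ≤ n by omega)
    linarith
  · refine (min_le_right _ _).trans ?_
    set M := initSeg n (t + 2 * r) with hM
    have hMc : M.card = t + 2 * r := card_initSeg_of_le hn
    obtain ⟨D, hDM, hD, hDN⟩ := exists_trace_of_ne ht hMc hN hne
    have hDU : D ⊆ M ∪ N := hDM.trans subset_union_left
    have h1 := pow_le_trace_weight hζ hp D (M ∪ N) hDU
    rw [← biasedMeasure_trace_eq hDU] at h1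
    have h2 : ζ ^ (t + 2 * R + m) ≤ ζ ^ (M ∪ N).card := by
      have := card_union_le M N
      exact pow_le_pow_of_le_one hζ.le (by linarith) (by omega)
    refine (h2.trans h1).trans (biasedMeasure_mono hp0.le hple fun A hA => ?_)
    have hA := (mem_filter.1 hA).2
    have e1 : A ∩ M = D := by
      rw [← inter_eq_left.2 hDM, ← hA, inter_assoc, inter_eq_right.2 subset_union_left]
    have e2 : A ∩ N = D ∩ N := by
      rw [← hA, inter_assoc, inter_eq_right.2 subset_union_right]
    rw [mem_sdiff, akFamily_eq_coreFamily, mem_coreFamily, mem_coreFamily, ← hM, e1, e2]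
    omega

theorem le_biasedMeasure_noisyFamily_sdiff_self {ζ : ℝ} (hζ : 0 < ζ) (hp : BiasRange ζ p)
    (ht : 1 ≤ t) {r s : ℕ} (hn : t + 2 * r + s ≤ n) :
    ζ ^ (t + 2 * r) * p ^ s ≤ biasedMeasure p (noisyFamily n t r s \ akFamily n t r) := by
  have hp0 : 0 < p := hζ.trans_le hp.1
  have hple : p ≤ 1 := by linarith [hp.2]
  set M := initSeg n (t + 2 * r) with hM
  set T := initSeg n (t + 2 * r + s) \ M with hT
  have hTc : T.card = s := by
    rw [hT, card_initSeg_sdiff (by omega) hn]; omega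
  have hMc : M.card = t + 2 * r := card_initSeg_of_le (by omega)
  have hMT : Disjoint M T := disjoint_sdiff
  obtain ⟨D, hDM, hD⟩ := exists_subset_card_eq (show t + r - 1 ≤ M.card by omega)
  have h1 := biasedMeasure_layer_trace (p := p) hMT Subset.rfl (t + r - 1)
  have h2 := pow_le_trace_weight hζ hp D M hDM
  have h3 : (1 : ℝ) ≤ M.card.choose (t + r - 1) := by
    exact_mod_cast Nat.choose_pos (by omega)
  rw [hD] at h2
  have h4 : ζ ^ M.card ≤ M.card.choose (t + r - 1) *
      (p ^ (t + r - 1) * (1 - p) ^ (M.card - (t + r - 1))) :=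
    h2.trans (le_mul_of_one_le_left ((pow_pos hζ _).le.trans h2) h3)
  calc ζ ^ (t + 2 * r) * p ^ s = p ^ s * ζ ^ M.card := by rw [hMc, mul_comm]
    _ ≤ p ^ s * (M.card.choose (t + r - 1) *
      (p ^ (t + r - 1) * (1 - p) ^ (M.card - (t + r - 1)))) := by gcongr
    _ = biasedMeasure p ((layer univ M (t + r - 1)).filter fun A => A ∩ T = T) := by
      rw [h1, hTc]; simp
    _ ≤ _ := by
      refine biasedMeasure_mono hp0.le hple fun A hA => ?_
      rw [mem_filter, mem_layer] at hA
      rw [mem_sdiff, akFamily_eq_coreFamily, mem_coreFamily, ← hM]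
      simp only [noisyFamily, mem_filter, mem_univ, true_and]
      rw [← hM]
      exact ⟨Or.inr ⟨by omega, inter_eq_right.1 hA.2⟩, by omega⟩

theorem tightness (ht : 1 ≤ t) {ζ : ℝ} (hζ : 0 < ζ) (hζ4 : ζ ≤ 1 / 4) :
    ∃ c : ℝ, 0 < c ∧ ∃ s₀ : ℕ,
      ∀ p : ℝ, ζ ≤ p → p ≤ 1 / 2 - ζ →
      ∀ r : ℕ, (r : ℝ) / ((t : ℝ) + 2 * (r : ℝ) - 1) ≤ p →
        p ≤ ((r : ℝ) + 1) / ((t : ℝ) + 2 * (r : ℝ) + 1) →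
      ∀ s : ℕ, s₀ ≤ s → ∀ n : ℕ, t + 2 * r + s ≤ n →
        TIntersecting t (noisyFamily n t r s) ∧
        akMax n p t * (1 - (1 - p) ^ s) ≤ biasedMeasure p (noisyFamily n t r s) ∧
        ∀ (r' : ℕ) (G : Finset (Finset (Fin n))), FamilyIso (akFamily n t r') G →
          c * ((1 - p) ^ s) ^ Real.logb (1 - p) p ≤
            biasedMeasure p (noisyFamily n t r s \ G) := by
  obtain ⟨a₀, a₁, ha₀, ha⟩ := exists_exponent_bounds hζ hζ4
  obtain ⟨R, hR⟩ := exists_param_bound hζ ht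
  obtain ⟨d, hd, hdist⟩ := exists_le_biasedMeasure_akFamily_sdiff hζ hζ4 ht R
  obtain ⟨s₁, hs₁⟩ := exists_pow_lt_of_lt_one (half_pos hd) (show 1 - ζ < 1 by linarith)
  refine ⟨min (d / 2) (ζ ^ (t + 2 * R)), by positivity, max 2 s₁, ?_⟩
  intro p hp1 hp2 r hr1 hr2 s hs n hn
  have hp : BiasRange ζ p := ⟨hp1, hp2⟩
  have hp0 : 0 < p := hζ.trans_le hp1
  have hple : p ≤ 1 := by linarith
  have hq : 0 < 1 - p := by linarith
  have hr1 := le_mul_of_div_le ht hr1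
  have hrR := (hR p hp r hr1).1
  have hmax := akMax_eq (n := n) ht hp0 (by linarith) hr1 (mul_le_of_le_div hr2) (by omega)
  have hs2 : 2 ≤ s := (le_max_left _ _).trans hs
  refine ⟨noisyFamily_tIntersecting hs2 hn, ?_, ?_⟩
  · have h := biasedMeasure_noisyFamily_sdiff_ge (t := t) hp0.le hple hn ∅
    rw [sdiff_empty, sdiff_empty] at h
    rw [hmax]
    linarith
  intro r' G hG
  -- This identifies the target `ε ^ log_{1-p} p` as `p ^ s`.
  have hpow : ((1 - p) ^ s) ^ Real.logb (1 - p) p = p ^ s := by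
    rw [← Real.rpow_natCast, ← Real.rpow_mul hq.le, mul_comm, Real.rpow_mul hq.le,
      (ha p hp).1.rpow_eq, Real.rpow_natCast]
  rw [hpow]
  have hps : p ^ s ≤ 1 := pow_le_one₀ hp0.le hple
  have hfar : ∀ (k : ℕ) (N : Finset (Fin n)), N.card = t + 2 * k →
      initSeg n (t + 2 * r) ≠ N → min (d / 2) (ζ ^ (t + 2 * R)) * p ^ s ≤
        biasedMeasure p (noisyFamily n t r s \ coreFamily N (t + k)) := by
    intro k N hN hne
    have h1 := hdist n p hp r hrR (by omega) hmax k N hN hne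
    have h2 := biasedMeasure_noisyFamily_sdiff_ge hp0.le hple hn (coreFamily N (t + k))
    have h3 : (1 - p) ^ s ≤ d / 2 :=
      calc (1 - p) ^ s ≤ (1 - p) ^ s₁ :=
            pow_le_pow_of_le_one hq.le (by linarith) ((le_max_right _ _).trans hs)
        _ ≤ (1 - ζ) ^ s₁ := by gcongr
        _ ≤ d / 2 := hs₁.le
    have h4 : (1 - p) ^ s * biasedMeasure p (akFamily n t r) ≤ (1 - p) ^ s * 1 := by
      gcongr
      exact biasedMeasure_le_one hp0.le hple _
    have h5 : min (d / 2) (ζ ^ (t + 2 * R)) * p ^ s ≤ d / 2 * 1 := by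
      gcongr
      exact min_le_left _ _
    linarith
  obtain ⟨N, hN, rfl⟩ := exists_core_of_familyIso hG
  rcases lt_or_ge n (t + 2 * r') with h | h
  -- A truncated core is replaced by the genuine core of parameter `(n - t) / 2`; this differs from
  -- `r` because `n ≥ t + 2 * r + s` with `s ≥ 2`.
  · have hc : (initSeg n (t + 2 * ((n - t) / 2))).card = t + 2 * ((n - t) / 2) :=
      card_initSeg_of_le (by omega)
    refine (hfar _ _ hc fun heq => ?_).trans (biasedMeasure_mono hp0.le hple
      (sdiff_subset_sdiff Subset.rfl (coreFamily_subset_of_lt h (by omega) (by omega) hc)))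
    have := congrArg card heq
    rw [hc, card_initSeg_of_le (by omega)] at this
    omega
  · rw [card_initSeg_of_le h] at hN
    by_cases heq : initSeg n (t + 2 * r) = N
    · subst heq
      rw [card_initSeg_of_le (by omega)] at hN
      obtain rfl : r = r' := by omega
      refine le_trans ?_ (le_biasedMeasure_noisyFamily_sdiff_self hζ hp ht hn)
      gcongr
      exact (min_le_right _ _).trans (pow_le_pow_of_le_one hζ.le (by linarith) (by omega))
    · exact hfar r' N hN heq

end BiasedIntersection

theorem mainTheorem3 (t : ℕ) (ht : 1 ≤ t) (ζ : ℝ) (hζ : 0 < ζ) :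
    -- stability, with a constant depending only on `t` and `ζ`
    (∃ C : ℝ, 0 < C ∧
      ∀ (n : ℕ) (p : ℝ), ζ ≤ p → p ≤ 1 / 2 - ζ →
      ∀ ε : ℝ, 0 < ε →
      ∀ F : Finset (Finset (Fin n)), TIntersecting t F →
        akMax n p t * (1 - ε) ≤ biasedMeasure p F →
        (∃ (r : ℕ) (G : Finset (Finset (Fin n))), FamilyIso (akFamily n t r) G ∧
          biasedMeasure p (F \ G) ≤ C * ε ^ Real.logb (1 - p) p) ∧
        (∀ r : ℕ, t + 2 * r ≤ n →
          (r : ℝ) / ((t : ℝ) + 2 * (r : ℝ) - 1) + ζ < p →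
          p < ((r : ℝ) + 1) / ((t : ℝ) + 2 * (r : ℝ) + 1) - ζ →
          ∃ G : Finset (Finset (Fin n)), FamilyIso (akFamily n t r) G ∧
            biasedMeasure p (F \ G) ≤ C * ε ^ Real.logb (1 - p) p)) ∧
    -- tightness up to a factor depending only on `t` and `ζ`, with `ε = (1 - p) ^ s`
    (∃ c : ℝ, 0 < c ∧ ∃ s₀ : ℕ,
      ∀ p : ℝ, ζ ≤ p → p ≤ 1 / 2 - ζ →
      ∀ r : ℕ, (r : ℝ) / ((t : ℝ) + 2 * (r : ℝ) - 1) ≤ p →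
        p ≤ ((r : ℝ) + 1) / ((t : ℝ) + 2 * (r : ℝ) + 1) →
      ∀ s : ℕ, s₀ ≤ s → ∀ n : ℕ, t + 2 * r + s ≤ n →
        TIntersecting t (noisyFamily n t r s) ∧
        akMax n p t * (1 - (1 - p) ^ s) ≤ biasedMeasure p (noisyFamily n t r s) ∧
        ∀ (r' : ℕ) (G : Finset (Finset (Fin n))), FamilyIso (akFamily n t r') G →
          c * ((1 - p) ^ s) ^ Real.logb (1 - p) p ≤
            biasedMeasure p (noisyFamily n t r s \ G)) := by
  -- For `ζ > 1/4` the interval `[ζ, 1/2 - ζ]` is empty and both claims are vacuous.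
  rcases le_or_gt ζ (1 / 4) with hζ4 | hζ4
  · exact ⟨BiasedIntersection.stability ht hζ hζ4, BiasedIntersection.tightness ht hζ hζ4⟩
  · exact ⟨⟨1, one_pos, fun n p h1 h2 => by linarith⟩,
      ⟨1, one_pos, 0, fun p h1 h2 => by linarith⟩⟩
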